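/- Let $R$ and $V$ be compact $C^1$ manifolds (possibly with boundary and corners) embedded in $\mathbb{R}^d$, with surface measures $\sigma$ and $\sigma'$; assume that every connected component of $R$ has nonempty boundary. Let $H^1_0(R)$ be the closure in $H^1(R)$ of the $C^1$ functions with compact support in the interior of $R$, with the inner product $\langle\phi,\psi\rangle=\int_R\nabla\phi\cdot\nabla\psi\,d\sigma$ and the associated norm ($\nabla$ is the tangential gradient). Let $B\subset\mathbb{R}^p$ be compact, let $B'\subset\mathbb{R}^p$ be open with $B\subset B'$, and let $H_m:V\times R\to\mathbb{R}$, $m\in B'$, be kernels such that - (R1) $(m,x,y)\mapsto H_m(x,y)$ and its tangential gradient $(m,x,y)\mapsto\nabla_xH_m(x,y)$ (exist and) are continuous on $B\times V\times R$; - (R2) for $1\le i,j\le p$ the derivatives $\partial_{m_i}H_m(x,y)$, $\partial_{m_i}\nabla_xH_m(x,y)$ and $\partial_{m_i}\partial_{m_j}H_m(x,y)$ exist and are continuous in $(m,x,y)$ on $B'\times V\times R$. Define $A_m:H^1_0(R)\to L^2(V)$ by $A_mg(x)=\int_RH_m(x,y)g(y)\,d\sigma(y)$, and for a unit vector $q\in\mathbb{R}^p$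 let $\partial_qA_m$ be the derivative of $m\mapsto A_m$ in the direction $q$. Assume that - (U1) for all $m_1,m_2\in B$ and $u,v\in H^1_0(R)$: if $A_{m_1}u=A_{m_2}v$ in $L^2(V)$ and $u\ne0$ or $v\neq0$, then $m_1=m_2$ and $u=v$; - (U2) for all unit vectors $q\in\mathbb{R}^p$, all $m\in B$ and all $u,v\in H^1_0(R)$: if $\partial_qA_mu=A_mv$ in $L^2(V)$, then $u=v=0$. Let $A_m^*:L^2(V)\to H^1_0(R)$ be the adjoint of $A_m$ for the inner products above. Fix $\beta>0$ and let $E_m\subset H^1_0(R)$ be the span of the eigenvectors of $A_m^*A_m$ whose eigenvalues are strictly greater than $\beta^2$. Then for every fixed $m_0\in B$ and every fixed $v_0\neq0$ in $H^1_0(R)$ there is a constant $C_{v_0}>0$ such that $$\|A_mu-A_{m_0}v_0\|_{L^2(V)}\ \ge\ C_{v_0}\,|m-m_0|\qquad\text{for all } m\in B \text{ and all } u\in E_m .$$ -/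

import Mathlib

open MeasureTheory Set
open scoped MeasureTheory

noncomputable section

namespace KernelInverse

/-- Euclidean space `ℝⁿ`. -/
abbrev Eu (n : ℕ) := EuclideanSpace ℝ (Fin n)

/-! ### Compact embedded manifolds -/

/-- `Φ` is a local `C¹` diffeomorphism of `ℝᵈ` that straightens `S`, near the points of its domain,
to an open piece of the corner `{z : zᵢ = 0 for i ≥ n, zᵢ ≥ 0 for i ∈ I}` of `ℝⁿ × {0}`, where
`I ⊆ {0, …, n - 1}`. With `I = ∅` this is a chart at interior points, with `I` a singleton a chart
at points of a smooth boundary, and with larger `I` a chart at corners. -/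
structure IsCornerChart {d : ℕ} (S : Set (Eu d)) (n : ℕ)
    (Φ : OpenPartialHomeomorph (Eu d) (Eu d)) (I : Finset (Fin d)) : Prop where
  dim_le : n ≤ d
  index_lt : ∀ i ∈ I, i.val < n
  contDiffOn_toFun : ContDiffOn ℝ 1 Φ Φ.source
  contDiffOn_symm : ContDiffOn ℝ 1 Φ.symm Φ.target
  straightens : ∀ x ∈ Φ.source,
    (x ∈ S ↔ (∀ i : Fin d, n ≤ i.val → Φ x i = 0) ∧ ∀ i ∈ I, 0 ≤ Φ x i)

/-- `S` is a compact `n`-dimensional `C¹` manifold embedded in `ℝᵈ`, possibly with boundary and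
corners. -/
structure IsCompactManifold {d : ℕ} (S : Set (Eu d)) (n : ℕ) : Prop where
  isCompact : IsCompact S
  exists_chart : ∀ x ∈ S, ∃ (Φ : OpenPartialHomeomorph (Eu d) (Eu d)) (I : Finset (Fin d)),
    IsCornerChart S n Φ I ∧ x ∈ Φ.source

/-- The manifold boundary of `S`: the points that some chart sends to a face of its corner. -/
def bdry {d : ℕ} (S : Set (Eu d)) (n : ℕ) : Set (Eu d) :=
  {x | x ∈ S ∧ ∃ (Φ : OpenPartialHomeomorph (Eu d) (Eu d)) (I : Finset (Fin d)),
    IsCornerChart S n Φ I ∧ x ∈ Φ.source ∧ ∃ i ∈ I, Φ x i = 0}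

/-- Every connected component of `S` has a nonempty boundary. -/
def ComponentsHaveBoundary {d : ℕ} (S : Set (Eu d)) (n : ℕ) : Prop :=
  ∀ x ∈ S, (connectedComponentIn S x ∩ bdry S n).Nonempty

/-- The surface measure of an `n`-dimensional `S ⊆ ℝᵈ`: `n`-dimensional Hausdorff measure on `S`,
normalized to agree with Lebesgue measure on `ℝⁿ`. -/
def surfaceMeasure {d : ℕ} (S : Set (Eu d)) (n : ℕ) : Measure (Eu d) :=
  (μHE[n] : Measure (Eu d)).restrict S

/-- The tangent space of `S` at `x`, as a linear subspace of `ℝᵈ`. -/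
def tangentPlane {d : ℕ} (S : Set (Eu d)) (x : Eu d) : Submodule ℝ (Eu d) :=
  Submodule.span ℝ (tangentConeAt ℝ S x)

/-- `g` is the (tangential) gradient at `x` of a function `f` on `S`. -/
def IsSurfaceGradient {d : ℕ} (S : Set (Eu d)) (f : Eu d → ℝ) (g x : Eu d) : Prop :=
  g ∈ tangentPlane S x ∧ HasGradientWithinAt f g S x

/-! ### The space `H¹₀(R)` -/

/-- The tangential gradient along `S` of a function that is `C¹` on all of `ℝᵈ`. -/
def surfaceGrad {d : ℕ} (S : Set (Eu d)) (f : Eu d → ℝ) (x : Eu d) : Eu d :=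
  (tangentPlane S x).starProjection (gradient f x)

/-- The pairs `(f, ∇f)` in `L²(R) × L²(R; ℝᵈ)`, where `f` is a `C¹` function on `R` whose support
does not meet the boundary of `R`. (Each such function is the restriction of a `C¹` function on
`ℝᵈ` whose support does not meet the boundary of `R`.) -/
def testPairs {d : ℕ} (R : Set (Eu d)) (r : ℕ) :
    Set (Lp ℝ 2 (surfaceMeasure R r) × Lp (Eu d) 2 (surfaceMeasure R r)) :=
  {P | ∃ f : Eu d → ℝ, ContDiff ℝ 1 f ∧ Disjoint (tsupport f) (bdry R r) ∧
    P.1 =ᵐ[surfaceMeasure R r] f ∧ P.2 =ᵐ[surfaceMeasure R r] surfaceGrad R f}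

/-- `H¹₀(R)`: the closure in `H¹` of the `C¹` functions with compact support in the interior of `R`.
An element is stored as the pair `(u, ∇u)`. -/
def H10 {d : ℕ} (R : Set (Eu d)) (r : ℕ) :
    Submodule ℝ (Lp ℝ 2 (surfaceMeasure R r) × Lp (Eu d) 2 (surfaceMeasure R r)) :=
  (Submodule.span ℝ (testPairs R r)).topologicalClosure

/-- The inner product `⟨u, v⟩ = ∫_R ∇u · ∇v dσ` of `H¹₀(R)`. -/
def gradInner {d : ℕ} {R : Set (Eu d)} {r : ℕ} (u v : H10 R r) : ℝ :=
  ∫ y, inner ℝ (u.1.2 y) (v.1.2 y) ∂(surfaceMeasure R r)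

/-! ### The operators `A_m` -/

/-- `(A_m u)(x) = ∫_R H_m(x, y) u(y) dσ(y)`. -/
def opA {p d : ℕ} {R : Set (Eu d)} {r : ℕ} (H : Eu p → Eu d → Eu d → ℝ) (m : Eu p)
    (u : H10 R r) (x : Eu d) : ℝ :=
  ∫ y, H m x y * u.1.1 y ∂(surfaceMeasure R r)

/-- `∂_q A_m u`, the derivative of `m ↦ A_m u` in the direction `q`. -/
def opDA {p d : ℕ} {R : Set (Eu d)} {r : ℕ} (H : Eu p → Eu d → Eu d → ℝ) (q m : Eu p)
    (u : H10 R r) (x : Eu d) : ℝ :=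
  lineDeriv ℝ (fun m' => opA H m' u x) m q

/-- The inner product of `L²(V)`. -/
def innerL2 {d : ℕ} (V : Set (Eu d)) (s : ℕ) (ψ χ : Eu d → ℝ) : ℝ :=
  ∫ x, ψ x * χ x ∂(surfaceMeasure V s)

/-- The norm of `L²(V)`. -/
def normL2 {d : ℕ} (V : Set (Eu d)) (s : ℕ) (ψ : Eu d → ℝ) : ℝ :=
  Real.sqrt (∫ x, |ψ x| ^ 2 ∂(surfaceMeasure V s))

/-- `w = A_m^* ψ`, where `A_m^* : L²(V) → H¹₀(R)` is the adjoint of `A_m : H¹₀(R) → L²(V)` for the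
inner product `∫ ∇u · ∇v` on `H¹₀(R)`. -/
def IsAdjointImage {p d : ℕ} {R : Set (Eu d)} {r : ℕ} (V : Set (Eu d)) (s : ℕ)
    (H : Eu p → Eu d → Eu d → ℝ) (m : Eu p) (ψ : Eu d → ℝ) (w : H10 R r) : Prop :=
  ∀ φ : H10 R r, gradInner w φ = innerL2 V s ψ (opA H m φ)

/-- `u` is an eigenvector of `A_m^* A_m` for the eigenvalue `lam`. -/
def IsEigenvector {p d : ℕ} {R : Set (Eu d)} {r : ℕ} (V : Set (Eu d)) (s : ℕ)
    (H : Eu p → Eu d → Eu d → ℝ) (m : Eu p) (lam : ℝ) (u : H10 R r) : Prop :=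
  u ≠ 0 ∧ IsAdjointImage V s H m (opA H m u) (lam • u)

/-- `E_m`: the span of the eigenvectors of `A_m^* A_m` with eigenvalue strictly greater than
`β²`. -/
def eigenspan {p d : ℕ} (R : Set (Eu d)) (r : ℕ) (V : Set (Eu d)) (s : ℕ)
    (H : Eu p → Eu d → Eu d → ℝ) (β : ℝ) (m : Eu p) : Submodule ℝ (H10 R r) :=
  Submodule.span ℝ {u | ∃ lam : ℝ, β ^ 2 < lam ∧ IsEigenvector V s H m lam u}

/-! ### Regularity and uniqueness assumptions -/

/-- The kernel `H` and its gradient in `x` are continuous on `B × V × R`, and the derivatives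
`∂_{m_i} H`, `∂_{m_i} ∇_x H`, `∂_{m_i} ∂_{m_j} H` exist and are continuous on `B' × V × R`, where
`B'` is an open set that contains `B`. Only the values of `H` on `B' × V × R` matter. -/
structure KernelRegular {p d : ℕ} (B B' : Set (Eu p)) (V R : Set (Eu d))
    (H : Eu p → Eu d → Eu d → ℝ) : Prop where
  isOpen : IsOpen B'
  subset : B ⊆ B'
  continuousOn : ContinuousOn (fun z : Eu p × Eu d × Eu d => H z.1 z.2.1 z.2.2) (B ×ˢ V ×ˢ R)
  gradient : ∃ G : Eu p → Eu d → Eu d → Eu d,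
    (∀ m ∈ B', ∀ x ∈ V, ∀ y ∈ R, IsSurfaceGradient V (fun x' => H m x' y) (G m x y) x) ∧
    ContinuousOn (fun z : Eu p × Eu d × Eu d => G z.1 z.2.1 z.2.2) (B ×ˢ V ×ˢ R) ∧
    ∀ i : Fin p, ∃ DG : Eu p → Eu d → Eu d → Eu d,
      (∀ m ∈ B', ∀ x ∈ V, ∀ y ∈ R,
        HasLineDerivAt ℝ (fun m' => G m' x y) (DG m x y) m (EuclideanSpace.single i 1)) ∧
      ContinuousOn (fun z : Eu p × Eu d × Eu d => DG z.1 z.2.1 z.2.2) (B' ×ˢ V ×ˢ R)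
  paramDeriv : ∀ j : Fin p, ∃ D : Eu p → Eu d → Eu d → ℝ,
    (∀ m ∈ B', ∀ x ∈ V, ∀ y ∈ R,
      HasLineDerivAt ℝ (fun m' => H m' x y) (D m x y) m (EuclideanSpace.single j 1)) ∧
    ContinuousOn (fun z : Eu p × Eu d × Eu d => D z.1 z.2.1 z.2.2) (B' ×ˢ V ×ˢ R) ∧
    ∀ i : Fin p, ∃ DD : Eu p → Eu d → Eu d → ℝ,
      (∀ m ∈ B', ∀ x ∈ V, ∀ y ∈ R,
        HasLineDerivAt ℝ (fun m' => D m' x y) (DD m x y) m (EuclideanSpace.single i 1)) ∧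
      ContinuousOn (fun z : Eu p × Eu d × Eu d => DD z.1 z.2.1 z.2.2) (B' ×ˢ V ×ˢ R)

/-- If `A_{m₁} u = A_{m₂} v` in `L²(V)` and `u ≠ 0` or `v ≠ 0`, then `m₁ = m₂` and `u = v`. -/
def UniqueSource {p d : ℕ} (B : Set (Eu p)) (R : Set (Eu d)) (r : ℕ) (V : Set (Eu d)) (s : ℕ)
    (H : Eu p → Eu d → Eu d → ℝ) : Prop :=
  ∀ m₁ ∈ B, ∀ m₂ ∈ B, ∀ u v : H10 R r,
    opA H m₁ u =ᵐ[surfaceMeasure V s] opA H m₂ v → u ≠ 0 ∨ v ≠ 0 → m₁ = m₂ ∧ u = v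

/-- If `∂_q A_m u = A_m v` in `L²(V)` for some unit vector `q`, then `u = v = 0`. -/
def UniqueDerivative {p d : ℕ} (B : Set (Eu p)) (R : Set (Eu d)) (r : ℕ) (V : Set (Eu d)) (s : ℕ)
    (H : Eu p → Eu d → Eu d → ℝ) : Prop :=
  ∀ q : Eu p, ‖q‖ = 1 → ∀ m ∈ B, ∀ u v : H10 R r,
    opDA H q m u =ᵐ[surfaceMeasure V s] opA H m v → u = 0 ∧ v = 0

end KernelInverse

end

/-! The argument is by contradiction and compactness. Suppose `m n ∈ B` and `u n` in the eigenspan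
of `A (m n)` satisfy `‖A (m n) (u n) - A m₀ v₀‖ < ‖m n - m₀‖ / (n + 1)`. The `u n` are bounded, so
along an ultrafilter `m n` converges and `u n` converges weakly; compactness of the operators and
(U1) identify the limits as `m₀` and `v₀`. Put `t n = ‖m n - m₀‖`, let `q` be the limit of `(m n -
m₀) / t n`, and set `y n = (u n - v₀) / t n`. If `y n` is bounded, with weak limit `y`, then
dividing by `t n` gives `∂_q A v₀ + A m₀ y = 0` in the limit, and (U2) forces `v₀ = 0`.

The difficulty is the bound on `y n`, since a compact operator has no bounded inverse. The
eigenspans supply it. Let `P` be the spectral projection of `A₀* A₀`, where `A₀ = A m₀`, onto the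
eigenvalues above a small `γ`. The eigenspan of `A m` is almost contained in the range of `P`: `‖u -
P u‖ ≤ c ‖A m - A₀‖ ‖u‖` (`norm_sub_spectral_projection_le`). Hence `v₀ = P v₀`, and `u n - v₀` is
the sum of `u n - P (u n)`, which is `O(t n)`, and `P (u n - v₀)`, which is `O(t n)` because `A₀*
A₀` is bounded below by `γ` on the range of `P` and `A₀ (u n - v₀) = O(t n)`. This is
`exists_mul_norm_sub_le_of_inner_eq`.

That argument takes place in `H¹₀` with the inner product `⟨∇u, ∇v⟩ + ⟨A₀ u, A₀ v⟩`, and adjoints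
are taken for it. The eigenspans depend only on the forms `⟨∇u, ∇v⟩` and `⟨A m u, A m v⟩`, so they
are unaffected. The new norm is equivalent to the `H¹` norm: Poincaré inequalities in charts bound
the `H¹` norm by `‖∇u‖` plus finitely many functionals (`exists_H10_estimate`), and these can be
traded for `A₀`, which is injective by (U1) (`exists_norm_le_of_finiteDimensional`).

The remaining analytic input is that integral operators with continuous kernels are compact, and
that `A m` is continuous on `B` and differentiable at `m₀` in operator norm. -/

namespace KernelInverse

open Filter Topology

/-! ### Weak limits and compact operators -/

section WeakLimits

variable {X Y : Type*} [NormedAddCommGroup X] [InnerProductSpace ℝ X] [CompleteSpace X]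
  [NormedAddCommGroup Y] [InnerProductSpace ℝ Y] [CompleteSpace Y]

/-- A bounded family in a Hilbert space has a weak limit along every ultrafilter. -/
theorem exists_weak_limit {ι : Type*} (l : Ultrafilter ι) (u : ι → X) (C : ℝ)
    (hu : ∀ᶠ i in (l : Filter ι), ‖u i‖ ≤ C) :
    ∃ v : X, ∀ φ : X, Tendsto (fun i => inner ℝ (u i) φ) l (𝓝 (inner ℝ v φ)) := by
  -- Riesz representation followed by Banach–Alaoglu; an ultrafilter makes the extraction of
  -- subsequences unnecessary.
  let f : ι → WeakDual ℝ X := fun i => StrongDual.toWeakDual (InnerProductSpace.toDual ℝ X (u i))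
  have hK := WeakDual.isCompact_closedBall (𝕜 := ℝ) (E := X) 0 C
  have hle : ((l.map f : Ultrafilter _) : Filter (WeakDual ℝ X)) ≤
      𝓟 (WeakDual.toStrongDual ⁻¹' Metric.closedBall 0 C) := by
    rw [le_principal_iff, Ultrafilter.mem_coe, Ultrafilter.mem_map]
    refine hu.mono fun i hi => ?_
    simpa [f] using! hi
  obtain ⟨g, -, hg⟩ := hK.ultrafilter_le_nhds _ hle
  refine ⟨(InnerProductSpace.toDual ℝ X).symm (WeakDual.toStrongDual g), fun φ => ?_⟩
  have h1 : Tendsto f l (𝓝 g) := hg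
  have h2 := ((WeakDual.eval_continuous (𝕜 := ℝ) φ).tendsto g).comp h1
  rw [InnerProductSpace.toDual_symm_apply]
  exact h2

/-- A compact operator maps bounded weakly convergent families to strongly convergent ones. -/
theorem tendsto_of_isCompactOperator {ι : Type*} (l : Ultrafilter ι) (u : ι → X) (C : ℝ)
    (hu : ∀ᶠ i in (l : Filter ι), ‖u i‖ ≤ C) (v : X)
    (hv : ∀ φ : X, Tendsto (fun i => inner ℝ (u i) φ) l (𝓝 (inner ℝ v φ)))
    (T : X →L[ℝ] Y) (hT : IsCompactOperator T) :
    Tendsto (fun i => T (u i)) l (𝓝 (T v)) := by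
  obtain ⟨K, hK, hKs⟩ := IsCompactOperator.image_closedBall_subset_compact hT C
  have hle : ((l.map (fun i => T (u i)) : Ultrafilter _) : Filter Y) ≤ 𝓟 K := by
    rw [le_principal_iff, Ultrafilter.mem_coe, Ultrafilter.mem_map]
    exact hu.mono fun i hi => hKs ⟨u i, by simpa using hi, rfl⟩
  obtain ⟨y, -, hy⟩ := hK.ultrafilter_le_nhds _ hle
  have hy' : Tendsto (fun i => T (u i)) l (𝓝 y) := hy
  -- The norm limit exists by compactness; testing against `ψ`, that is, the weak limit against `T*
  -- ψ`, identifies it.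
  have : y = T v := by
    refine ext_inner_right ℝ fun ψ => ?_
    have h1 : Tendsto (fun i => inner ℝ (T (u i)) ψ) l (𝓝 (inner ℝ y ψ)) := hy'.inner tendsto_const_nhds
    have h2 := hv (T.adjoint ψ)
    simp only [ContinuousLinearMap.adjoint_inner_right] at h2
    exact tendsto_nhds_unique h1 h2
  exact this ▸ hy'

end WeakLimits

/-! ### Spectral projections of compact symmetric operators -/

section SpectralProjection

variable {X : Type*} [NormedAddCommGroup X] [InnerProductSpace ℝ X]

open Module.End

/-- Pythagoras: components in distinct eigenspaces are orthogonal, and `T` scales each one by its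
eigenvalue. The shared weights `c` allow the two norms to be compared term by term. -/
theorem exists_norm_sq_of_mem_iSup_eigenspace {T : X →ₗ[ℝ] X} (hT : T.IsSymmetric)
    (S : Set ℝ) {x : X} (hx : x ∈ ⨆ μ : S, eigenspace T (μ : ℝ)) :
    ∃ (s : Finset S) (c : S → ℝ), (∀ μ, 0 ≤ c μ) ∧ ‖x‖ ^ 2 = ∑ μ ∈ s, c μ ∧
      ‖T x‖ ^ 2 = ∑ μ ∈ s, (μ : ℝ) ^ 2 * c μ := by
  obtain ⟨f, hf, rfl⟩ := (Submodule.mem_iSup_iff_exists_finsupp _ _).1 hx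
  have hO := hT.orthogonalFamily_eigenspaces.comp (Subtype.coe_injective (p := fun μ => μ ∈ S))
  refine ⟨f.support, fun μ => ‖f μ‖ ^ 2, fun μ => by positivity, ?_, ?_⟩
  · exact hO.norm_sum (fun μ => ⟨f μ, hf μ⟩) f.support
  · have h1 := hO.norm_sum (fun μ => (μ : ℝ) • ⟨f μ, hf μ⟩) f.support
    have h2 : T (f.sum fun _ y => y) = ∑ μ ∈ f.support, (μ : ℝ) • f μ := by
      rw [Finsupp.sum, map_sum]
      exact Finset.sum_congr rfl fun μ _ => mem_eigenspace_iff.1 (hf μ)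
    rw [h2]
    refine h1.trans (Finset.sum_congr rfl fun μ _ => ?_)
    rw [norm_smul, mul_pow, Real.norm_eq_abs, sq_abs]
    rfl

theorem map_mem_iSup_eigenspace {T : X →ₗ[ℝ] X} (S : Set ℝ) {x : X}
    (hx : x ∈ ⨆ μ : S, eigenspace T (μ : ℝ)) : T x ∈ ⨆ μ : S, eigenspace T (μ : ℝ) := by
  induction hx using Submodule.iSup_induction' with
  | mem μ x hx =>
    rw [mem_eigenspace_iff.1 hx]
    exact Submodule.smul_mem _ _ (Submodule.mem_iSup_of_mem μ hx)
  | zero => simp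
  | add x y _ _ h1 h2 => rw [map_add]; exact add_mem h1 h2

/-- The spectral projection of a compact symmetric operator onto the part of the spectrum where
`|μ| > γ`. -/
theorem exists_spectral_projection [CompleteSpace X] (T : X →L[ℝ] X)
    (hT : (T : X →ₗ[ℝ] X).IsSymmetric) (hc : IsCompactOperator T) {γ : ℝ} (hγ : 0 < γ) :
    ∃ P : X →L[ℝ] X, (∀ x, P (T x) = T (P x)) ∧ (∀ x, γ * ‖P x‖ ≤ ‖T x‖) ∧
      (∀ x, ‖T (x - P x)‖ ≤ γ * ‖x - P x‖) ∧ ∀ x, ‖x - P x‖ ≤ ‖x‖ := by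
  set E : Submodule ℝ X := ⨆ μ : {μ : ℝ | γ < |μ|}, eigenspace (T : X →ₗ[ℝ] X) (μ : ℝ) with hE
  set F : Submodule ℝ X := ⨆ μ : {μ : ℝ | |μ| ≤ γ}, eigenspace (T : X →ₗ[ℝ] X) (μ : ℝ) with hF
  set K := E.topologicalClosure with hK
  have hKc : IsClosed (K : Set X) := E.isClosed_topologicalClosure
  have : CompleteSpace K := hKc.completeSpace_coe
  set L := F.topologicalClosure with hL
  have hLc : IsClosed (L : Set X) := F.isClosed_topologicalClosure
  have : CompleteSpace L := hLc.completeSpace_coe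
  have hEF : E ⟂ F := by
    rw [hE, hF, Submodule.isOrtho_iSup_left]
    intro μ
    rw [Submodule.isOrtho_iSup_right]
    intro ν
    refine hT.orthogonalFamily_eigenspaces.isOrtho ?_
    intro h
    have h1 := μ.2
    have h2 := ν.2
    simp only [mem_ofPred_eq] at h1 h2
    rw [h] at h1
    linarith
  have hTK : ∀ x ∈ K, T x ∈ K := by
    intro x hx
    exact map_mem_closure T.continuous hx fun y hy => map_mem_iSup_eigenspace _ hy
  have hTKo : ∀ x ∈ Kᗮ, T x ∈ Kᗮ := by
    intro x hx y hy
    exact (hT y x).symm.trans (hx _ (hTK y hy))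
  have hlow : ∀ x ∈ K, γ * ‖x‖ ≤ ‖T x‖ := by
    intro x hx
    have hcl : IsClosed {x : X | γ * ‖x‖ ≤ ‖T x‖} := isClosed_le (by fun_prop) (by fun_prop)
    refine closure_minimal ?_ hcl hx
    intro y hy
    obtain ⟨s, c, hc0, h1, h2⟩ := exists_norm_sq_of_mem_iSup_eigenspace hT _ hy
    have : (γ * ‖y‖) ^ 2 ≤ ‖T y‖ ^ 2 := by
      rw [mul_pow, h1]
      refine le_trans ?_ h2.ge
      rw [Finset.mul_sum]
      refine Finset.sum_le_sum fun μ _ => mul_le_mul_of_nonneg_right ?_ (hc0 μ)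
      have := μ.2
      simp only [mem_ofPred_eq] at this
      exact sq_le_sq.2 (by rw [abs_of_pos hγ]; exact this.le)
    exact (sq_le_sq₀ (by positivity) (by positivity)).1 this
  have hup : ∀ x ∈ L, ‖T x‖ ≤ γ * ‖x‖ := by
    intro x hx
    have hcl : IsClosed {x : X | ‖T x‖ ≤ γ * ‖x‖} := isClosed_le (by fun_prop) (by fun_prop)
    refine closure_minimal ?_ hcl hx
    intro y hy
    obtain ⟨s, c, hc0, h1, h2⟩ := exists_norm_sq_of_mem_iSup_eigenspace hT _ hy
    have : ‖T y‖ ^ 2 ≤ (γ * ‖y‖) ^ 2 := by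
      rw [mul_pow, h1]
      refine h2.le.trans ?_
      rw [Finset.mul_sum]
      refine Finset.sum_le_sum fun μ _ => mul_le_mul_of_nonneg_right ?_ (hc0 μ)
      have := μ.2
      simp only [mem_ofPred_eq] at this
      exact sq_le_sq.2 (by rw [abs_of_pos hγ]; exact this)
    exact (sq_le_sq₀ (by positivity) (by positivity)).1 this
  -- For `x` in `Kᗮ`, the difference of `x` and its projection to `L` is orthogonal to the
  -- eigenspaces with `|μ| ≤ γ` and to those with `|μ| > γ`. By the spectral theorem it vanishes.
  have hLK : Kᗮ ≤ L := by
    intro x hx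
    have hLle : L ≤ Kᗮ := by
      rw [hK, Submodule.orthogonal_closure]
      refine Submodule.topologicalClosure_minimal _ ?_ (Submodule.isClosed_orthogonal _)
      exact hEF.symm.le
    have h1 : x - L.starProjection x ∈ Lᗮ := Submodule.sub_starProjection_mem_orthogonal x
    have h2 : x - L.starProjection x ∈ Kᗮ := sub_mem hx (hLle (Submodule.starProjection_apply_mem L x))
    have h3 : x - L.starProjection x ∈ (⨆ μ, eigenspace (T : X →ₗ[ℝ] X) μ)ᗮ := by
      rw [← Submodule.iInf_orthogonal, Submodule.mem_iInf]
      intro μ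
      by_cases hμ : |μ| ≤ γ
      · refine Submodule.orthogonal_le ?_ h1
        exact (le_iSup (fun μ : {μ : ℝ | |μ| ≤ γ} => eigenspace (T : X →ₗ[ℝ] X) (μ : ℝ))
          ⟨μ, hμ⟩).trans F.le_topologicalClosure
      · refine Submodule.orthogonal_le ?_ h2
        exact (le_iSup (fun μ : {μ : ℝ | γ < |μ|} => eigenspace (T : X →ₗ[ℝ] X) (μ : ℝ))
          ⟨μ, not_le.1 hμ⟩).trans E.le_topologicalClosure
    rw [ContinuousLinearMap.orthogonalComplement_iSup_eigenspaces_eq_bot hc hT,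
      Submodule.mem_bot, sub_eq_zero] at h3
    rw [h3]
    exact Submodule.starProjection_apply_mem L x
  have hcomm : ∀ x, K.starProjection (T x) = T (K.starProjection x) := by
    intro x
    refine Submodule.eq_starProjection_of_mem_of_inner_eq_zero
      (hTK _ (Submodule.starProjection_apply_mem K x)) ?_
    intro w hw
    rw [← map_sub, real_inner_comm]
    exact hTKo _ (Submodule.sub_starProjection_mem_orthogonal x) w hw
  refine ⟨K.starProjection, hcomm, fun x => ?_, fun x => ?_, fun x => ?_⟩
  · refine (hlow _ (Submodule.starProjection_apply_mem K x)).trans ?_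
    rw [← hcomm]
    exact Submodule.norm_starProjection_apply_le K _
  · exact hup _ (hLK (Submodule.sub_starProjection_mem_orthogonal x))
  · have : x - K.starProjection x = Kᗮ.starProjection x := by
      rw [sub_eq_iff_eq_add, add_comm]
      exact (Submodule.starProjection_add_starProjection_orthogonal x).symm
    rw [this]
    exact Submodule.norm_starProjection_apply_le _ _

end SpectralProjection

/-! ### Spans of generalized eigenvectors for a pair of forms -/

section FormEigenspan

variable {X Y Z : Type*} [NormedAddCommGroup X] [NormedSpace ℝ X]
  [NormedAddCommGroup Y] [InnerProductSpace ℝ Y] [NormedAddCommGroup Z] [InnerProductSpace ℝ Z]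

/-- The span of the vectors `u` with `⟨A u, A φ⟩ = λ ⟨G u, G φ⟩` for all `φ`, for `λ > β²`. -/
def formEigenspan (G : X →L[ℝ] Y) (A : X →L[ℝ] Z) (β : ℝ) : Submodule ℝ X :=
  Submodule.span ℝ {u | ∃ lam : ℝ, β ^ 2 < lam ∧
    ∀ φ, lam * inner ℝ (G u) (G φ) = inner ℝ (A u) (A φ)}

/-- For fixed `lam` the eigenvector equation is linear in `u`, so terms with the same eigenvalue can
be merged. Only then are different terms orthogonal. -/
theorem exists_sum_of_mem_formEigenspan {G : X →L[ℝ] Y} {A : X →L[ℝ] Z} {β : ℝ} {u : X}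
    (hu : u ∈ formEigenspan G A β) :
    ∃ f : {lam : ℝ // β ^ 2 < lam} →₀ X, u = ∑ lam ∈ f.support, f lam ∧
      ∀ (lam : {lam : ℝ // β ^ 2 < lam}) (φ : X), (lam : ℝ) * inner ℝ (G (f lam)) (G φ) = inner ℝ (A (f lam)) (A φ) := by
  let p : {lam : ℝ // β ^ 2 < lam} → Submodule ℝ X := fun lam =>
    { carrier := {u | ∀ φ, (lam : ℝ) * inner ℝ (G u) (G φ) = inner ℝ (A u) (A φ)}
      add_mem' := by
        intro a b ha hb φ
        simp only [map_add, inner_add_left, mul_add, ha φ, hb φ]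
      zero_mem' := by intro φ; simp
      smul_mem' := by
        intro c a ha φ
        simp only [map_smul, real_inner_smul_left]
        rw [← ha φ]; ring }
  have h1 : u ∈ ⨆ lam, p lam := by
    refine (Submodule.span_le.2 ?_ : formEigenspan G A β ≤ _) hu
    rintro w ⟨lam, hlam, hw⟩
    exact Submodule.mem_iSup_of_mem (p := p) ⟨lam, hlam⟩ hw
  obtain ⟨f, hf, hfu⟩ := (Submodule.mem_iSup_iff_exists_finsupp _ _).1 h1
  exact ⟨f, hfu.symm, hf⟩

/-- By symmetry of both forms, components for different `lam` are orthogonal for `⟨G ·, G ·⟩`, hence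
also for `⟨A ·, A ·⟩`. On the diagonal the ratio of the two forms is `lam > β²`. -/
theorem sq_mul_norm_sq_le_of_mem_formEigenspan {G : X →L[ℝ] Y} {A : X →L[ℝ] Z} {β : ℝ} {u : X}
    (hu : u ∈ formEigenspan G A β) : β ^ 2 * ‖G u‖ ^ 2 ≤ ‖A u‖ ^ 2 := by
  obtain ⟨f, rfl, hf⟩ := exists_sum_of_mem_formEigenspan hu
  have horth : ∀ i j, i ≠ j → inner ℝ (G (f i)) (G (f j)) = 0 := by
    intro i j hij
    have h1 := hf i (f j)
    have h2 := hf j (f i)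
    rw [real_inner_comm, real_inner_comm (A (f i))] at h2
    have h3 : ((i : ℝ) - j) * inner ℝ (G (f i)) (G (f j)) = 0 := by rw [sub_mul, h1, h2, sub_self]
    rcases mul_eq_zero.1 h3 with h | h
    · exact absurd (Subtype.ext (sub_eq_zero.1 h)) hij
    · exact h
  rw [← real_inner_self_eq_norm_sq, ← real_inner_self_eq_norm_sq]
  simp only [map_sum, sum_inner, inner_sum, Finset.mul_sum]
  refine Finset.sum_le_sum fun i _ => Finset.sum_le_sum fun j _ => ?_
  rw [← hf j (f i)]
  rcases eq_or_ne j i with rfl | hij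
  · exact mul_le_mul_of_nonneg_right j.2.le real_inner_self_nonneg
  · simp [horth _ _ hij]

/-- On an eigenvector, `w = u / lam`, where `lam > β² ≥ 0`. The lemma lets the energy form of `u` be
rewritten through `A* A w`. -/
theorem exists_preimage_of_mem_formEigenspan {G : X →L[ℝ] Y} {A : X →L[ℝ] Z} {β : ℝ} {u : X}
    (hu : u ∈ formEigenspan G A β) :
    ∃ w ∈ formEigenspan G A β, ∀ φ, inner ℝ (A w) (A φ) = inner ℝ (G u) (G φ) := by
  induction hu using Submodule.span_induction with
  | mem u hu =>
    obtain ⟨lam, hlam, h⟩ := hu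
    have hpos : 0 < lam := (sq_nonneg β).trans_lt hlam
    refine ⟨lam⁻¹ • u, Submodule.smul_mem _ _ (Submodule.subset_span ⟨lam, hlam, h⟩), fun φ => ?_⟩
    rw [map_smul, real_inner_smul_left, ← h φ, inv_mul_cancel_left₀ hpos.ne']
  | zero => exact ⟨0, zero_mem _, by simp⟩
  | add u v _ _ h1 h2 =>
    obtain ⟨w, hw, h1⟩ := h1
    obtain ⟨w', hw', h2⟩ := h2
    exact ⟨w + w', add_mem hw hw', fun φ => by simp only [map_add, inner_add_left, h1, h2]⟩
  | smul c u _ h =>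
    obtain ⟨w, hw, h⟩ := h
    exact ⟨c • w, Submodule.smul_mem _ _ hw, fun φ => by
      simp only [map_smul, real_inner_smul_left, h]⟩

end FormEigenspan

end KernelInverse

/-! ### The Lipschitz lower bound in a Hilbert space -/

namespace KernelInverse

open Filter Topology

theorem tendsto_clm_apply {ι X Z : Type*} [NormedAddCommGroup X] [NormedSpace ℝ X]
    [NormedAddCommGroup Z] [NormedSpace ℝ Z] {l : Filter ι} {T : ι → X →L[ℝ] Z} {T' : X →L[ℝ] Z}
    {u : ι → X} {v : X} (hT : Tendsto T l (𝓝 T')) (hu : Tendsto u l (𝓝 v)) :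
    Tendsto (fun i => T i (u i)) l (𝓝 (T' v)) :=
  ((isBoundedBilinearMap_apply (𝕜 := ℝ) (E := X) (F := Z)).continuous.tendsto (T', v)).comp
    (hT.prodMk_nhds hu)

section Lipschitz

variable {M X Y Z : Type*} [NormedAddCommGroup M]
  [NormedAddCommGroup X] [InnerProductSpace ℝ X] [CompleteSpace X]
  [NormedAddCommGroup Y] [InnerProductSpace ℝ Y]
  [NormedAddCommGroup Z] [InnerProductSpace ℝ Z] [CompleteSpace Z]

/-- Split off `(A (m i) - A m') (u i)`, which tends to zero because `u i` is bounded; the rest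
converges because `A m'` is compact. -/
theorem tendsto_apply_of_weak_limit {ι : Type*} (l : Ultrafilter ι) {B : Set M}
    {A : M → X →L[ℝ] Z} (hA : ContinuousOn A B) (hcomp : ∀ m ∈ B, IsCompactOperator (A m))
    {m : ι → M} (hmB : ∀ i, m i ∈ B) {m' : M} (hm'B : m' ∈ B) (hm : Tendsto m l (𝓝 m'))
    {u : ι → X} {C : ℝ} (hu : ∀ᶠ i in (l : Filter ι), ‖u i‖ ≤ C) {v : X}
    (hv : ∀ φ : X, Tendsto (fun i => inner ℝ (u i) φ) l (𝓝 (inner ℝ v φ))) :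
    Tendsto (fun i => A (m i) (u i)) l (𝓝 (A m' v)) := by
  have h1 := tendsto_of_isCompactOperator l u C hu v hv (A m') (hcomp m' hm'B)
  have h2 : Tendsto (fun i => A (m i)) l (𝓝 (A m')) :=
    (hA m' hm'B).tendsto.comp (tendsto_nhdsWithin_iff.2 ⟨hm, Eventually.of_forall hmB⟩)
  have h3 : Tendsto (fun i => ‖A (m i) - A m'‖ * C) l (𝓝 0) := by
    simpa using (tendsto_iff_norm_sub_tendsto_zero.1 h2).mul_const C
  have h4 : Tendsto (fun i => (A (m i) - A m') (u i)) l (𝓝 0) := by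
    refine squeeze_zero_norm' ?_ h3
    filter_upwards [hu] with i hi
    exact (ContinuousLinearMap.le_opNorm _ _).trans (by gcongr)
  simpa using h4.add h1

/-- Otherwise there are unit vectors `z i` in the eigenspans with `A (m i) (z i) → 0`. Their weak
limit is killed by an injective `A m'`, so it is zero, and `A m₀ (z i) → 0` by compactness. The
eigenspan bound gives `‖G (z i)‖ ≤ ‖A (m i) (z i)‖ / β → 0`, which contradicts `‖z i‖ = 1`. -/
theorem exists_norm_le_of_mem_formEigenspan {B : Set M} (hB : IsCompact B) {m₀ : M} (hm₀ : m₀ ∈ B)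
    {G : X →L[ℝ] Y} {A : M → X →L[ℝ] Z}
    (hG : ∀ u v, inner ℝ u v = inner ℝ (G u) (G v) + inner ℝ (A m₀ u) (A m₀ v))
    (hA : ContinuousOn A B) (hcomp : ∀ m ∈ B, IsCompactOperator (A m))
    (hinj : ∀ m ∈ B, ∀ u, A m u = 0 → u = 0) {β : ℝ} (hβ : 0 < β) :
    ∃ K : ℝ, 0 < K ∧ ∀ m ∈ B, ∀ u ∈ formEigenspan G (A m) β, ‖u‖ ≤ K * ‖A m u‖ := by
  by_contra! hcon
  have hex : ∀ n : ℕ, ∃ m ∈ B, ∃ z ∈ formEigenspan G (A m) β, ‖z‖ = 1 ∧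
      ‖A m z‖ ≤ 1 / ((n : ℝ) + 1) := by
    intro n
    obtain ⟨m, hm, u, hu, h⟩ := hcon ((n : ℝ) + 1) (by positivity)
    have hu0 : 0 < ‖u‖ := lt_of_le_of_lt (by positivity) h
    refine ⟨m, hm, ‖u‖⁻¹ • u, Submodule.smul_mem _ _ hu, ?_, ?_⟩
    · rw [norm_smul, norm_inv, norm_norm, inv_mul_cancel₀ hu0.ne']
    · rw [map_smul, norm_smul, norm_inv, norm_norm, inv_mul_le_iff₀ hu0, mul_one_div,
        le_div_iff₀ (by positivity), mul_comm]
      exact h.le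
  choose m hmB z hz hz1 hAz using hex
  let l : Ultrafilter ℕ := hyperfilter ℕ
  have hl : (l : Filter ℕ) ≤ atTop := Nat.hyperfilter_le_atTop
  obtain ⟨m', hm'B, hm'⟩ := hB.ultrafilter_le_nhds (l.map m) (by
    rw [le_principal_iff, Ultrafilter.mem_coe, Ultrafilter.mem_map]
    exact univ_mem' hmB)
  have hm' : Tendsto m l (𝓝 m') := hm'
  have hzb : ∀ᶠ i in (l : Filter ℕ), ‖z i‖ ≤ 1 := Eventually.of_forall fun i => (hz1 i).le
  obtain ⟨v, hv⟩ := exists_weak_limit l z 1 hzb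
  have h0 : Tendsto (fun i => A (m i) (z i)) l (𝓝 0) :=
    squeeze_zero_norm hAz (tendsto_one_div_add_atTop_nhds_zero_nat.mono_left hl)
  have hv0 : v = 0 := hinj m' hm'B v (tendsto_nhds_unique
    (tendsto_apply_of_weak_limit l hA hcomp hmB hm'B hm' hzb hv) h0)
  have h1 : Tendsto (fun i => A m₀ (z i)) l (𝓝 0) := by
    simpa [hv0] using tendsto_of_isCompactOperator l z 1 hzb v hv (A m₀) (hcomp m₀ hm₀)
  have h2 : Tendsto (fun i => ‖A (m i) (z i)‖ ^ 2 / β ^ 2 + ‖A m₀ (z i)‖ ^ 2) l (𝓝 0) := by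
    simpa using ((h0.norm.pow 2).div_const (β ^ 2)).add (h1.norm.pow 2)
  have h3 : ∀ i, (1 : ℝ) ≤ ‖A (m i) (z i)‖ ^ 2 / β ^ 2 + ‖A m₀ (z i)‖ ^ 2 := by
    intro i
    have e1 := hG (z i) (z i)
    rw [real_inner_self_eq_norm_sq, real_inner_self_eq_norm_sq, real_inner_self_eq_norm_sq,
      hz1 i, one_pow] at e1
    have e2 := sq_mul_norm_sq_le_of_mem_formEigenspan (hz i)
    have e3 : ‖G (z i)‖ ^ 2 ≤ ‖A (m i) (z i)‖ ^ 2 / β ^ 2 := by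
      rw [le_div_iff₀ (by positivity), mul_comm]; exact e2
    linarith
  have h4 : (1 : ℝ) ≤ 0 := ge_of_tendsto h2 (Eventually.of_forall h3)
  linarith

theorem norm_adjoint_comp_sub_le (A A₀ : X →L[ℝ] Z) (x : X) :
    ‖A.adjoint (A x) - A₀.adjoint (A₀ x)‖ ≤ (‖A‖ + ‖A₀‖) * ‖A - A₀‖ * ‖x‖ := by
  have h1 : A.adjoint (A x) - A₀.adjoint (A₀ x) =
      A.adjoint ((A - A₀) x) + (A - A₀).adjoint (A₀ x) := by
    simp [map_sub]
  have h2 : ‖A.adjoint ((A - A₀) x)‖ ≤ ‖A‖ * (‖A - A₀‖ * ‖x‖) :=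
    (ContinuousLinearMap.le_opNorm _ _).trans (by
      rw [LinearIsometryEquiv.norm_map]; gcongr; exact ContinuousLinearMap.le_opNorm _ _)
  have h3 : ‖(A - A₀).adjoint (A₀ x)‖ ≤ ‖A - A₀‖ * (‖A₀‖ * ‖x‖) :=
    (ContinuousLinearMap.le_opNorm _ _).trans (by
      rw [LinearIsometryEquiv.norm_map]; gcongr; exact ContinuousLinearMap.le_opNorm _ _)
  rw [h1]
  refine (norm_add_le _ _).trans ((add_le_add h2 h3).trans (le_of_eq (by ring)))

/-- The eigenspan of a perturbed operator is close to the spectral subspace of the unperturbed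
one. -/
theorem norm_sub_spectral_projection_le {G : X →L[ℝ] Y} {A A₀ : X →L[ℝ] Z}
    (hG : ∀ u v, inner ℝ u v = inner ℝ (G u) (G v) + inner ℝ (A₀ u) (A₀ v)) {β K γ : ℝ}
    (hK : 0 < K) (hE : ∀ u ∈ formEigenspan G A β, ‖u‖ ≤ K * ‖A u‖) (hγ : γ * (1 + K ^ 2) ≤ 1 / 2)
    (hγ0 : 0 < γ) {P : X →L[ℝ] X}
    (hP : ∀ x, P (A₀.adjoint (A₀ x)) = A₀.adjoint (A₀ (P x)))
    (hP2 : ∀ x, ‖A₀.adjoint (A₀ (x - P x))‖ ≤ γ * ‖x - P x‖) (hP3 : ∀ x, ‖x - P x‖ ≤ ‖x‖) {u : X}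
    (hu : u ∈ formEigenspan G A β) :
    ‖u - P u‖ ≤ 2 * K ^ 2 * ((‖A‖ + ‖A₀‖) * ‖A - A₀‖) * ‖u‖ := by
  set D := (‖A‖ + ‖A₀‖) * ‖A - A₀‖ with hD
  have hD0 : 0 ≤ D := by positivity
  -- `Q` is the restriction of `1 - P` to the eigenspan. The estimate `key` bounds `Q` by half of
  -- its own norm plus the wanted error, and the half is then absorbed.
  let Q : formEigenspan G A β →L[ℝ] X :=
    (ContinuousLinearMap.id ℝ X - P).comp (formEigenspan G A β).subtypeL
  have hQ : ∀ w (hw : w ∈ formEigenspan G A β), ‖w - P w‖ ≤ ‖Q‖ * ‖w‖ := fun w hw =>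
    Q.le_opNorm ⟨w, hw⟩
  have hGn : ∀ x, ‖G x‖ ≤ ‖x‖ := by
    intro x
    have := hG x x
    simp only [real_inner_self_eq_norm_sq] at this
    exact (sq_le_sq₀ (norm_nonneg _) (norm_nonneg _)).1 (by nlinarith [sq_nonneg ‖A₀ x‖])
  have key : ∀ u ∈ formEigenspan G A β,
      ‖u - P u‖ ≤ (‖Q‖ / 2 + K ^ 2 * D) * ‖u‖ := by
    intro u hu
    obtain ⟨w, hw, hwu⟩ := exists_preimage_of_mem_formEigenspan hu
    have hwn : ‖w‖ ≤ K ^ 2 * ‖u‖ := by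
      have h1 : ‖A w‖ ^ 2 ≤ ‖u‖ * ‖w‖ := by
        rw [← real_inner_self_eq_norm_sq, hwu w]
        refine (real_inner_le_norm _ _).trans ?_
        gcongr <;> exact hGn _
      have h2 : ‖w‖ ^ 2 ≤ K ^ 2 * ‖A w‖ ^ 2 := by
        rw [← mul_pow]; gcongr; exact hE w hw
      rcases (norm_nonneg w).eq_or_lt with h | h
      · rw [← h]; positivity
      · have h3 : ‖w‖ * ‖w‖ ≤ K ^ 2 * ‖u‖ * ‖w‖ := by
          nlinarith [mul_le_mul_of_nonneg_left h1 (sq_nonneg K)]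
        exact le_of_mul_le_mul_right h3 h
    -- The inner product is the energy plus `⟨A₀ ·, A₀ ·⟩`, and the energy of `u` against `φ` equals
    -- `⟨A w, A φ⟩`.
    have hueq : u = A₀.adjoint (A₀ u) + A.adjoint (A w) := by
      refine ext_inner_right ℝ fun φ => ?_
      rw [inner_add_left, ContinuousLinearMap.adjoint_inner_left,
        ContinuousLinearMap.adjoint_inner_left, hwu φ, hG u φ, add_comm]
    set e := A.adjoint (A w) - A₀.adjoint (A₀ w) with he
    have hen : ‖e‖ ≤ D * ‖w‖ := norm_adjoint_comp_sub_le A A₀ w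
    -- Apply `1 - P` to `u = A₀* A₀ (u + w) + e`. On the range of `1 - P` the operator `A₀* A₀` has
    -- norm at most `γ`, so the first two terms are small multiples of `‖Q‖`.
    have hQu : u - P u = A₀.adjoint (A₀ (u - P u)) + A₀.adjoint (A₀ (w - P w)) + (e - P e) := by
      have h1 : u = A₀.adjoint (A₀ u) + A₀.adjoint (A₀ w) + e := by rw [he]; rw [add_assoc, add_sub_cancel]; exact hueq
      have h2 : P u = A₀.adjoint (A₀ (P u)) + A₀.adjoint (A₀ (P w)) + P e := by
        conv_lhs => rw [h1]
        rw [map_add, map_add, hP, hP]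
      simp only [map_sub]
      have h3 : u - P u = (A₀.adjoint (A₀ u) + A₀.adjoint (A₀ w) + e) -
          (A₀.adjoint (A₀ (P u)) + A₀.adjoint (A₀ (P w)) + P e) := congrArg₂ _ h1 h2
      rw [h3]
      abel
    calc ‖u - P u‖ ≤ ‖A₀.adjoint (A₀ (u - P u))‖ + ‖A₀.adjoint (A₀ (w - P w))‖ + ‖e - P e‖ := by
          conv_lhs => rw [hQu]
          exact norm_add₃_le
      _ ≤ γ * (‖Q‖ * ‖u‖) + γ * (‖Q‖ * (K ^ 2 * ‖u‖)) + D * (K ^ 2 * ‖u‖) := by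
          refine add_le_add_three ((hP2 u).trans ?_) ((hP2 w).trans ?_) ((hP3 e).trans (hen.trans ?_))
          · gcongr; exact hQ u hu
          · gcongr; exact (hQ w hw).trans (by gcongr)
          · gcongr
      _ = (γ * (1 + K ^ 2)) * (‖Q‖ * ‖u‖) + K ^ 2 * D * ‖u‖ := by ring
      _ ≤ (1 / 2) * (‖Q‖ * ‖u‖) + K ^ 2 * D * ‖u‖ := by gcongr
      _ = (‖Q‖ / 2 + K ^ 2 * D) * ‖u‖ := by ring
  have hN : ‖Q‖ ≤ ‖Q‖ / 2 + K ^ 2 * D :=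
    Q.opNorm_le_bound (by positivity) fun w => key w w.2
  refine (hQ u hu).trans ?_
  gcongr
  linarith

variable [NormedSpace ℝ M]

/-- A conditional Lipschitz lower bound for a family of compact operators. -/
theorem exists_mul_norm_sub_le_of_inner_eq [ProperSpace M] {B : Set M} (hB : IsCompact B) {m₀ : M}
    (hm₀ : m₀ ∈ B) {G : X →L[ℝ] Y} {A : M → X →L[ℝ] Z} {A' : M →L[ℝ] X →L[ℝ] Z}
    (hG : ∀ u v, inner ℝ u v = inner ℝ (G u) (G v) + inner ℝ (A m₀ u) (A m₀ v))
    (hA : ContinuousOn A B) (hcomp : ∀ m ∈ B, IsCompactOperator (A m))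
    (hA' : HasFDerivWithinAt A A' B m₀)
    (hU1 : ∀ m₁ ∈ B, ∀ m₂ ∈ B, ∀ u v, A m₁ u = A m₂ v → u ≠ 0 ∨ v ≠ 0 → m₁ = m₂ ∧ u = v)
    (hU2 : ∀ q, ‖q‖ = 1 → ∀ u v, A' q u = A m₀ v → u = 0 ∧ v = 0)
    {β : ℝ} (hβ : 0 < β) {v₀ : X} (hv₀ : v₀ ≠ 0) :
    ∃ C : ℝ, 0 < C ∧ ∀ m ∈ B, ∀ u ∈ formEigenspan G (A m) β,
      C * ‖m - m₀‖ ≤ ‖A m u - A m₀ v₀‖ := by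
  have hinj : ∀ m ∈ B, ∀ u, A m u = 0 → u = 0 := by
    intro m hm u hu
    by_contra h
    exact h (hU1 m hm m hm u 0 (by rw [hu, map_zero]) (Or.inl h)).2
  obtain ⟨K, hK, hE⟩ := exists_norm_le_of_mem_formEigenspan hB hm₀ hG hA hcomp hinj hβ
  obtain ⟨N, hN⟩ := (hB.image_of_continuousOn hA).isBounded.exists_norm_le
  have hN : ∀ m ∈ B, ‖A m‖ ≤ N := fun m hm => hN _ (mem_image_of_mem A hm)
  have hN0 : 0 ≤ N := (norm_nonneg _).trans (hN m₀ hm₀)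
  -- The spectral threshold for which the absorption in `norm_sub_spectral_projection_le` works with
  -- factor `1 / 2`.
  set γ : ℝ := 1 / (2 * (1 + K ^ 2)) with hγd
  have hγ0 : 0 < γ := by positivity
  have hγ : γ * (1 + K ^ 2) ≤ 1 / 2 := by rw [hγd]; field_simp; exact le_rfl
  have hTc : IsCompactOperator ((A m₀).adjoint.comp (A m₀)) := by
    change IsCompactOperator ((A m₀).adjoint ∘ A m₀)
    exact (hcomp m₀ hm₀).clm_comp _
  obtain ⟨P, hP, hP1, hP2, hP3⟩ := exists_spectral_projection ((A m₀).adjoint.comp (A m₀))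
    (fun x y => by
      simp only [ContinuousLinearMap.coe_coe, ContinuousLinearMap.comp_apply,
        ContinuousLinearMap.adjoint_inner_left, ContinuousLinearMap.adjoint_inner_right])
    hTc hγ0
  simp only [ContinuousLinearMap.comp_apply] at hP hP1 hP2
  by_contra! hcon
  have hex : ∀ n : ℕ, ∃ m ∈ B, ∃ u ∈ formEigenspan G (A m) β,
      ‖A m u - A m₀ v₀‖ < 1 / ((n : ℝ) + 1) * ‖m - m₀‖ := fun n => hcon _ (by positivity)
  choose m hmB u hu hlt using hex
  have ht : ∀ n, 0 < ‖m n - m₀‖ := fun n => by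
    by_contra h
    have h0 : ‖m n - m₀‖ = 0 := le_antisymm (not_lt.1 h) (norm_nonneg _)
    have := hlt n
    rw [h0, mul_zero] at this
    exact absurd this (not_lt.2 (norm_nonneg _))
  obtain ⟨b, hb⟩ := hB.isBounded.exists_norm_le
  have htb : ∀ n, ‖m n - m₀‖ ≤ 2 * b := fun n =>
    (norm_sub_le _ _).trans (by linarith [hb _ (hmB n), hb _ hm₀])
  have hsmall : ∀ n : ℕ, 1 / ((n : ℝ) + 1) ≤ 1 := fun n => by
    rw [div_le_one (by positivity)]; linarith [(Nat.cast_nonneg n : (0 : ℝ) ≤ n)]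
  set U : ℝ := K * (‖A m₀ v₀‖ + 2 * b) with hU
  have hub : ∀ n, ‖u n‖ ≤ U := by
    intro n
    refine (hE _ (hmB n) _ (hu n)).trans ?_
    rw [hU]
    gcongr
    have h1 : ‖A (m n) (u n)‖ ≤ ‖A m₀ v₀‖ + ‖A (m n) (u n) - A m₀ v₀‖ := by
      have := norm_add_le (A m₀ v₀) (A (m n) (u n) - A m₀ v₀)
      rwa [add_sub_cancel] at this
    have h2 : 1 / ((n : ℝ) + 1) * ‖m n - m₀‖ ≤ 1 * (2 * b) :=
      mul_le_mul (hsmall n) (htb n) (norm_nonneg _) zero_le_one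
    linarith [hlt n]
  let l : Ultrafilter ℕ := hyperfilter ℕ
  have hl : (l : Filter ℕ) ≤ atTop := Nat.hyperfilter_le_atTop
  have hinv : Tendsto (fun n : ℕ => 1 / ((n : ℝ) + 1)) l (𝓝 0) :=
    tendsto_one_div_add_atTop_nhds_zero_nat.mono_left hl
  obtain ⟨m', hm'B, hm'⟩ := hB.ultrafilter_le_nhds (l.map m) (by
    rw [le_principal_iff, Ultrafilter.mem_coe, Ultrafilter.mem_map]
    exact univ_mem' hmB)
  have hm' : Tendsto m l (𝓝 m') := hm'
  have hub' : ∀ᶠ i in (l : Filter ℕ), ‖u i‖ ≤ U := Eventually.of_forall hub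
  obtain ⟨v, hv⟩ := exists_weak_limit l u U hub'
  have hlim1 := tendsto_apply_of_weak_limit l hA hcomp hmB hm'B hm' hub' hv
  have hlim2 : Tendsto (fun n => A (m n) (u n)) l (𝓝 (A m₀ v₀)) := by
    rw [tendsto_iff_norm_sub_tendsto_zero]
    refine squeeze_zero (fun _ => norm_nonneg _) (fun n => (hlt n).le.trans
      (mul_le_mul_of_nonneg_left (htb n) (by positivity))) ?_
    simpa using hinv.mul_const (2 * b)
  -- From here on `m'` and `v` stand for `m₀` and `v₀`.
  obtain ⟨rfl, rfl⟩ := hU1 m' hm'B m₀ hm₀ v v₀ (tendsto_nhds_unique hlim1 hlim2) (Or.inr hv₀)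
  have hmw : Tendsto m l (𝓝[B] m') := tendsto_nhdsWithin_iff.2 ⟨hm', Eventually.of_forall hmB⟩
  obtain ⟨L, hL0, hL⟩ := (hA'.isBigO_sub.comp_tendsto hmw).exists_pos
  have hL : ∀ᶠ n in (l : Filter ℕ), ‖A (m n) - A m'‖ ≤ L * ‖m n - m'‖ := hL.bound
  set c : ℝ := 2 * K ^ 2 * ((N + N) * L) * U with hc
  have hQ : ∀ᶠ n in (l : Filter ℕ), ‖u n - P (u n)‖ ≤ c * ‖m n - m'‖ := by
    filter_upwards [hL] with n hn
    refine (norm_sub_spectral_projection_le hG hK (hE _ (hmB n)) hγ hγ0 hP hP2 hP3 (hu n)).trans ?_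
    calc _ ≤ 2 * K ^ 2 * ((N + N) * (L * ‖m n - m'‖)) * U := by
          gcongr
          · exact hN _ (hmB n)
          · exact hN _ hm'B
          · exact hub n
      _ = c * ‖m n - m'‖ := by rw [hc]; ring
  have ht0 : Tendsto (fun n => ‖m n - m'‖) l (𝓝 0) := tendsto_iff_norm_sub_tendsto_zero.1 hm'
  have hQ0 : Tendsto (fun n => u n - P (u n)) l (𝓝 0) :=
    squeeze_zero_norm' hQ (by simpa using ht0.const_mul c)
  -- `u n - P (u n)` tends to zero in norm and to `v - P v` weakly.
  have hPv : v - P v = 0 := by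
    refine ext_inner_right ℝ fun φ => ?_
    have h1 : Tendsto (fun n => inner ℝ (u n - P (u n)) φ) l (𝓝 (inner ℝ (0 : X) φ)) :=
      hQ0.inner tendsto_const_nhds
    have h2 := (hv φ).sub (hv (P.adjoint φ))
    simp only [ContinuousLinearMap.adjoint_inner_right, ← inner_sub_left] at h2
    exact tendsto_nhds_unique h2 h1
  set c₁ : ℝ := γ⁻¹ * (N * (1 + L * U)) + c with hc₁
  -- The crucial rate: it gives strong convergence of `u n` and bounded difference quotients `y n`.
  have hdiff : ∀ᶠ n in (l : Filter ℕ), ‖u n - v‖ ≤ c₁ * ‖m n - m'‖ := by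
    filter_upwards [hL, hQ] with n hn hqn
    have h1 : u n - v = P (u n - v) + (u n - P (u n)) := by
      rw [map_sub, ← sub_eq_zero.1 hPv]; abel
    have h2 : ‖A m' (u n - v)‖ ≤ (1 + L * U) * ‖m n - m'‖ := by
      have e1 : A m' (u n - v) = (A (m n) (u n) - A m' v) - (A (m n) - A m') (u n) := by
        simp only [map_sub, _root_.sub_apply]; abel
      rw [e1]
      refine (norm_sub_le _ _).trans ?_
      have e2 : ‖(A (m n) - A m') (u n)‖ ≤ L * ‖m n - m'‖ * U :=
        (ContinuousLinearMap.le_opNorm _ _).trans (by gcongr; exact hub n)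
      have e3 := mul_le_mul_of_nonneg_right (hsmall n) (norm_nonneg (m n - m'))
      linarith [hlt n]
    have h3 : ‖P (u n - v)‖ ≤ γ⁻¹ * (N * ((1 + L * U) * ‖m n - m'‖)) := by
      rw [le_inv_mul_iff₀ hγ0]
      refine (hP1 _).trans ((ContinuousLinearMap.le_opNorm _ _).trans ?_)
      rw [LinearIsometryEquiv.norm_map]
      gcongr
      exact hN _ hm'B
    calc ‖u n - v‖ ≤ ‖P (u n - v)‖ + ‖u n - P (u n)‖ := by
          conv_lhs => rw [h1]
          exact norm_add_le _ _
      _ ≤ γ⁻¹ * (N * ((1 + L * U) * ‖m n - m'‖)) + c * ‖m n - m'‖ := add_le_add h3 hqn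
      _ = c₁ * ‖m n - m'‖ := by rw [hc₁]; ring
  have huv : Tendsto u l (𝓝 v) := by
    rw [tendsto_iff_norm_sub_tendsto_zero]
    exact squeeze_zero' (Eventually.of_forall fun _ => norm_nonneg _) hdiff
      (by simpa using ht0.const_mul c₁)
  let y : ℕ → X := fun n => ‖m n - m'‖⁻¹ • (u n - v)
  let q : ℕ → M := fun n => ‖m n - m'‖⁻¹ • (m n - m')
  have hyb : ∀ᶠ n in (l : Filter ℕ), ‖y n‖ ≤ c₁ := by
    filter_upwards [hdiff] with n hn
    simp only [y, norm_smul, norm_inv, norm_norm]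
    rw [inv_mul_le_iff₀ (ht n), mul_comm]
    exact hn
  have hq1 : ∀ n, q n ∈ Metric.sphere (0 : M) 1 := fun n => by
    simp only [q, mem_sphere_zero_iff_norm, norm_smul, norm_inv, norm_norm]
    exact inv_mul_cancel₀ (ht n).ne'
  obtain ⟨q', hq'1, hq'⟩ := (isCompact_sphere (0 : M) 1).ultrafilter_le_nhds (l.map q) (by
    rw [le_principal_iff, Ultrafilter.mem_coe, Ultrafilter.mem_map]
    exact univ_mem' hq1)
  have hq' : Tendsto q l (𝓝 q') := hq'
  obtain ⟨y', hy'⟩ := exists_weak_limit l y c₁ hyb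
  have hAy := tendsto_of_isCompactOperator l y c₁ hyb y' hy' (A m') (hcomp m' hm'B)
  have hr : Tendsto (fun n => ‖m n - m'‖⁻¹ • (A (m n) - A m' - A' (m n - m'))) l (𝓝 0) := by
    have h1 := (hA'.isLittleO.comp_tendsto hmw).norm_norm.tendsto_div_nhds_zero
    refine squeeze_zero_norm (fun n => le_of_eq ?_) h1
    rw [norm_smul, norm_inv, norm_norm, div_eq_inv_mul]
    rfl
  have hru : Tendsto (fun n => (‖m n - m'‖⁻¹ • (A (m n) - A m' - A' (m n - m'))) (u n)) l (𝓝 0) := by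
    simpa using! tendsto_clm_apply hr huv
  have hA'q : Tendsto (fun n => A' (q n) (u n)) l (𝓝 (A' q' v)) :=
    tendsto_clm_apply ((A'.continuous.tendsto q').comp hq') huv
  have hall := (hru.add hA'q).add hAy
  rw [zero_add] at hall
  have hzero : Tendsto (fun n => ‖m n - m'‖⁻¹ • (A (m n) (u n) - A m' v)) l (𝓝 0) := by
    refine squeeze_zero_norm (fun n => ?_) hinv
    rw [norm_smul, norm_inv, norm_norm, inv_mul_le_iff₀ (ht n), mul_comm]
    exact (hlt n).le
  -- The difference quotient of `A (m n) (u n)` splits into the Taylor remainder, the derivative in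
  -- the direction `q n`, and `A m'` applied to `y n`.
  have heq : ∀ n, (‖m n - m'‖⁻¹ • (A (m n) - A m' - A' (m n - m'))) (u n) + A' (q n) (u n) +
      A m' (y n) = ‖m n - m'‖⁻¹ • (A (m n) (u n) - A m' v) := by
    intro n
    simp only [q, y, map_smul, _root_.smul_apply, _root_.sub_apply,
      map_sub, ← smul_add]
    congr 1
    abel
  simp only [heq] at hall
  have hfin : A' q' v + A m' y' = 0 := tendsto_nhds_unique hall hzero
  refine hv₀ (hU2 q' (by simpa using hq'1) v (-y') ?_).1
  rw [map_neg]
  exact eq_neg_of_add_eq_zero_left hfin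

end Lipschitz

end KernelInverse

/-! ### Change of norm: from an energy estimate to a Hilbert space -/

namespace KernelInverse

open Filter Topology

section Banach

variable {M X Y Z W : Type*} [NormedAddCommGroup M] [NormedSpace ℝ M]
  [NormedAddCommGroup X] [NormedSpace ℝ X]
  [NormedAddCommGroup Y] [InnerProductSpace ℝ Y]
  [NormedAddCommGroup Z] [InnerProductSpace ℝ Z]
  [NormedAddCommGroup W] [NormedSpace ℝ W]

/-- Peetre's argument: in an a priori estimate, finitely many functionals can be replaced by an
injective operator. -/
theorem exists_norm_le_of_finiteDimensional [CompleteSpace X] [FiniteDimensional ℝ W]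
    (G : X →L[ℝ] Y)
    (K : X →L[ℝ] W) (A₀ : X →L[ℝ] Z) {c : ℝ} (hc : ∀ u, ‖u‖ ≤ c * (‖G u‖ + ‖K u‖))
    (hinj : ∀ u, A₀ u = 0 → u = 0) : ∃ C : ℝ, ∀ u, ‖u‖ ≤ C * (‖G u‖ + ‖A₀ u‖) := by
  by_contra! hcon
  have hex : ∀ n : ℕ, ∃ z : X, ‖z‖ = 1 ∧ ‖G z‖ + ‖A₀ z‖ ≤ 1 / ((n : ℝ) + 1) := by
    intro n
    obtain ⟨u, h⟩ := hcon ((n : ℝ) + 1)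
    have hu0 : 0 < ‖u‖ := lt_of_le_of_lt (by positivity) h
    refine ⟨‖u‖⁻¹ • u, ?_, ?_⟩
    · rw [norm_smul, norm_inv, norm_norm, inv_mul_cancel₀ hu0.ne']
    · rw [map_smul, map_smul, norm_smul, norm_smul, norm_inv, norm_norm, ← mul_add,
        inv_mul_le_iff₀ hu0, mul_one_div, le_div_iff₀ (by positivity), mul_comm]
      exact h.le
  choose z hz1 hz using hex
  let l : Ultrafilter ℕ := hyperfilter ℕ
  have hl : (l : Filter ℕ) ≤ atTop := Nat.hyperfilter_le_atTop
  have hinv : Tendsto (fun n : ℕ => 1 / ((n : ℝ) + 1)) l (𝓝 0) :=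
    tendsto_one_div_add_atTop_nhds_zero_nat.mono_left hl
  have hGz : Tendsto (fun n => G (z n)) l (𝓝 0) :=
    squeeze_zero_norm (fun n => (le_add_of_nonneg_right (norm_nonneg _)).trans (hz n)) hinv
  have hAz : Tendsto (fun n => A₀ (z n)) l (𝓝 0) :=
    squeeze_zero_norm (fun n => (le_add_of_nonneg_left (norm_nonneg _)).trans (hz n)) hinv
  have : ProperSpace W := FiniteDimensional.proper ℝ W
  -- Finite dimension of `W` is used here: the bounded images `K (z n)` converge along the
  -- ultrafilter. As `(G, K)` is bounded below, convergence of `G (z n)` and `K (z n)` makes `z n`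
  -- Cauchy.
  obtain ⟨κ, -, hκ⟩ := (isCompact_closedBall (0 : W) ‖K‖).ultrafilter_le_nhds
    (l.map fun n => K (z n)) (by
      rw [le_principal_iff, Ultrafilter.mem_coe, Ultrafilter.mem_map]
      exact univ_mem' fun n => by simpa [hz1 n] using K.le_opNorm (z n))
  have hκ : Tendsto (fun n => K (z n)) l (𝓝 κ) := hκ
  have hanti : AntilipschitzWith (Real.toNNReal (2 * |c|)) (G.prod K) := by
    refine (G.prod K).antilipschitz_of_bound fun u => ?_
    rw [Real.coe_toNNReal _ (by positivity)]
    have h1 : ‖G u‖ ≤ ‖G.prod K u‖ := le_max_left _ _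
    have h2 : ‖K u‖ ≤ ‖G.prod K u‖ := le_max_right _ _
    calc ‖u‖ ≤ c * (‖G u‖ + ‖K u‖) := hc u
      _ ≤ |c| * (‖G.prod K u‖ + ‖G.prod K u‖) := by gcongr; exact le_abs_self c
      _ = 2 * |c| * ‖G.prod K u‖ := by ring
  have hcauchy : Cauchy (map z (l : Filter ℕ)) := by
    rw [← (hanti.isUniformInducing (G.prod K).uniformContinuous).cauchy_map_iff, map_map]
    exact (hGz.prodMk_nhds hκ).cauchy_map
  obtain ⟨v, hv⟩ := CompleteSpace.complete hcauchy
  have hv : Tendsto z l (𝓝 v) := hv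
  have h1 : ‖v‖ = 1 := tendsto_nhds_unique hv.norm (by simp [hz1])
  have h0 : v = 0 := hinj v (tendsto_nhds_unique ((A₀.continuous.tendsto v).comp hv) hAz)
  rw [h0, norm_zero] at h1
  exact zero_ne_one h1

/-- The eigenspan is defined by the forms of `G` and `A` alone, so it does not see the norm of `X`;
hypotheses and conclusion can be moved along `e`. -/
theorem exists_mul_norm_sub_le_of_equiv {H : Type*} [NormedAddCommGroup H] [InnerProductSpace ℝ H]
    [CompleteSpace H] [ProperSpace M] [CompleteSpace Z] {B : Set M} (hB : IsCompact B)
    {m₀ : M} (hm₀ : m₀ ∈ B) {G : X →L[ℝ] Y} {A : M → X →L[ℝ] Z} {A' : M →L[ℝ] X →L[ℝ] Z}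
    (e : X ≃L[ℝ] H)
    (he : ∀ u v, inner ℝ (e u) (e v) = inner ℝ (G u) (G v) + inner ℝ (A m₀ u) (A m₀ v))
    (hA : ContinuousOn A B) (hcomp : ∀ m ∈ B, IsCompactOperator (A m))
    (hA' : HasFDerivWithinAt A A' B m₀)
    (hU1 : ∀ m₁ ∈ B, ∀ m₂ ∈ B, ∀ u v, A m₁ u = A m₂ v → u ≠ 0 ∨ v ≠ 0 → m₁ = m₂ ∧ u = v)
    (hU2 : ∀ q, ‖q‖ = 1 → ∀ u v, A' q u = A m₀ v → u = 0 ∧ v = 0)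
    {β : ℝ} (hβ : 0 < β) {v₀ : X} (hv₀ : v₀ ≠ 0) :
    ∃ C : ℝ, 0 < C ∧ ∀ m ∈ B, ∀ u ∈ formEigenspan G (A m) β,
      C * ‖m - m₀‖ ≤ ‖A m u - A m₀ v₀‖ := by
  let R : (X →L[ℝ] Z) →L[ℝ] (H →L[ℝ] Z) :=
    (ContinuousLinearMap.compL ℝ H X Z).flip (e.symm : H →L[ℝ] X)
  have hR : ∀ T w, R T w = T (e.symm w) := fun T w => rfl
  have hRA : HasFDerivWithinAt (fun m => R (A m)) (R.comp A') B m₀ :=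
    R.hasFDerivAt.comp_hasFDerivWithinAt m₀ hA'
  have hRc : ∀ m ∈ B, IsCompactOperator (R (A m)) := fun m hm =>
    (hcomp m hm).comp_clm (e.symm : H →L[ℝ] X)
  obtain ⟨C, hC, h⟩ := exists_mul_norm_sub_le_of_inner_eq (M := M) (B := B) hB hm₀
    (G := G.comp (e.symm : H →L[ℝ] X))
    (A := fun m => R (A m)) (A' := R.comp A') (v₀ := e v₀) (β := β)
    (fun u v => by simpa [hR] using he (e.symm u) (e.symm v))
    (R.continuous.comp_continuousOn hA) hRc hRA
    (fun m₁ h₁ m₂ h₂ u v huv hne => by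
      simp only [hR] at huv
      have := hU1 m₁ h₁ m₂ h₂ (e.symm u) (e.symm v) huv (by simpa using hne)
      exact ⟨this.1, e.symm.injective this.2⟩)
    (fun q hq u v huv => by
      have := hU2 q hq (e.symm u) (e.symm v) huv
      simpa using this)
    hβ (by simpa using hv₀)
  refine ⟨C, hC, fun m hm u hu => ?_⟩
  have hu' : e u ∈ formEigenspan (G.comp (e.symm : H →L[ℝ] X)) (R (A m)) β := by
    refine (Submodule.span_le (p := (formEigenspan
      (G.comp (e.symm : H →L[ℝ] X)) (R (A m)) β).comap (e.toLinearEquiv : X →ₗ[ℝ] H))).2 ?_ hu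
    rintro w ⟨lam, hlam, hw⟩
    refine Submodule.subset_span ⟨lam, hlam, fun φ => ?_⟩
    simpa [hR] using hw (e.symm φ)
  have := h m hm (e u) hu'
  simpa [hR] using this

/-- A conditional Lipschitz lower bound for a family of compact operators on a Banach space, where
the energy `‖G u‖` controls the norm up to the operator `A m₀`. -/
theorem exists_mul_norm_sub_le [CompleteSpace X] [ProperSpace M] [CompleteSpace Z] {B : Set M} (hB : IsCompact B)
    {m₀ : M} (hm₀ : m₀ ∈ B) {G : X →L[ℝ] Y} {A : M → X →L[ℝ] Z} {A' : M →L[ℝ] X →L[ℝ] Z}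
    {c : ℝ} (hc : ∀ u, ‖u‖ ≤ c * (‖G u‖ + ‖A m₀ u‖))
    (hA : ContinuousOn A B) (hcomp : ∀ m ∈ B, IsCompactOperator (A m))
    (hA' : HasFDerivWithinAt A A' B m₀)
    (hU1 : ∀ m₁ ∈ B, ∀ m₂ ∈ B, ∀ u v, A m₁ u = A m₂ v → u ≠ 0 ∨ v ≠ 0 → m₁ = m₂ ∧ u = v)
    (hU2 : ∀ q, ‖q‖ = 1 → ∀ u v, A' q u = A m₀ v → u = 0 ∧ v = 0)
    {β : ℝ} (hβ : 0 < β) {v₀ : X} (hv₀ : v₀ ≠ 0) :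
    ∃ C : ℝ, 0 < C ∧ ∀ m ∈ B, ∀ u ∈ formEigenspan G (A m) β,
      C * ‖m - m₀‖ ≤ ‖A m u - A m₀ v₀‖ := by
  -- With the `L²` product norm, `J` pulls back exactly the inner product `⟨G u, G v⟩ + ⟨A m₀ u, A
  -- m₀ v⟩`. Its range, complete because `J` is bounded below, serves as the Hilbert space.
  let J : X →L[ℝ] WithLp 2 (Y × Z) :=
    ((WithLp.prodContinuousLinearEquiv 2 ℝ Y Z).symm : (Y × Z) →L[ℝ] WithLp 2 (Y × Z)).comp
      (G.prod (A m₀))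
  have hJinner : ∀ u v, inner ℝ (J u) (J v) =
      inner ℝ (G u) (G v) + inner ℝ (A m₀ u) (A m₀ v) := fun u v => rfl
  have hJbd : ∀ u, ‖u‖ ≤ (2 * |c|) * ‖J u‖ := by
    intro u
    have e : ‖J u‖ ^ 2 = ‖G u‖ ^ 2 + ‖A m₀ u‖ ^ 2 := by
      simp only [← real_inner_self_eq_norm_sq]; exact hJinner u u
    have h1 : ‖G u‖ ≤ ‖J u‖ :=
      (sq_le_sq₀ (norm_nonneg _) (norm_nonneg _)).1 (by nlinarith [sq_nonneg ‖A m₀ u‖])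
    have h2 : ‖A m₀ u‖ ≤ ‖J u‖ :=
      (sq_le_sq₀ (norm_nonneg _) (norm_nonneg _)).1 (by nlinarith [sq_nonneg ‖G u‖])
    calc ‖u‖ ≤ c * (‖G u‖ + ‖A m₀ u‖) := hc u
      _ ≤ |c| * (‖J u‖ + ‖J u‖) := by gcongr; exact le_abs_self c
      _ = 2 * |c| * ‖J u‖ := by ring
  clear_value J
  have hJinj : Function.Injective (J : X →ₗ[ℝ] WithLp 2 (Y × Z)) := by
    refine (injective_iff_map_eq_zero (J : X →ₗ[ℝ] WithLp 2 (Y × Z))).2 fun u hu => ?_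
    have h1 := hJbd u
    have h2 : J u = 0 := hu
    rw [h2, norm_zero, mul_zero] at h1
    exact norm_le_zero_iff.1 h1
  let e₀ := LinearEquiv.ofInjective (J : X →ₗ[ℝ] WithLp 2 (Y × Z)) hJinj
  let e := e₀.toContinuousLinearEquivOfBounds ‖J‖ (2 * |c|) (fun u => J.le_opNorm u) (by
    intro w
    obtain ⟨u, rfl⟩ := e₀.surjective w
    rw [LinearEquiv.symm_apply_apply]
    exact hJbd u)
  have : CompleteSpace (LinearMap.range (J : X →ₗ[ℝ] WithLp 2 (Y × Z))) :=
    (completeSpace_congr (e := e.toEquiv) e.isUniformEmbedding).1 inferInstance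
  exact exists_mul_norm_sub_le_of_equiv hB hm₀ e (fun u v => hJinner u v) hA hcomp hA' hU1 hU2
    hβ hv₀

end Banach

end KernelInverse

/-! ### Surface measure in bi-Lipschitz corner charts -/

namespace KernelInverse

open Filter Topology
open scoped NNReal ENNReal

theorem euclideanHausdorffMeasure_image_le {X Y : Type*} [MetricSpace X] [MeasurableSpace X]
    [BorelSpace X] [MetricSpace Y] [MeasurableSpace Y] [BorelSpace Y] {K : ℝ≥0} {f : X → Y}
    {s : Set X} (hf : LipschitzOnWith K f s) (n : ℕ) :
    (μHE[n] : Measure Y) (f '' s) ≤ (K : ℝ≥0∞) ^ n * (μHE[n] : Measure X) s := by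
  simp only [Measure.euclideanHausdorffMeasure_def, Measure.smul_apply, ENNReal.smul_def,
    smul_eq_mul]
  calc _ ≤ _ * ((K : ℝ≥0∞) ^ (n : ℝ) * Measure.hausdorffMeasure (n : ℝ) s) := by
        gcongr
        exact hf.hausdorffMeasure_image_le (Nat.cast_nonneg n)
    _ = _ := by rw [ENNReal.rpow_natCast]; ring

/-- The model corner `{z : zᵢ = 0 for i ≥ n, zᵢ ≥ 0 for i ∈ I}`. -/
def modelCorner {d : ℕ} (n : ℕ) (I : Finset (Fin d)) : Set (Eu d) :=
  {z | (∀ i : Fin d, n ≤ i.val → z i = 0) ∧ ∀ i ∈ I, 0 ≤ z i}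

theorem isClosed_modelCorner {d : ℕ} (n : ℕ) (I : Finset (Fin d)) :
    IsClosed (modelCorner n I) := by
  have : modelCorner n I = (⋂ i : Fin d, ⋂ _ : n ≤ i.val, {z : Eu d | z i = 0}) ∩
      ⋂ i ∈ I, {z : Eu d | 0 ≤ z i} := by
    ext z; simp [modelCorner]
  rw [this]
  refine IsClosed.inter ?_ ?_
  · exact isClosed_iInter fun i => isClosed_iInter fun _ => isClosed_eq (by fun_prop) (by fun_prop)
  · exact isClosed_iInter fun i => isClosed_iInter fun _ => isClosed_le (by fun_prop) (by fun_prop)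

theorem convex_modelCorner {d : ℕ} (n : ℕ) (I : Finset (Fin d)) : Convex ℝ (modelCorner n I) := by
  intro z hz w hw a b ha hb _
  refine ⟨fun i hi => ?_, fun i hi => ?_⟩
  · simp [hz.1 i hi, hw.1 i hi]
  · have h1 := hz.2 i hi
    have h2 := hw.2 i hi
    simp only [PiLp.add_apply, PiLp.smul_apply, smul_eq_mul]
    positivity

/-- Extension by zero `ℝⁿ → ℝᵈ`. -/
def zeroExtend (n d : ℕ) : Eu n →ₗ[ℝ] Eu d where
  toFun z := WithLp.toLp 2 fun i : Fin d => if h : i.val < n then z ⟨i.val, h⟩ else 0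
  map_add' z w := by
    ext i
    by_cases h : i.val < n <;> simp [h]
  map_smul' c z := by
    ext i
    by_cases h : i.val < n <;> simp [h]

/-- A bounded piece of the corner lies in the image of a ball of `ℝⁿ` under extension by zero, a
Lipschitz map, and on `ℝⁿ` the measure is Lebesgue measure. -/
theorem euclideanHausdorffMeasure_lt_top_of_isBounded {d n : ℕ} (hn : n ≤ d)
    {I : Finset (Fin d)} {s : Set (Eu d)} (hs : Bornology.IsBounded s) (hsI : s ⊆ modelCorner n I) :
    (μHE[n] : Measure (Eu d)) s < ∞ := by
  obtain ⟨ρ, hρ⟩ := hs.exists_norm_le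
  let L := (zeroExtend n d).toContinuousLinearMap
  have hsub : s ⊆ L '' Metric.closedBall 0 ρ := by
    intro z hz
    refine ⟨WithLp.toLp 2 fun j : Fin n => z (Fin.castLE hn j), ?_, ?_⟩
    · rw [mem_closedBall_zero_iff]
      refine le_trans ?_ (hρ z hz)
      rw [EuclideanSpace.norm_eq, EuclideanSpace.norm_eq]
      refine Real.sqrt_le_sqrt ?_
      refine (Finset.sum_map Finset.univ (Fin.castLEEmb hn)
        (fun i : Fin d => ‖z i‖ ^ 2)).symm.le.trans ?_
      exact Finset.sum_le_sum_of_subset_of_nonneg (Finset.subset_univ _)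
        fun _ _ _ => by positivity
    · ext i
      change (if h : i.val < n then z (Fin.castLE hn ⟨i.val, h⟩) else 0) = z i
      by_cases h : i.val < n
      · simp [h]
      · rw [dif_neg h, (hsI hz).1 i (not_lt.1 h)]
  refine (measure_mono hsub).trans_lt ?_
  refine (euclideanHausdorffMeasure_image_le (L.lipschitz.lipschitzOnWith) n).trans_lt ?_
  rw [EuclideanSpace.euclideanHausdorffMeasure_eq_volume]
  exact ENNReal.mul_lt_top (ENNReal.pow_lt_top ENNReal.coe_lt_top)
    (isCompact_closedBall _ _).measure_lt_top

/-- A corner chart with bi-Lipschitz bounds on a ball. -/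
structure IsLipschitzChart {d : ℕ} (S : Set (Eu d)) (n : ℕ)
    (Φ : OpenPartialHomeomorph (Eu d) (Eu d)) (I : Finset (Fin d)) (z₀ : Eu d) (ρ : ℝ) (L : ℝ≥0) :
    Prop extends IsCornerChart S n Φ I where
  pos : 0 < ρ
  ball_subset : Metric.ball z₀ (2 * ρ) ⊆ Φ.target
  lipschitz_symm : LipschitzOnWith L Φ.symm (Metric.ball z₀ (2 * ρ))
  lipschitz : LipschitzOnWith L Φ (Φ.symm '' Metric.ball z₀ (2 * ρ))

theorem IsCornerChart.exists_isLipschitzChart {d n : ℕ} {S : Set (Eu d)}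
    {Φ : OpenPartialHomeomorph (Eu d) (Eu d)} {I : Finset (Fin d)} (h : IsCornerChart S n Φ I)
    {x : Eu d} (hx : x ∈ Φ.source) : ∃ ρ L, IsLipschitzChart S n Φ I (Φ x) ρ L := by
  have hz : Φ x ∈ Φ.target := Φ.map_source hx
  obtain ⟨L₁, t₁, ht₁, hL₁⟩ := (h.contDiffOn_toFun.contDiffAt
    (Φ.open_source.mem_nhds hx)).exists_lipschitzOnWith
  obtain ⟨L₂, t₂, ht₂, hL₂⟩ := (h.contDiffOn_symm.contDiffAt
    (Φ.open_target.mem_nhds hz)).exists_lipschitzOnWith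
  have hcont : Tendsto Φ.symm (𝓝 (Φ x)) (𝓝 x) := by
    have := Φ.symm.continuousAt (x := Φ x) hz
    rwa [ContinuousAt, Φ.left_inv hx] at this
  obtain ⟨ε, hε, hεs⟩ := Metric.mem_nhds_iff.1
    (inter_mem (inter_mem (Φ.open_target.mem_nhds hz) ht₂) (hcont ht₁))
  -- Halving keeps the closed ball of radius `ρ` inside the open ball of radius `2 * ρ` where the
  -- Lipschitz bounds hold, so the derivative of `Φ.symm` is bounded by `L` at every point of the
  -- compact piece.
  refine ⟨ε / 2, max L₁ L₂, h, by positivity, ?_, ?_, ?_⟩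
  all_goals rw [mul_div_cancel₀ _ (two_ne_zero' ℝ)]
  · exact fun y hy => (hεs hy).1.1
  · exact (hL₂.mono fun y hy => (hεs hy).1.2).weaken (le_max_right _ _)
  · refine (hL₁.mono ?_).weaken (le_max_left _ _)
    rintro _ ⟨y, hy, rfl⟩
    exact (hεs hy).2

section Chart

variable {d n : ℕ} {S : Set (Eu d)} {Φ : OpenPartialHomeomorph (Eu d) (Eu d)}
  {I : Finset (Fin d)} {z₀ : Eu d} {ρ : ℝ} {L : ℝ≥0}

/-- A convex piece of the model corner. -/
def cornerPiece (n : ℕ) (I : Finset (Fin d)) (z₀ : Eu d) (ρ : ℝ) : Set (Eu d) :=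
  Metric.closedBall z₀ ρ ∩ modelCorner n I

theorem isCompact_cornerPiece : IsCompact (cornerPiece n I z₀ ρ) :=
  (isCompact_closedBall z₀ ρ).inter_right (isClosed_modelCorner n I)

theorem convex_cornerPiece : Convex ℝ (cornerPiece n I z₀ ρ) :=
  (convex_closedBall z₀ ρ).inter (convex_modelCorner n I)

namespace IsLipschitzChart

theorem cornerPiece_subset_ball (h : IsLipschitzChart S n Φ I z₀ ρ L) :
    cornerPiece n I z₀ ρ ⊆ Metric.ball z₀ (2 * ρ) :=
  inter_subset_left.trans (Metric.closedBall_subset_ball (by linarith [h.pos]))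

theorem cornerPiece_subset_target (h : IsLipschitzChart S n Φ I z₀ ρ L) :
    cornerPiece n I z₀ ρ ⊆ Φ.target :=
  h.cornerPiece_subset_ball.trans h.ball_subset

theorem symm_mem (h : IsLipschitzChart S n Φ I z₀ ρ L) {y : Eu d} (hy : y ∈ Φ.target)
    (hyI : y ∈ modelCorner n I) : Φ.symm y ∈ S := by
  rw [h.straightens _ (Φ.map_target hy), Φ.right_inv hy]
  exact hyI

theorem image_subset (h : IsLipschitzChart S n Φ I z₀ ρ L) :
    Φ.symm '' cornerPiece n I z₀ ρ ⊆ S := by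
  rintro _ ⟨y, hy, rfl⟩
  exact h.symm_mem (h.cornerPiece_subset_target hy) hy.2

theorem continuousOn_symm (h : IsLipschitzChart S n Φ I z₀ ρ L) :
    ContinuousOn Φ.symm (cornerPiece n I z₀ ρ) :=
  Φ.symm.continuousOn.mono h.cornerPiece_subset_target

theorem isCompact_image (h : IsLipschitzChart S n Φ I z₀ ρ L) :
    IsCompact (Φ.symm '' cornerPiece n I z₀ ρ) :=
  isCompact_cornerPiece.image_of_continuousOn h.continuousOn_symm

theorem image_mem_nhdsWithin {x : Eu d} (hx : x ∈ Φ.source)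
    (h : IsLipschitzChart S n Φ I (Φ x) ρ L) :
    Φ.symm '' cornerPiece n I (Φ x) ρ ∈ 𝓝[S] x := by
  have h1 : Φ.source ∩ Φ ⁻¹' Metric.closedBall (Φ x) ρ ∈ 𝓝 x :=
    inter_mem (Φ.open_source.mem_nhds hx)
      ((Φ.continuousAt hx) (Metric.closedBall_mem_nhds _ h.pos))
  filter_upwards [mem_nhdsWithin_of_mem_nhds h1, self_mem_nhdsWithin] with y hy hyS
  exact ⟨Φ y, ⟨hy.2, (h.straightens y hy.1).1 hyS⟩, Φ.left_inv hy.1⟩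

theorem measure_cornerPiece_lt_top (h : IsLipschitzChart S n Φ I z₀ ρ L) :
    (μHE[n] : Measure (Eu d)) (cornerPiece n I z₀ ρ) < ∞ :=
  euclideanHausdorffMeasure_lt_top_of_isBounded h.dim_le isCompact_cornerPiece.isBounded
    inter_subset_right

theorem measure_image_le (h : IsLipschitzChart S n Φ I z₀ ρ L) {s : Set (Eu d)}
    (hs : s ⊆ cornerPiece n I z₀ ρ) :
    (μHE[n] : Measure (Eu d)) (Φ.symm '' s) ≤ (L : ℝ≥0∞) ^ n * (μHE[n] : Measure (Eu d)) s :=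
  euclideanHausdorffMeasure_image_le
    (h.lipschitz_symm.mono (hs.trans h.cornerPiece_subset_ball)) n

theorem measure_le_image (h : IsLipschitzChart S n Φ I z₀ ρ L) {s : Set (Eu d)}
    (hs : s ⊆ cornerPiece n I z₀ ρ) :
    (μHE[n] : Measure (Eu d)) s ≤ (L : ℝ≥0∞) ^ n * (μHE[n] : Measure (Eu d)) (Φ.symm '' s) := by
  have h1 : s = Φ '' (Φ.symm '' s) := by
    rw [image_image]
    conv_lhs => rw [← image_id s]
    exact image_congr fun y hy => (Φ.right_inv (h.cornerPiece_subset_target (hs hy))).symm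
  conv_lhs => rw [h1]
  exact euclideanHausdorffMeasure_image_le
    (h.lipschitz.mono (image_mono (hs.trans h.cornerPiece_subset_ball))) n

theorem measure_image_lt_top (h : IsLipschitzChart S n Φ I z₀ ρ L) :
    (μHE[n] : Measure (Eu d)) (Φ.symm '' cornerPiece n I z₀ ρ) < ∞ :=
  (h.measure_image_le subset_rfl).trans_lt
    (ENNReal.mul_lt_top (ENNReal.pow_lt_top ENNReal.coe_lt_top) h.measure_cornerPiece_lt_top)

theorem aemeasurable_symm (h : IsLipschitzChart S n Φ I z₀ ρ L) :
    AEMeasurable Φ.symm ((μHE[n] : Measure (Eu d)).restrict (cornerPiece n I z₀ ρ)) :=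
  h.continuousOn_symm.aemeasurable isCompact_cornerPiece.measurableSet

/-- The surface measure on a chart image is controlled by the measure on the model corner. -/
theorem restrict_image_le (h : IsLipschitzChart S n Φ I z₀ ρ L) :
    (μHE[n] : Measure (Eu d)).restrict (Φ.symm '' cornerPiece n I z₀ ρ) ≤
      (L : ℝ≥0∞) ^ n •
        ((μHE[n] : Measure (Eu d)).restrict (cornerPiece n I z₀ ρ)).map Φ.symm := by
  refine Measure.le_iff.2 fun E hE => ?_
  rw [Measure.smul_apply, smul_eq_mul, Measure.map_apply_of_aemeasurable h.aemeasurable_symm hE,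
    Measure.restrict_apply hE, Measure.restrict_apply' isCompact_cornerPiece.measurableSet]
  refine le_trans (measure_mono ?_) (h.measure_image_le inter_subset_right)
  rintro _ ⟨hyE, y, hy, rfl⟩
  exact ⟨y, ⟨hyE, hy⟩, rfl⟩

theorem map_symm_le (h : IsLipschitzChart S n Φ I z₀ ρ L) :
    ((μHE[n] : Measure (Eu d)).restrict (cornerPiece n I z₀ ρ)).map Φ.symm ≤
      (L : ℝ≥0∞) ^ n • surfaceMeasure S n := by
  refine Measure.le_iff.2 fun E hE => ?_
  rw [Measure.smul_apply, smul_eq_mul, Measure.map_apply_of_aemeasurable h.aemeasurable_symm hE,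
    surfaceMeasure, Measure.restrict_apply hE,
    Measure.restrict_apply' isCompact_cornerPiece.measurableSet]
  refine (h.measure_le_image inter_subset_right).trans ?_
  gcongr
  rintro _ ⟨y, ⟨hyE, hy⟩, rfl⟩
  exact ⟨hyE, h.image_subset ⟨y, hy, rfl⟩⟩

end IsLipschitzChart

end Chart

theorem IsCompactManifold.exists_isLipschitzChart {d n : ℕ} {S : Set (Eu d)}
    (hS : IsCompactManifold S n) {x : Eu d} (hx : x ∈ S) :
    ∃ Φ I ρ L, x ∈ Φ.source ∧ IsLipschitzChart S n Φ I (Φ x) ρ L := by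
  obtain ⟨Φ, I, hΦ, hxΦ⟩ := hS.exists_chart x hx
  obtain ⟨ρ, L, h⟩ := hΦ.exists_isLipschitzChart hxΦ
  exact ⟨Φ, I, ρ, L, hxΦ, h⟩

theorem IsCompactManifold.isFiniteMeasure_surfaceMeasure {d n : ℕ} {S : Set (Eu d)}
    (hS : IsCompactManifold S n) : IsFiniteMeasure (surfaceMeasure S n) := by
  refine ⟨?_⟩
  rw [surfaceMeasure, Measure.restrict_apply_univ]
  refine hS.isCompact.measure_lt_top_of_nhdsWithin fun x hx => ?_
  obtain ⟨Φ, I, ρ, L, hxΦ, h⟩ := hS.exists_isLipschitzChart hx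
  exact ⟨_, h.image_mem_nhdsWithin hxΦ, h.measure_image_lt_top⟩

end KernelInverse

/-! ### Poincaré inequality on convex sets -/

namespace KernelInverse

open Filter Topology
open scoped NNReal ENNReal

section Convex

variable {d n : ℕ} {K : Set (Eu d)}

/-- The homothety with centre `w` and ratio `s` maps the convex set `K` into itself and multiplies
`n`-dimensional Hausdorff measure by `s ^ n`, whatever the dimension of the ambient space. -/
theorem lintegral_homothety_le (hK : Convex ℝ K) {w : Eu d} (hw : w ∈ K)
    {s : ℝ} (hs : 0 < s) (hs1 : s ≤ 1) {g : Eu d → ℝ≥0∞} (hg : Measurable g) :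
    ∫⁻ z in K, g (w + s • (z - w)) ∂(μHE[n]) ≤
      ENNReal.ofReal s⁻¹ ^ n * ∫⁻ z in K, g z ∂(μHE[n]) := by
  have hm : Measurable fun z : Eu d => w + s • (z - w) := by fun_prop
  rw [← lintegral_map hg hm, ← smul_eq_mul, ← lintegral_smul_measure]
  refine lintegral_mono' (Measure.le_iff.2 fun E hE => ?_) le_rfl
  rw [Measure.map_apply hm hE, Measure.restrict_apply (hm hE), Measure.smul_apply,
    Measure.restrict_apply hE]
  have hfun : (fun z : Eu d => w + s • (z - w)) = AffineMap.homothety w s := by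
    funext z
    rw [AffineMap.homothety_apply, vsub_eq_sub, vadd_eq_add, add_comm]
  have hsub : (fun z : Eu d => w + s • (z - w)) ⁻¹' E ∩ K ⊆
      (AffineMap.homothety w s) ⁻¹' (E ∩ K) := by
    rintro z ⟨hzE, hzK⟩
    rw [← hfun]
    refine ⟨hzE, ?_⟩
    exact hK.add_smul_sub_mem hw hzK ⟨hs.le, hs1⟩
  refine (measure_mono hsub).trans (le_of_eq ?_)
  rw [euclideanHausdorffMeasure_homothety_preimage n w hs.ne', ENNReal.smul_def, smul_eq_mul,
    smul_eq_mul]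
  congr 1
  rw [ENNReal.coe_pow, ENNReal.ofReal, ← nnnorm_inv]
  congr 2
  exact (Real.toNNReal_eq_nnnorm_of_nonneg (inv_nonneg.2 hs.le)).symm

/-- Freeze `z` if `s ≤ 1 / 2` and `w` otherwise. In the other variable the map is a homothety of
ratio at least `1 / 2`, whose inverse Jacobian is at most `2 ^ n`; this avoids the singularity at
either end of the segment. -/
theorem lintegral_lintegral_segment_le (hK : Convex ℝ K)
    (hKfin : (μHE[n] : Measure (Eu d)) K < ∞) {s : ℝ} (hs : s ∈ Icc (0 : ℝ) 1)
    {g : Eu d → ℝ≥0∞} (hg : Measurable g) :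
    ∫⁻ z in K, ∫⁻ w in K, g (w + s • (z - w)) ∂(μHE[n]) ∂(μHE[n]) ≤
      2 ^ n * (μHE[n] : Measure (Eu d)) K * ∫⁻ z in K, g z ∂(μHE[n]) := by
  have : IsFiniteMeasure ((μHE[n] : Measure (Eu d)).restrict K) := ⟨by simpa using hKfin⟩
  have hpow : ∀ t : ℝ, 1 / 2 ≤ t → ENNReal.ofReal t⁻¹ ≤ 2 := by
    intro t ht
    have h2 : t⁻¹ ≤ 2 := by
      rw [inv_le_comm₀ (by linarith) two_pos]; linarith
    exact (ENNReal.ofReal_le_ofReal h2).trans (by simp)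
  have hconst : ∀ J : Eu d → ℝ≥0∞,
      (∀ z ∈ K, J z ≤ 2 ^ n * ∫⁻ z in K, g z ∂(μHE[n])) →
      ∫⁻ z in K, J z ∂(μHE[n]) ≤
        2 ^ n * (μHE[n] : Measure (Eu d)) K * ∫⁻ z in K, g z ∂(μHE[n]) := by
    intro J hJ
    refine (setLIntegral_mono measurable_const hJ).trans (le_of_eq ?_)
    rw [setLIntegral_const]; ring
  rcases le_total s (1 / 2) with h | h
  · refine hconst _ fun z hz => ?_
    have e : ∀ w : Eu d, w + s • (z - w) = z + (1 - s) • (w - z) := by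
      intro w; module
    simp only [e]
    refine (lintegral_homothety_le hK hz (by linarith) (by linarith [hs.1]) hg).trans ?_
    gcongr
    exact hpow (1 - s) (by linarith)
  · rw [lintegral_lintegral_swap (by fun_prop)]
    refine hconst _ fun w hw => ?_
    refine (lintegral_homothety_le hK hw (by linarith) hs.2 hg).trans ?_
    gcongr
    exact hpow _ h

/-- A Poincaré inequality on a convex set for the `n`-dimensional Hausdorff measure. -/
theorem lintegral_lintegral_sub_sq_le (hK : Convex ℝ K) (hKm : MeasurableSet K)
    (hKfin : (μHE[n] : Measure (Eu d)) K < ∞) {F : Eu d → ℝ} {g : Eu d → ℝ≥0∞}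
    (hg : Measurable g) {c : ℝ≥0∞} (hc : c ≠ ∞)
    (hF : ∀ z ∈ K, ∀ w ∈ K, ‖F z - F w‖ₑ ^ 2 ≤
      c * ∫⁻ s in Icc (0 : ℝ) 1, g (w + s • (z - w))) :
    ∫⁻ z in K, ∫⁻ w in K, ‖F z - F w‖ₑ ^ 2 ∂(μHE[n]) ∂(μHE[n]) ≤
      c * (2 ^ n * (μHE[n] : Measure (Eu d)) K) * ∫⁻ z in K, g z ∂(μHE[n]) := by
  have : IsFiniteMeasure ((μHE[n] : Measure (Eu d)).restrict K) := ⟨by simpa using hKfin⟩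
  calc ∫⁻ z in K, ∫⁻ w in K, ‖F z - F w‖ₑ ^ 2 ∂(μHE[n]) ∂(μHE[n])
      ≤ ∫⁻ z in K, ∫⁻ w in K, (c * ∫⁻ s in Icc (0 : ℝ) 1, g (w + s • (z - w)))
          ∂(μHE[n]) ∂(μHE[n]) :=
        setLIntegral_mono' hKm fun z hz => setLIntegral_mono' hKm fun w hw => hF z hz w hw
    _ = c * ∫⁻ z in K, ∫⁻ w in K, (∫⁻ s in Icc (0 : ℝ) 1, g (w + s • (z - w)))
          ∂(μHE[n]) ∂(μHE[n]) := by
        rw [← lintegral_const_mul' _ _ hc]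
        exact lintegral_congr fun z => lintegral_const_mul' _ _ hc
    _ = c * ∫⁻ z in K, (∫⁻ s in Icc (0 : ℝ) 1, ∫⁻ w in K, g (w + s • (z - w)) ∂(μHE[n]))
          ∂(μHE[n]) := by
        congr 1
        exact lintegral_congr fun z => lintegral_lintegral_swap (by fun_prop)
    _ = c * ∫⁻ s in Icc (0 : ℝ) 1, ∫⁻ z in K, ∫⁻ w in K, g (w + s • (z - w))
          ∂(μHE[n]) ∂(μHE[n]) := by
        congr 1
        refine lintegral_lintegral_swap (Measurable.aemeasurable ?_)
        refine Measurable.lintegral_prod_right' (f := fun p : (Eu d × ℝ) × Eu d =>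
          g (p.2 + p.1.2 • (p.1.1 - p.2))) (by fun_prop)
    _ ≤ c * ∫⁻ s in Icc (0 : ℝ) 1,
          2 ^ n * (μHE[n] : Measure (Eu d)) K * ∫⁻ z in K, g z ∂(μHE[n]) := by
        gcongr c * ?_
        exact setLIntegral_mono' measurableSet_Icc fun s hs =>
          lintegral_lintegral_segment_le hK hKfin hs hg
    _ = _ := by
        rw [setLIntegral_const, Real.volume_Icc]
        simp
        ring

end Convex

/-- Expand the nonnegative integral of `(h - m) ^ 2`, where `m` is the mean of `h`. -/
theorem sq_intervalIntegral_le {h : ℝ → ℝ} (hh : ContinuousOn h (Icc 0 1)) :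
    (∫ s in (0 : ℝ)..1, h s) ^ 2 ≤ ∫ s in (0 : ℝ)..1, h s ^ 2 := by
  have hu : uIcc (0 : ℝ) 1 = Icc 0 1 := uIcc_of_le zero_le_one
  set m := ∫ s in (0 : ℝ)..1, h s with hm
  have h1 : IntervalIntegrable h volume 0 1 := ContinuousOn.intervalIntegrable (hu ▸ hh)
  have h2 : IntervalIntegrable (fun s => h s ^ 2) volume 0 1 :=
    ContinuousOn.intervalIntegrable (hu ▸ hh.pow 2)
  have h3 : 0 ≤ ∫ s in (0 : ℝ)..1, (h s - m) ^ 2 :=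
    intervalIntegral.integral_nonneg zero_le_one fun s _ => sq_nonneg _
  have h4 : ∫ s in (0 : ℝ)..1, (h s - m) ^ 2 = (∫ s in (0 : ℝ)..1, h s ^ 2) - 2 * m * m + m ^ 2 := by
    have e : ∀ s, (h s - m) ^ 2 = h s ^ 2 - 2 * m * h s + m ^ 2 := fun s => by ring
    simp only [e]
    rw [intervalIntegral.integral_add (h2.sub (h1.const_mul _)) intervalIntegrable_const,
      intervalIntegral.integral_sub h2 (h1.const_mul _), intervalIntegral.integral_const_mul, ← hm]
    simp
  nlinarith

/-- The difference of a `C¹` function at two points of a convex set is controlled by its derivative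
along the segment, in the directions of the range of a linear map `π`. -/
theorem enorm_sub_sq_le_lintegral_segment {E : Type*} [NormedAddCommGroup E] [NormedSpace ℝ E]
    {U K : Set E} (hU : IsOpen U) (hK : Convex ℝ K) (hKU : K ⊆ U) {F : E → ℝ}
    (hF : ContDiffOn ℝ 1 F U) (π : E →L[ℝ] E) {z w : E} (hz : z ∈ K) (hw : w ∈ K)
    (hπ : π (z - w) = z - w) {b : ℝ} (hb : ‖z - w‖ ≤ b) :
    ‖F z - F w‖ₑ ^ 2 ≤ ENNReal.ofReal (b ^ 2) *
      ∫⁻ s in Icc (0 : ℝ) 1, K.indicator (fun y => ‖(fderiv ℝ F y).comp π‖ₑ ^ 2)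
        (w + s • (z - w)) := by
  have hseg : ∀ s ∈ Icc (0 : ℝ) 1, w + s • (z - w) ∈ K := fun s hs =>
    hK.add_smul_sub_mem hw hz hs
  have hcont : ContinuousOn (fun s : ℝ => fderiv ℝ F (w + s • (z - w))) (Icc 0 1) :=
    (hF.continuousOn_fderiv_of_isOpen hU le_rfl).comp (by fun_prop) fun s hs => hKU (hseg s hs)
  have hder : ∀ s ∈ Icc (0 : ℝ) 1, HasDerivAt (fun s : ℝ => F (w + s • (z - w)))
      (fderiv ℝ F (w + s • (z - w)) (z - w)) s := by
    intro s hs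
    have h1 : HasFDerivAt F (fderiv ℝ F (w + s • (z - w))) (w + s • (z - w)) :=
      ((hF.differentiableOn one_ne_zero).differentiableAt
        (hU.mem_nhds (hKU (hseg s hs)))).hasFDerivAt
    have h2 : HasDerivAt (fun s : ℝ => w + s • (z - w)) (z - w) s := by
      simpa using ((hasDerivAt_id s).smul_const (z - w)).const_add w
    exact h1.comp_hasDerivAt s h2
  have hu : uIcc (0 : ℝ) 1 = Icc 0 1 := uIcc_of_le zero_le_one
  have hft : ∫ s in (0 : ℝ)..1, fderiv ℝ F (w + s • (z - w)) (z - w) = F z - F w := by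
    rw [intervalIntegral.integral_eq_sub_of_hasDerivAt (by rwa [hu])
      (ContinuousOn.intervalIntegrable (hu ▸ hcont.clm_apply continuousOn_const))]
    simp
  -- Composition with `π` loses nothing, since `π` fixes `z - w`, and it keeps only the directions
  -- that a tangential gradient can control.
  set h : ℝ → ℝ := fun s => ‖(fderiv ℝ F (w + s • (z - w))).comp π‖ with hh
  have hhc : ContinuousOn h (Icc 0 1) := (hcont.clm_comp continuousOn_const).norm
  have hb0 : 0 ≤ b := (norm_nonneg _).trans hb
  have hle : |F z - F w| ≤ b * ∫ s in (0 : ℝ)..1, h s := by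
    rw [← hft, ← Real.norm_eq_abs, ← intervalIntegral.integral_const_mul]
    refine intervalIntegral.norm_integral_le_of_norm_le zero_le_one ?_
      (ContinuousOn.intervalIntegrable (hu ▸ continuousOn_const.mul hhc))
    refine ae_of_all _ fun s _ => ?_
    calc ‖fderiv ℝ F (w + s • (z - w)) (z - w)‖
        = ‖(fderiv ℝ F (w + s • (z - w))).comp π (z - w)‖ := by
          rw [ContinuousLinearMap.comp_apply, hπ]
      _ ≤ h s * ‖z - w‖ := ContinuousLinearMap.le_opNorm _ _
      _ ≤ b * h s := by rw [mul_comm]; gcongr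
  have hsq : (F z - F w) ^ 2 ≤ b ^ 2 * ∫ s in (0 : ℝ)..1, h s ^ 2 := by
    rw [← sq_abs]
    calc |F z - F w| ^ 2 ≤ (b * ∫ s in (0 : ℝ)..1, h s) ^ 2 := by gcongr
      _ = b ^ 2 * (∫ s in (0 : ℝ)..1, h s) ^ 2 := by ring
      _ ≤ _ := by gcongr; exact sq_intervalIntegral_le hhc
  have h1 : ‖F z - F w‖ₑ ^ 2 = ENNReal.ofReal ((F z - F w) ^ 2) := by
    rw [Real.enorm_eq_ofReal_abs, ← ENNReal.ofReal_pow (abs_nonneg _), sq_abs]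
  have hint : IntegrableOn (fun s => h s ^ 2) (Icc 0 1) := (hhc.pow 2).integrableOn_Icc
  rw [h1]
  refine (ENNReal.ofReal_le_ofReal hsq).trans (le_of_eq ?_)
  rw [ENNReal.ofReal_mul (sq_nonneg b), intervalIntegral.integral_of_le zero_le_one,
    ← integral_Icc_eq_integral_Ioc,
    ofReal_integral_eq_lintegral_ofReal hint (ae_of_all _ fun s => sq_nonneg _)]
  congr 1
  refine setLIntegral_congr_fun measurableSet_Icc fun s hs => ?_
  simp only [indicator_of_mem (hseg s hs), hh]
  rw [ENNReal.ofReal_pow (norm_nonneg _), ofReal_norm]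

end KernelInverse

/-! ### Poincaré inequality in a chart -/

namespace KernelInverse

open Filter Topology
open scoped NNReal ENNReal

/-- The coordinate projection of `ℝᵈ` onto `ℝⁿ × {0}`. -/
def headProj (n d : ℕ) : Eu d →ₗ[ℝ] Eu d where
  toFun z := WithLp.toLp 2 fun i : Fin d => if i.val < n then z i else 0
  map_add' z w := by
    ext i
    by_cases h : i.val < n <;> simp [h]
  map_smul' c z := by
    ext i
    by_cases h : i.val < n <;> simp [h]

theorem headProj_apply (n d : ℕ) (z : Eu d) (i : Fin d) :
    headProj n d z i = if i.val < n then z i else 0 := rfl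

theorem norm_headProj_le (n d : ℕ) (z : Eu d) : ‖headProj n d z‖ ≤ ‖z‖ := by
  rw [EuclideanSpace.norm_eq, EuclideanSpace.norm_eq]
  refine Real.sqrt_le_sqrt (Finset.sum_le_sum fun i _ => ?_)
  rw [headProj_apply]
  split_ifs
  · exact le_rfl
  · simpa using sq_nonneg (z i)

theorem headProj_of_tail_eq_zero {n d : ℕ} {z : Eu d} (h : ∀ i : Fin d, n ≤ i.val → z i = 0) :
    headProj n d z = z := by
  ext i
  rw [headProj_apply]
  split_ifs with hi
  · rfl
  · rw [h i (not_lt.1 hi)]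

theorem headProj_eq_sum (n d : ℕ) (z : Eu d) :
    headProj n d z = ∑ i : Fin d, if i.val < n then z i • EuclideanSpace.single i (1 : ℝ) else 0 := by
  ext j
  rw [headProj_apply]
  simp only [WithLp.ofLp_sum, Finset.sum_apply]
  rw [Finset.sum_eq_single j]
  · split_ifs <;> simp
  · intro i _ hij
    split_ifs <;> simp [hij.symm]
  · simp

namespace IsLipschitzChart

variable {d n : ℕ} {S : Set (Eu d)} {Φ : OpenPartialHomeomorph (Eu d) (Eu d)}
  {I : Finset (Fin d)} {z₀ : Eu d} {ρ : ℝ} {L : ℝ≥0}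

theorem hasFDerivAt_symm (h : IsLipschitzChart S n Φ I z₀ ρ L) {y : Eu d} (hy : y ∈ Φ.target) :
    HasFDerivAt Φ.symm (fderiv ℝ Φ.symm y) y :=
  ((h.contDiffOn_symm.differentiableOn one_ne_zero).differentiableAt
    (Φ.open_target.mem_nhds hy)).hasFDerivAt

/-- For `i < n`, adding the `i`-th basis vector to `y` stays in the corner even when `y` is on a
face, so that vector is in the tangent cone. The derivative of `Φ.symm` carries it to the tangent
cone of `S`; passing to the span handles arbitrary signs. -/
theorem fderiv_symm_headProj_mem (h : IsLipschitzChart S n Φ I z₀ ρ L) {y : Eu d}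
    (hy : y ∈ cornerPiece n I z₀ ρ) (e : Eu d) :
    fderiv ℝ Φ.symm y (headProj n d e) ∈ tangentPlane S (Φ.symm y) := by
  have hyt := h.cornerPiece_subset_target hy
  rw [headProj_eq_sum, map_sum]
  refine sum_mem fun i _ => ?_
  split_ifs with hi
  swap
  · rw [map_zero]; exact zero_mem _
  rw [map_smul]
  refine Submodule.smul_mem _ _ (Submodule.subset_span ?_)
  have h1 : EuclideanSpace.single i (1 : ℝ) ∈ tangentConeAt ℝ (modelCorner n I ∩ Φ.target) y := by
    rw [tangentConeAt_inter_nhds (Φ.open_target.mem_nhds hyt)]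
    have h2 : y + EuclideanSpace.single i (1 : ℝ) ∈ modelCorner n I := by
      refine ⟨fun j hj => ?_, fun j hj => ?_⟩
      · have hij : j ≠ i := by rintro rfl; omega
        simp [hy.2.1 j hj, hij]
      · have h3 := hy.2.2 j hj
        rcases eq_or_ne j i with rfl | hij
        · simp; positivity
        · simpa [hij] using h3
    have h4 := mem_tangentConeAt_of_segment_subset
      ((convex_modelCorner n I).segment_subset hy.2 h2)
    simpa using h4
  refine tangentConeAt_mono ?_
    ((h.hasFDerivAt_symm hyt).hasFDerivWithinAt.mapsTo_tangent_cone h1)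
  rintro _ ⟨w, hw, rfl⟩
  exact h.symm_mem hw.2 hw.1

/-- By the chain rule, the derivative of `f` is evaluated only on tangent vectors, where it equals
the pairing with the projected gradient. -/
theorem norm_fderiv_comp_headProj_le (h : IsLipschitzChart S n Φ I z₀ ρ L) {f : Eu d → ℝ}
    (hf : ContDiff ℝ 1 f) {y : Eu d} (hy : y ∈ cornerPiece n I z₀ ρ) :
    ‖(fderiv ℝ (f ∘ Φ.symm) y).comp (headProj n d).toContinuousLinearMap‖ ≤
      L * ‖surfaceGrad S f (Φ.symm y)‖ := by
  have hyt := h.cornerPiece_subset_target hy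
  have hfd : DifferentiableAt ℝ f (Φ.symm y) := (hf.differentiable one_ne_zero) _
  refine ContinuousLinearMap.opNorm_le_bound _ (by positivity) fun e => ?_
  have e1 : ((fderiv ℝ (f ∘ Φ.symm) y).comp (headProj n d).toContinuousLinearMap) e =
      fderiv ℝ f (Φ.symm y) (fderiv ℝ Φ.symm y (headProj n d e)) := by
    rw [fderiv_comp y hfd (h.hasFDerivAt_symm hyt).differentiableAt]
    rfl
  have e2 : fderiv ℝ f (Φ.symm y) (fderiv ℝ Φ.symm y (headProj n d e)) =
      inner ℝ (surfaceGrad S f (Φ.symm y)) (fderiv ℝ Φ.symm y (headProj n d e)) := by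
    rw [surfaceGrad, Submodule.inner_starProjection_left_eq_right,
      Submodule.starProjection_eq_self_iff.2 (h.fderiv_symm_headProj_mem hy e), gradient,
      InnerProductSpace.toDual_symm_apply]
  rw [e1, e2]
  have e3 : ‖fderiv ℝ Φ.symm y‖ ≤ L :=
    norm_fderiv_le_of_lipschitzOn ℝ (Metric.isOpen_ball.mem_nhds (h.cornerPiece_subset_ball hy))
      h.lipschitz_symm
  calc ‖inner ℝ (surfaceGrad S f (Φ.symm y)) (fderiv ℝ Φ.symm y (headProj n d e))‖
      ≤ ‖surfaceGrad S f (Φ.symm y)‖ * ‖fderiv ℝ Φ.symm y (headProj n d e)‖ :=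
        norm_inner_le_norm _ _
    _ ≤ ‖surfaceGrad S f (Φ.symm y)‖ * (L * ‖e‖) := by
        gcongr
        refine (ContinuousLinearMap.le_opNorm _ _).trans ?_
        gcongr
        exact norm_headProj_le n d e
    _ = L * ‖surfaceGrad S f (Φ.symm y)‖ * ‖e‖ := by ring

/-- A Poincaré inequality on the image of a chart, for the surface measure. -/
theorem exists_lintegral_sub_sq_le (h : IsLipschitzChart S n Φ I z₀ ρ L) :
    ∃ C : ℝ≥0∞, C ≠ ∞ ∧ ∀ (f : Eu d → ℝ) (p : Eu d → Eu d), ContDiff ℝ 1 f → Measurable p →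
      p =ᵐ[surfaceMeasure S n] surfaceGrad S f →
      ∫⁻ x in Φ.symm '' cornerPiece n I z₀ ρ, ∫⁻ y in Φ.symm '' cornerPiece n I z₀ ρ,
        ‖f x - f y‖ₑ ^ 2 ∂(μHE[n]) ∂(μHE[n]) ≤ C * ∫⁻ x, ‖p x‖ₑ ^ 2 ∂(surfaceMeasure S n) := by
  set K := cornerPiece n I z₀ ρ with hKdef
  have hKc : IsCompact K := isCompact_cornerPiece
  have hKm : MeasurableSet K := hKc.measurableSet
  set μK := (μHE[n] : Measure (Eu d)).restrict K with hμK
  have hfinK : IsFiniteMeasure μK := ⟨by simpa [hμK] using h.measure_cornerPiece_lt_top⟩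
  set ν := (L : ℝ≥0∞) ^ n • μK.map Φ.symm with hν
  have hLtop : (L : ℝ≥0∞) ^ n ≠ ∞ := ENNReal.pow_ne_top ENNReal.coe_ne_top
  have hνle : (μHE[n] : Measure (Eu d)).restrict (Φ.symm '' K) ≤ ν := h.restrict_image_le
  have hae : AEMeasurable Φ.symm μK := h.aemeasurable_symm
  have hνfin : IsFiniteMeasure ν := by
    refine ⟨?_⟩
    rw [hν, Measure.smul_apply, smul_eq_mul]
    exact ENNReal.mul_lt_top hLtop.lt_top (measure_lt_top _ _)
  -- Here `2 * ρ` bounds the diameter of the piece; the other factor comes from the convex Poincaré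
  -- inequality.
  set c₁ : ℝ≥0∞ := ENNReal.ofReal ((2 * ρ) ^ 2) * (2 ^ n * (μHE[n] : Measure (Eu d)) K) with hc₁
  refine ⟨(L : ℝ≥0∞) ^ n * ((L : ℝ≥0∞) ^ n * (c₁ * (L ^ 2 * (L : ℝ≥0∞) ^ n))), ?_, ?_⟩
  · refine ENNReal.mul_ne_top hLtop (ENNReal.mul_ne_top hLtop (ENNReal.mul_ne_top ?_
      (ENNReal.mul_ne_top (ENNReal.pow_ne_top ENNReal.coe_ne_top) hLtop)))
    exact ENNReal.mul_ne_top ENNReal.ofReal_ne_top (ENNReal.mul_ne_top (by simp)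
      h.measure_cornerPiece_lt_top.ne)
  -- A measurable representative `p` of the surface gradient is used, so that its integral can be
  -- moved along the chart without measurability of `surfaceGrad S f` itself.
  intro f p hf hp hpf
  have hfm : Measurable f := hf.continuous.measurable
  have hFcd : ContDiffOn ℝ 1 (f ∘ Φ.symm) Φ.target := hf.comp_contDiffOn h.contDiffOn_symm
  set π : Eu d →L[ℝ] Eu d := (headProj n d).toContinuousLinearMap with hπ
  set g : Eu d → ℝ≥0∞ := K.indicator fun y => ‖(fderiv ℝ (f ∘ Φ.symm) y).comp π‖ₑ ^ 2 with hg
  have hgm : Measurable g := by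
    classical
    rw [hg, ← piecewise_eq_indicator]
    refine ContinuousOn.measurable_piecewise ?_ continuousOn_const hKm
    have h1 : ContinuousOn (fun y => (fderiv ℝ (f ∘ Φ.symm) y).comp π) K :=
      ((hFcd.continuousOn_fderiv_of_isOpen Φ.open_target le_rfl).mono
        h.cornerPiece_subset_target).clm_comp continuousOn_const
    exact (ENNReal.continuous_pow 2).comp_continuousOn h1.enorm
  have step1 : ∫⁻ z in K, ∫⁻ w in K, ‖(f ∘ Φ.symm) z - (f ∘ Φ.symm) w‖ₑ ^ 2 ∂(μHE[n]) ∂(μHE[n]) ≤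
      c₁ * ∫⁻ z in K, g z ∂(μHE[n]) := by
    refine lintegral_lintegral_sub_sq_le convex_cornerPiece hKm h.measure_cornerPiece_lt_top hgm
      ENNReal.ofReal_ne_top fun z hz w hw => ?_
    refine enorm_sub_sq_le_lintegral_segment Φ.open_target convex_cornerPiece
      h.cornerPiece_subset_target hFcd π hz hw ?_ ?_
    · refine headProj_of_tail_eq_zero fun i hi => ?_
      simp [hz.2.1 i hi, hw.2.1 i hi]
    · rw [← dist_eq_norm]
      have e1 := Metric.mem_closedBall.1 hz.1
      have e2 := Metric.mem_closedBall.1 hw.1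
      linarith [dist_triangle_right z w z₀]
  have step2 : ∫⁻ z in K, g z ∂(μHE[n]) ≤
      L ^ 2 * ((L : ℝ≥0∞) ^ n * ∫⁻ x, ‖p x‖ₑ ^ 2 ∂(surfaceMeasure S n)) := by
    have hmap := h.map_symm_le
    have hac : ∀ᵐ z ∂μK, p (Φ.symm z) = surfaceGrad S f (Φ.symm z) := by
      have hpf' : ∀ᵐ x ∂(μK.map Φ.symm), p x = surfaceGrad S f x :=
        (Measure.absolutelyContinuous_of_le_smul hmap).ae_eq hpf
      exact ae_of_ae_map hae hpf'
    calc ∫⁻ z in K, g z ∂(μHE[n]) ≤ ∫⁻ z in K, L ^ 2 * ‖p (Φ.symm z)‖ₑ ^ 2 ∂(μHE[n]) := by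
          refine lintegral_mono_ae ?_
          filter_upwards [hac, ae_restrict_mem hKm] with z hz hzK
          rw [hg, indicator_of_mem hzK, hz, ← mul_pow]
          gcongr
          have e1 := h.norm_fderiv_comp_headProj_le hf hzK
          rw [← ofReal_norm, ← ofReal_norm, ← ENNReal.ofReal_coe_nnreal,
            ← ENNReal.ofReal_mul (NNReal.coe_nonneg L)]
          exact ENNReal.ofReal_le_ofReal e1
      _ = L ^ 2 * ∫⁻ x, ‖p x‖ₑ ^ 2 ∂(μK.map Φ.symm) := by
          rw [lintegral_const_mul' _ _ (ENNReal.pow_ne_top ENNReal.coe_ne_top),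
            lintegral_map' (by fun_prop) hae]
      _ ≤ L ^ 2 * ((L : ℝ≥0∞) ^ n * ∫⁻ x, ‖p x‖ₑ ^ 2 ∂(surfaceMeasure S n)) := by
          gcongr
          rw [← smul_eq_mul ((L : ℝ≥0∞) ^ n), ← lintegral_smul_measure]
          exact lintegral_mono' hmap le_rfl
  have hG2 : Measurable fun q : Eu d × Eu d => ‖f q.1 - f q.2‖ₑ ^ 2 := by fun_prop
  calc ∫⁻ x in Φ.symm '' K, ∫⁻ y in Φ.symm '' K, ‖f x - f y‖ₑ ^ 2 ∂(μHE[n]) ∂(μHE[n])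
      ≤ ∫⁻ x, ∫⁻ y, ‖f x - f y‖ₑ ^ 2 ∂ν ∂ν :=
        lintegral_mono' hνle fun x => lintegral_mono' hνle le_rfl
    _ = (L : ℝ≥0∞) ^ n * ((L : ℝ≥0∞) ^ n *
          ∫⁻ z, ∫⁻ w, ‖f (Φ.symm z) - f (Φ.symm w)‖ₑ ^ 2 ∂μK ∂μK) := by
        have hin : ∀ x, ∫⁻ y, ‖f x - f y‖ₑ ^ 2 ∂ν =
            (L : ℝ≥0∞) ^ n * ∫⁻ w, ‖f x - f (Φ.symm w)‖ₑ ^ 2 ∂μK := by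
          intro x
          rw [hν, lintegral_smul_measure, smul_eq_mul, lintegral_map' (by fun_prop) hae]
        rw [hν, lintegral_smul_measure, smul_eq_mul, ← hν,
          lintegral_map' (hG2.lintegral_prod_right').aemeasurable hae]
        simp only [hin]
        rw [lintegral_const_mul' _ _ hLtop]
    _ ≤ (L : ℝ≥0∞) ^ n * ((L : ℝ≥0∞) ^ n * (c₁ * (L ^ 2 * ((L : ℝ≥0∞) ^ n *
          ∫⁻ x, ‖p x‖ₑ ^ 2 ∂(surfaceMeasure S n))))) := by
        gcongr
        exact step1.trans (by gcongr)
    _ = _ := by ring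

end IsLipschitzChart

end KernelInverse

/-! ### A priori estimate on `H10` -/

namespace KernelInverse

open Filter Topology TopologicalSpace
open scoped NNReal ENNReal

/-- The variance identity. It turns a bound on the double integral of differences into an `L²` bound
modulo the mean, and it also yields the Cauchy–Schwarz bound `integral_abs_le`. -/
theorem measureReal_mul_integral_sq {α : Type*} [MeasurableSpace α] (μ : Measure α)
    [IsFiniteMeasure μ] {f : α → ℝ} (hf : Integrable f μ) (hf2 : Integrable (fun x => f x ^ 2) μ) :
    2 * (μ.real univ * ∫ x, f x ^ 2 ∂μ) =
      2 * (∫ x, f x ∂μ) ^ 2 + ∫ x, ∫ y, (f x - f y) ^ 2 ∂μ ∂μ := by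
  have h1 : ∀ x, ∫ y, (f x - f y) ^ 2 ∂μ =
      μ.real univ * f x ^ 2 - 2 * (∫ y, f y ∂μ) * f x + ∫ y, f y ^ 2 ∂μ := by
    intro x
    have e : ∀ y, (f x - f y) ^ 2 = f x ^ 2 - 2 * f x * f y + f y ^ 2 := fun y => by ring
    have i1 : Integrable (fun _ : α => f x ^ 2) μ := integrable_const _
    have i2 : Integrable (fun y => 2 * f x * f y) μ := hf.const_mul _
    have i3 : Integrable (fun y => f x ^ 2 - 2 * f x * f y) μ := i1.sub i2
    simp only [e]
    rw [integral_add i3 hf2, integral_sub i1 i2, integral_const, integral_const_mul, smul_eq_mul]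
    ring
  have i1 : Integrable (fun x => μ.real univ * f x ^ 2) μ := hf2.const_mul _
  have i2 : Integrable (fun x => 2 * (∫ y, f y ∂μ) * f x) μ := hf.const_mul _
  have i3 : Integrable (fun x => μ.real univ * f x ^ 2 - 2 * (∫ y, f y ∂μ) * f x) μ := i1.sub i2
  simp only [h1]
  rw [integral_add i3 (integrable_const _), integral_sub i1 i2, integral_const_mul,
    integral_const_mul, integral_const, smul_eq_mul]
  ring

theorem integrable_restrict_of_continuousOn {α E : Type*} [TopologicalSpace α] [T2Space α]
    [PseudoMetrizableSpace α] [MeasurableSpace α] [BorelSpace α] [NormedAddCommGroup E]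
    {μ : Measure α} {K : Set α} (hK : IsCompact K) (hμ : IsFiniteMeasure (μ.restrict K))
    {f : α → E} (hf : ContinuousOn f K) : Integrable f (μ.restrict K) := by
  obtain ⟨C, hC⟩ := hK.exists_bound_of_continuousOn hf
  exact Integrable.of_bound (hf.aestronglyMeasurable_of_isCompact hK hK.measurableSet) C
    ((ae_restrict_mem hK.measurableSet).mono hC)

theorem surfaceGrad_add {d : ℕ} (S : Set (Eu d)) {f g : Eu d → ℝ} (hf : ContDiff ℝ 1 f)
    (hg : ContDiff ℝ 1 g) : surfaceGrad S (f + g) = surfaceGrad S f + surfaceGrad S g := by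
  funext x
  simp only [surfaceGrad, gradient, Pi.add_apply]
  rw [fderiv_add (hf.differentiable one_ne_zero x) (hg.differentiable one_ne_zero x), map_add,
    map_add]

theorem surfaceGrad_smul {d : ℕ} (S : Set (Eu d)) (c : ℝ) {f : Eu d → ℝ} (hf : ContDiff ℝ 1 f) :
    surfaceGrad S (c • f) = c • surfaceGrad S f := by
  funext x
  simp only [surfaceGrad, gradient, Pi.smul_apply]
  rw [fderiv_const_smul (hf.differentiable one_ne_zero x), map_smul, map_smul]

/-- The pairs `(f, ∇f)` in `L² × L²` where `f` is `C¹`. -/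
def smoothPairs {d : ℕ} (S : Set (Eu d)) (n : ℕ) :
    Submodule ℝ (Lp ℝ 2 (surfaceMeasure S n) × Lp (Eu d) 2 (surfaceMeasure S n)) where
  carrier := {P | ∃ f : Eu d → ℝ, ContDiff ℝ 1 f ∧ P.1 =ᵐ[surfaceMeasure S n] f ∧
    P.2 =ᵐ[surfaceMeasure S n] surfaceGrad S f}
  add_mem' := by
    rintro P Q ⟨f, hf, hP1, hP2⟩ ⟨g, hg, hQ1, hQ2⟩
    refine ⟨f + g, hf.add hg, (Lp.coeFn_add _ _).trans (hP1.add hQ1), ?_⟩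
    rw [surfaceGrad_add S hf hg]
    exact (Lp.coeFn_add _ _).trans (hP2.add hQ2)
  zero_mem' := by
    refine ⟨0, contDiff_const, Lp.coeFn_zero _ _ _, ?_⟩
    have : surfaceGrad S (0 : Eu d → ℝ) = 0 := by
      simpa using surfaceGrad_smul S 0 (f := 0) contDiff_const
    rw [this]
    exact Lp.coeFn_zero _ _ _
  smul_mem' := by
    rintro c P ⟨f, hf, hP1, hP2⟩
    refine ⟨c • f, contDiff_const.smul hf, (Lp.coeFn_smul _ _).trans (hP1.const_smul c), ?_⟩
    rw [surfaceGrad_smul S c hf]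
    exact (Lp.coeFn_smul _ _).trans (hP2.const_smul c)

section Estimate

variable {d n : ℕ} {S : Set (Eu d)}

theorem norm_sq_eq_integral_norm_sq {α E : Type*} [MeasurableSpace α] [NormedAddCommGroup E]
    [InnerProductSpace ℝ E] {μ : Measure α} (f : Lp E 2 μ) :
    ‖f‖ ^ 2 = ∫ x, ‖f x‖ ^ 2 ∂μ := by
  rw [← real_inner_self_eq_norm_sq, L2.inner_def]
  simp only [real_inner_self_eq_norm_sq]

theorem integrable_norm_sq {α E : Type*} [MeasurableSpace α] [NormedAddCommGroup E]
    {μ : Measure α} (f : Lp E 2 μ) : Integrable (fun x => ‖f x‖ ^ 2) μ :=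
  (Lp.memLp f).integrable_norm_pow (by norm_num)

/-- Near each point of a compact manifold, the `L²` norm of a `C¹` function is controlled by one
functional and the norm of its gradient. -/
theorem IsCompactManifold.exists_local_estimate (hS : IsCompactManifold S n) {x : Eu d}
    (hx : x ∈ S) : ∃ W ∈ 𝓝[S] x, MeasurableSet W ∧ ∃ c : ℝ, 0 ≤ c ∧
      ∀ P ∈ smoothPairs S n, ∫ y in W, P.1 y ^ 2 ∂(surfaceMeasure S n) ≤
        c * ((∫ y in W, P.1 y ∂(surfaceMeasure S n)) ^ 2 + ‖P.2‖ ^ 2) := by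
  obtain ⟨Φ, I, ρ, L, hxΦ, h⟩ := hS.exists_isLipschitzChart hx
  set W := Φ.symm '' cornerPiece n I (Φ x) ρ with hW
  have hWm : MeasurableSet W := h.isCompact_image.measurableSet
  have hWS : W ⊆ S := h.image_subset
  obtain ⟨C, hC, hCf⟩ := h.exists_lintegral_sub_sq_le
  set μ := (μHE[n] : Measure (Eu d)).restrict W with hμ
  have hfin : IsFiniteMeasure μ := ⟨by simpa [hμ] using h.measure_image_lt_top⟩
  have hμS : (surfaceMeasure S n).restrict W = μ := by
    rw [surfaceMeasure, Measure.restrict_restrict hWm, inter_eq_left.2 hWS]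
  -- The constant results from dividing the variance identity by the measure of `W`. If that measure
  -- is zero, the quotient is zero by convention and both sides vanish.
  refine ⟨W, h.image_mem_nhdsWithin hxΦ, hWm, (1 + C.toReal) / μ.real univ, by positivity, ?_⟩
  rintro P ⟨f, hf, hPf, hPg⟩
  rw [hμS]
  have hPf' : P.1 =ᵐ[μ] f := by
    rw [← hμS]; exact ae_restrict_of_ae hPf
  have e1 : ∫ y, P.1 y ^ 2 ∂μ = ∫ y, f y ^ 2 ∂μ :=
    integral_congr_ae (hPf'.mono fun y hy => by simp only [hy])
  have e2 : ∫ y, P.1 y ∂μ = ∫ y, f y ∂μ := integral_congr_ae hPf'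
  rw [e1, e2]
  have hfi : Integrable f μ := 
    integrable_restrict_of_continuousOn h.isCompact_image hfin hf.continuous.continuousOn
  have hfi2 : Integrable (fun y => f y ^ 2) μ :=
    integrable_restrict_of_continuousOn h.isCompact_image hfin (hf.continuous.pow 2).continuousOn
  have hCf := hCf f P.2 hf (Lp.stronglyMeasurable P.2).measurable hPg
  have hgr : ∫⁻ y, ‖P.2 y‖ₑ ^ 2 ∂(surfaceMeasure S n) = ENNReal.ofReal (‖P.2‖ ^ 2) := by
    rw [norm_sq_eq_integral_norm_sq, ofReal_integral_eq_lintegral_ofReal (integrable_norm_sq P.2)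
      (ae_of_all _ fun _ => sq_nonneg _)]
    exact lintegral_congr fun y => by rw [ENNReal.ofReal_pow (norm_nonneg _), ofReal_norm]
  have hdouble : ∫ y, ∫ z, (f y - f z) ^ 2 ∂μ ∂μ ≤ C.toReal * ‖P.2‖ ^ 2 := by
    have hsq : ∀ y z, ‖f y - f z‖ₑ ^ 2 = ENNReal.ofReal ((f y - f z) ^ 2) := fun y z => by
      rw [Real.enorm_eq_ofReal_abs, ← ENNReal.ofReal_pow (abs_nonneg _), sq_abs]
    rw [integral_eq_lintegral_of_nonneg_ae
      (ae_of_all _ fun y => integral_nonneg fun z => sq_nonneg _)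
      (by
        have : StronglyMeasurable fun q : Eu d × Eu d => (f q.1 - f q.2) ^ 2 :=
          ((hf.continuous.comp continuous_fst).sub (hf.continuous.comp continuous_snd)).pow 2
            |>.stronglyMeasurable
        exact this.integral_prod_right.aestronglyMeasurable)]
    have hin : ∀ y, ENNReal.ofReal (∫ z, (f y - f z) ^ 2 ∂μ) = ∫⁻ z, ‖f y - f z‖ₑ ^ 2 ∂μ := by
      intro y
      have hint : Integrable (fun z => (f y - f z) ^ 2) μ :=
        integrable_restrict_of_continuousOn h.isCompact_image hfin
          ((continuous_const.sub hf.continuous).pow 2).continuousOn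
      rw [ofReal_integral_eq_lintegral_ofReal hint (ae_of_all _ fun _ => sq_nonneg _)]
      exact lintegral_congr fun z => (hsq y z).symm
    simp only [hin]
    rw [hgr] at hCf
    refine (ENNReal.toReal_mono (ENNReal.mul_ne_top hC ENNReal.ofReal_ne_top) hCf).trans ?_
    rw [ENNReal.toReal_mul, ENNReal.toReal_ofReal (sq_nonneg _)]
  have hid := measureReal_mul_integral_sq μ hfi hfi2
  rcases (measureReal_nonneg (μ := μ) (s := univ)).eq_or_lt with h0 | h0
  · have : μ = 0 := by
      rw [← Measure.measure_univ_eq_zero]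
      exact (measureReal_eq_zero_iff (measure_ne_top _ _)).1 h0.symm
    rw [this]; simp
  · rw [div_mul_eq_mul_div, le_div_iff₀ h0]
    nlinarith [ENNReal.toReal_nonneg (a := C), sq_nonneg (∫ y, f y ∂μ), sq_nonneg ‖P.2‖,
      mul_nonneg (ENNReal.toReal_nonneg (a := C)) (sq_nonneg (∫ y, f y ∂μ)),
      mul_nonneg (ENNReal.toReal_nonneg (a := C)) (sq_nonneg ‖P.2‖)]

theorem IsCompactManifold.exists_smoothPairs_estimate (hS : IsCompactManifold S n) :
    ∃ (t : Finset (Eu d)) (ℓ : Lp ℝ 2 (surfaceMeasure S n) →L[ℝ] (t → ℝ)) (c : ℝ), 0 ≤ c ∧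
      ∀ P ∈ smoothPairs S n, ‖P.1‖ ^ 2 ≤ c * (‖ℓ P.1‖ ^ 2 + ‖P.2‖ ^ 2) := by
  have hfin := hS.isFiniteMeasure_surfaceMeasure
  choose! W hWn hWm c hc hest using fun x (hx : x ∈ S) => hS.exists_local_estimate hx
  obtain ⟨t, htS, hcov⟩ := hS.isCompact.elim_nhdsWithin_subcover W hWn
  -- The functionals are the integrals over the finitely many patches of a cover of `S`.
  let ℓ : Lp ℝ 2 (surfaceMeasure S n) →L[ℝ] (t → ℝ) := ContinuousLinearMap.pi fun x =>
    innerSL ℝ (indicatorConstLp 2 (hWm x (htS x x.2)) (measure_ne_top _ _) (1 : ℝ))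
  have hℓ : ∀ u (x : t), ℓ u x = ∫ y in W x, u y ∂(surfaceMeasure S n) := fun u x =>
    L2.inner_indicatorConstLp_one (𝕜 := ℝ) (hWm x (htS x x.2)) (measure_ne_top _ _) u
  refine ⟨t, ℓ, ∑ x ∈ t, c x, Finset.sum_nonneg fun x hx => hc x (htS x hx), fun P hP => ?_⟩
  have hint : Integrable (fun y => P.1 y ^ 2) (surfaceMeasure S n) := by
    simpa using integrable_norm_sq P.1
  have hae : ∀ᵐ y ∂(surfaceMeasure S n),
      P.1 y ^ 2 ≤ ∑ x ∈ t, (W x).indicator (fun y => P.1 y ^ 2) y := by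
    filter_upwards [ae_restrict_mem hS.isCompact.measurableSet] with y hy
    obtain ⟨x, hx, hyx⟩ := mem_iUnion₂.1 (hcov hy)
    refine le_trans ?_ (Finset.single_le_sum
      (f := fun x => (W x).indicator (fun y => P.1 y ^ 2) y) (fun x _ => ?_) hx)
    · simp only [indicator_of_mem hyx, le_refl]
    · exact indicator_nonneg (fun _ _ => sq_nonneg _) _
  have e1 : ‖P.1‖ ^ 2 = ∫ y, P.1 y ^ 2 ∂(surfaceMeasure S n) := by
    simp [norm_sq_eq_integral_norm_sq]
  calc ‖P.1‖ ^ 2 ≤ ∫ y, ∑ x ∈ t, (W x).indicator (fun y => P.1 y ^ 2) y ∂(surfaceMeasure S n) := by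
        rw [e1]
        exact integral_mono_ae hint
          (integrable_finsetSum _ fun x hx => hint.indicator (hWm x (htS x hx))) hae
    _ = ∑ x ∈ t, ∫ y in W x, P.1 y ^ 2 ∂(surfaceMeasure S n) := by
        rw [integral_finsetSum _ fun x hx => hint.indicator (hWm x (htS x hx))]
        exact Finset.sum_congr rfl fun x hx => integral_indicator (hWm x (htS x hx))
    _ ≤ ∑ x ∈ t, c x * (‖ℓ P.1‖ ^ 2 + ‖P.2‖ ^ 2) := by
        refine Finset.sum_le_sum fun x hx => (hest x (htS x hx) P hP).trans ?_
        have := hc x (htS x hx)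
        gcongr _ * (?_ + _)
        rw [← hℓ P.1 ⟨x, hx⟩, ← sq_abs, ← Real.norm_eq_abs]
        gcongr
        exact norm_le_pi_norm _ _
    _ = _ := by rw [Finset.sum_mul]

/-- On `H¹₀`, the norm is controlled by the norm of the gradient and finitely many functionals. -/
theorem IsCompactManifold.exists_H10_estimate (hS : IsCompactManifold S n) :
    ∃ (t : Finset (Eu d)) (ℓ : Lp ℝ 2 (surfaceMeasure S n) →L[ℝ] (t → ℝ)) (c : ℝ),
      ∀ u : H10 S n, ‖u‖ ≤ c * (‖u.1.2‖ + ‖ℓ u.1.1‖) := by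
  obtain ⟨t, ℓ, c, hc, h⟩ := hS.exists_smoothPairs_estimate
  refine ⟨t, ℓ, 1 + √c, fun u => ?_⟩
  -- The estimate is a closed condition on pairs, so it passes from test pairs to the closure.
  have hcl : IsClosed {P : Lp ℝ 2 (surfaceMeasure S n) × Lp (Eu d) 2 (surfaceMeasure S n) |
      ‖P.1‖ ^ 2 ≤ c * (‖ℓ P.1‖ ^ 2 + ‖P.2‖ ^ 2)} := isClosed_le (by fun_prop) (by fun_prop)
  have hsub : Submodule.span ℝ (testPairs S n) ≤ smoothPairs S n := by
    refine Submodule.span_le.2 ?_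
    rintro P ⟨f, hf, -, h1, h2⟩
    exact ⟨f, hf, h1, h2⟩
  have h1 : ‖u.1.1‖ ^ 2 ≤ c * (‖ℓ u.1.1‖ ^ 2 + ‖u.1.2‖ ^ 2) :=
    closure_minimal (fun P hP => h P (hsub hP)) hcl u.2
  have h2 : ‖u.1.1‖ ≤ √c * (‖u.1.2‖ + ‖ℓ u.1.1‖) := by
    refine (sq_le_sq₀ (norm_nonneg _) (by positivity)).1 (h1.trans ?_)
    rw [mul_pow, Real.sq_sqrt hc]
    gcongr
    nlinarith [norm_nonneg u.1.2, norm_nonneg (ℓ u.1.1),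
      mul_nonneg (norm_nonneg u.1.2) (norm_nonneg (ℓ u.1.1))]
  have h3 : ‖u‖ ≤ ‖u.1.1‖ + ‖u.1.2‖ :=
    max_le (le_add_of_nonneg_right (norm_nonneg _)) (le_add_of_nonneg_left (norm_nonneg _))
  have := norm_nonneg (ℓ u.1.1)
  linarith

end Estimate

end KernelInverse

/-! ### Integral operators with continuous kernels -/

namespace KernelInverse

open Filter Topology TopologicalSpace
open scoped NNReal ENNReal

section KernelOperators

variable {d : ℕ} {R V : Set (Eu d)} {σ τ : Measure (Eu d)}

/-- `T` is the integral operator with kernel `k`. -/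
def IsKernelOp (σ τ : Measure (Eu d)) (k : Eu d → Eu d → ℝ) (T : Lp ℝ 2 σ →L[ℝ] Lp ℝ 2 τ) : Prop :=
  ∀ u, T u =ᵐ[τ] fun x => ∫ y, k x y * u y ∂σ

theorem continuousOn_slice {k : Eu d → Eu d → ℝ}
    (hk : ContinuousOn (fun z : Eu d × Eu d => k z.1 z.2) (V ×ˢ R)) {x : Eu d} (hx : x ∈ V) :
    ContinuousOn (k x) R := by
  have h : ContinuousOn (fun y : Eu d => (x, y)) R := by fun_prop
  exact hk.comp h fun y hy => ⟨hx, hy⟩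

theorem integral_abs_le [IsFiniteMeasure σ] (u : Lp ℝ 2 σ) :
    ∫ y, |u y| ∂σ ≤ √(σ.real univ) * ‖u‖ := by
  have hu : Integrable (fun y => |u y|) σ := ((Lp.memLp u).integrable one_le_two).abs
  have hu2 : Integrable (fun y => |u y| ^ 2) σ := integrable_norm_sq u
  have h := measureReal_mul_integral_sq σ hu hu2
  have h0 : 0 ≤ ∫ x, ∫ y, (|u x| - |u y|) ^ 2 ∂σ ∂σ :=
    integral_nonneg fun _ => integral_nonneg fun _ => sq_nonneg _
  have h1 : ‖u‖ ^ 2 = ∫ y, |u y| ^ 2 ∂σ := norm_sq_eq_integral_norm_sq u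
  refine (sq_le_sq₀ (integral_nonneg fun _ => abs_nonneg _) (by positivity)).1 ?_
  rw [mul_pow, Real.sq_sqrt measureReal_nonneg, h1]
  linarith

theorem integrable_kernel_mul [IsFiniteMeasure σ] (hσ : ∀ᵐ y ∂σ, y ∈ R) (hR : IsCompact R)
    {a : Eu d → ℝ} (ha : ContinuousOn a R) (u : Lp ℝ 2 σ) : Integrable (fun y => a y * u y) σ := by
  obtain ⟨C, hC⟩ := hR.exists_bound_of_continuousOn ha
  have hu : Integrable u σ := (Lp.memLp u).integrable one_le_two
  have hm : AEStronglyMeasurable a σ := by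
    have := ha.aestronglyMeasurable_of_isCompact hR hR.measurableSet (μ := σ)
    rwa [Measure.restrict_eq_self_of_ae_mem hσ] at this
  exact hu.bdd_mul hm (hσ.mono fun y hy => hC y hy)

theorem abs_integral_kernel_mul_le [IsFiniteMeasure σ] (hσ : ∀ᵐ y ∂σ, y ∈ R) {a : Eu d → ℝ}
    {C : ℝ} (hC : 0 ≤ C) (ha : ∀ y ∈ R, |a y| ≤ C) (u : Lp ℝ 2 σ) :
    |∫ y, a y * u y ∂σ| ≤ C * (√(σ.real univ) * ‖u‖) := by
  have hu : Integrable (fun y => |u y|) σ := ((Lp.memLp u).integrable one_le_two).abs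
  calc |∫ y, a y * u y ∂σ| ≤ ∫ y, C * |u y| ∂σ := by
        rw [← Real.norm_eq_abs]
        refine norm_integral_le_of_norm_le (hu.const_mul C) (hσ.mono fun y hy => ?_)
        rw [Real.norm_eq_abs, abs_mul]
        exact mul_le_mul_of_nonneg_right (ha y hy) (abs_nonneg _)
    _ ≤ _ := by
        rw [integral_const_mul]
        exact mul_le_mul_of_nonneg_left (integral_abs_le u) hC

/-- The factor between the sup norm of a kernel and the norm of its integral operator. -/
noncomputable def kernelConst (σ τ : Measure (Eu d)) : ℝ :=
  (measureUnivNNReal τ : ℝ) ^ (2 : ℝ≥0∞).toReal⁻¹ * √(σ.real univ)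

theorem kernelConst_nonneg (σ τ : Measure (Eu d)) : 0 ≤ kernelConst σ τ := by
  unfold kernelConst; positivity

theorem norm_le_of_ae_abs_le [IsFiniteMeasure τ] {f : Lp ℝ 2 τ} {C N : ℝ} (hC : 0 ≤ C) (hN : 0 ≤ N)
    (h : ∀ᵐ x ∂τ, |f x| ≤ C * (√(σ.real univ) * N)) : ‖f‖ ≤ C * kernelConst σ τ * N := by
  refine (Lp.norm_le_of_ae_bound (by positivity) h).trans (le_of_eq ?_)
  rw [kernelConst]; ring

theorem IsKernelOp.norm_le [IsFiniteMeasure σ] [IsFiniteMeasure τ] (hσ : ∀ᵐ y ∂σ, y ∈ R)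
    (hτ : ∀ᵐ x ∂τ, x ∈ V) {k : Eu d → Eu d → ℝ} {T : Lp ℝ 2 σ →L[ℝ] Lp ℝ 2 τ}
    (hT : IsKernelOp σ τ k T) {C : ℝ} (hC : 0 ≤ C) (hk : ∀ x ∈ V, ∀ y ∈ R, |k x y| ≤ C) :
    ‖T‖ ≤ C * kernelConst σ τ := by
  have := kernelConst_nonneg σ τ
  refine T.opNorm_le_bound (by positivity) fun u => ?_
  refine norm_le_of_ae_abs_le hC (norm_nonneg u) ?_
  filter_upwards [hT u, hτ] with x hx hxV
  rw [hx]
  exact abs_integral_kernel_mul_le hσ hC (hk x hxV) u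

theorem IsKernelOp.congr (hσ : ∀ᵐ y ∂σ, y ∈ R) (hτ : ∀ᵐ x ∂τ, x ∈ V) {k k' : Eu d → Eu d → ℝ}
    {T : Lp ℝ 2 σ →L[ℝ] Lp ℝ 2 τ} (hT : IsKernelOp σ τ k T)
    (hk : ∀ x ∈ V, ∀ y ∈ R, k x y = k' x y) : IsKernelOp σ τ k' T := by
  intro u
  filter_upwards [hT u, hτ] with x hx hxV
  rw [hx]
  exact integral_congr_ae (hσ.mono fun y hy => by simp only [hk x hxV y hy])

theorem IsKernelOp.sub [IsFiniteMeasure σ] (hσ : ∀ᵐ y ∂σ, y ∈ R) (hR : IsCompact R)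
    (hτ : ∀ᵐ x ∂τ, x ∈ V) {k k' : Eu d → Eu d → ℝ} {T T' : Lp ℝ 2 σ →L[ℝ] Lp ℝ 2 τ}
    (hT : IsKernelOp σ τ k T) (hT' : IsKernelOp σ τ k' T')
    (hk : ∀ x ∈ V, ContinuousOn (k x) R) (hk' : ∀ x ∈ V, ContinuousOn (k' x) R) :
    IsKernelOp σ τ (fun x y => k x y - k' x y) (T - T') := by
  intro u
  filter_upwards [hT u, hT' u, hτ, Lp.coeFn_sub (T u) (T' u)] with x hx hx' hxV hs
  have e : (T - T') u = T u - T' u := rfl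
  rw [e, hs, Pi.sub_apply, hx, hx', ← integral_sub (integrable_kernel_mul hσ hR (hk x hxV) u)
    (integrable_kernel_mul hσ hR (hk' x hxV) u)]
  simp only [sub_mul]

theorem IsKernelOp.sum [IsFiniteMeasure σ] (hσ : ∀ᵐ y ∂σ, y ∈ R) (hR : IsCompact R)
    (hτ : ∀ᵐ x ∂τ, x ∈ V) {ι : Type*} (s : Finset ι) (c : ι → ℝ) {k : ι → Eu d → Eu d → ℝ}
    {T : ι → Lp ℝ 2 σ →L[ℝ] Lp ℝ 2 τ} (hT : ∀ i, IsKernelOp σ τ (k i) (T i))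
    (hk : ∀ i, ∀ x ∈ V, ContinuousOn (k i x) R) :
    IsKernelOp σ τ (fun x y => ∑ i ∈ s, c i * k i x y) (∑ i ∈ s, c i • T i) := by
  intro u
  induction s using Finset.cons_induction with
  | empty =>
    simp only [Finset.sum_empty, zero_mul, integral_zero]
    exact Lp.coeFn_zero _ _ _
  | cons i s hi ih =>
    have e : (∑ j ∈ Finset.cons i s hi, c j • T j) u = c i • T i u + (∑ j ∈ s, c j • T j) u := by
      rw [Finset.sum_cons]; rfl
    rw [e]
    filter_upwards [ih, hT i u, hτ, Lp.coeFn_add (c i • T i u) ((∑ j ∈ s, c j • T j) u),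
      Lp.coeFn_smul (c i) (T i u)] with x h1 h2 hxV h3 h4
    have i1 : Integrable (fun y => c i * (k i x y * u y)) σ :=
      (integrable_kernel_mul hσ hR (hk i x hxV) u).const_mul _
    have i2 : Integrable (fun y => (∑ j ∈ s, c j * k j x y) * u y) σ :=
      integrable_kernel_mul hσ hR
        (continuousOn_finsetSum _ fun j _ => continuousOn_const.mul (hk j x hxV)) u
    rw [h3, Pi.add_apply, h4, Pi.smul_apply, h1, h2, smul_eq_mul, ← integral_const_mul,
      ← integral_add i1 i2]
    refine integral_congr_ae (ae_of_all _ fun y => ?_)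
    simp only [Finset.sum_cons]
    ring

theorem exists_isKernelOp [IsFiniteMeasure σ] [IsFiniteMeasure τ] (hσ : ∀ᵐ y ∂σ, y ∈ R)
    (hR : IsCompact R) (hτ : ∀ᵐ x ∂τ, x ∈ V) (hV : IsCompact V) {k : Eu d → Eu d → ℝ}
    (hk : ContinuousOn (fun z : Eu d × Eu d => k z.1 z.2) (V ×ˢ R)) :
    ∃ T, IsKernelOp σ τ k T := by
  obtain ⟨C₀, hC₀⟩ := (hV.prod hR).exists_bound_of_continuousOn hk
  set C := |C₀| with hCd
  have hC : ∀ x ∈ V, ∀ y ∈ R, |k x y| ≤ C := fun x hx y hy =>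
    (hC₀ (x, y) ⟨hx, hy⟩).trans (le_abs_self _)
  have hC0 : 0 ≤ C := abs_nonneg _
  -- The kernel is continuous on `V ×ˢ R` only; its extension by zero is jointly measurable on the
  -- whole space.
  set k' : Eu d × Eu d → ℝ := (V ×ˢ R).indicator fun z => k z.1 z.2 with hk'
  have hk'm : StronglyMeasurable k' := by
    classical
    rw [hk', ← piecewise_eq_indicator]
    exact (hk.measurable_piecewise continuousOn_const
      (hV.measurableSet.prod hR.measurableSet)).stronglyMeasurable
  have hkk' : ∀ x ∈ V, ∀ y ∈ R, k' (x, y) = k x y := fun x hx y hy =>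
    indicator_of_mem (show (x, y) ∈ V ×ˢ R from ⟨hx, hy⟩) _
  have hmem : ∀ u : Lp ℝ 2 σ, MemLp (fun x => ∫ y, k' (x, y) * u y ∂σ) 2 τ := by
    intro u
    refine MemLp.of_bound ?_ (C * (√(σ.real univ) * ‖u‖)) ?_
    · have : StronglyMeasurable fun z : Eu d × Eu d => k' z * u z.2 :=
        hk'm.mul ((Lp.stronglyMeasurable u).comp_measurable measurable_snd)
      exact this.integral_prod_right.aestronglyMeasurable
    · filter_upwards [hτ] with x hx
      exact abs_integral_kernel_mul_le hσ hC0 (fun y hy => by rw [hkk' x hx y hy]; exact hC x hx y hy) u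
  have hint : ∀ x ∈ V, ∀ u : Lp ℝ 2 σ, Integrable (fun y => k' (x, y) * u y) σ := by
    intro x hx u
    have h1 : ContinuousOn (k x) R := continuousOn_slice hk hx
    exact (integrable_kernel_mul hσ hR h1 u).congr
      (hσ.mono fun y hy => by simp only [hkk' x hx y hy])
  let T₀ : Lp ℝ 2 σ →ₗ[ℝ] Lp ℝ 2 τ :=
    { toFun := fun u => (hmem u).toLp _
      map_add' := by
        intro u v
        rw [← MemLp.toLp_add]
        refine MemLp.toLp_congr _ _ ?_
        filter_upwards [hτ] with x hx
        rw [Pi.add_apply, ← integral_add (hint x hx u) (hint x hx v)]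
        refine integral_congr_ae ?_
        filter_upwards [Lp.coeFn_add u v] with y hy
        rw [hy, Pi.add_apply, mul_add]
      map_smul' := by
        intro c u
        rw [RingHom.id_apply, ← MemLp.toLp_const_smul]
        refine MemLp.toLp_congr _ _ ?_
        filter_upwards [hτ] with x hx
        rw [Pi.smul_apply, smul_eq_mul, ← integral_const_mul]
        refine integral_congr_ae ?_
        filter_upwards [Lp.coeFn_smul c u] with y hy
        rw [hy, Pi.smul_apply, smul_eq_mul]
        ring }
  have hT₀ : ∀ u, T₀ u =ᵐ[τ] fun x => ∫ y, k' (x, y) * u y ∂σ := fun u => (hmem u).coeFn_toLp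
  let T : Lp ℝ 2 σ →L[ℝ] Lp ℝ 2 τ := T₀.mkContinuous (C * kernelConst σ τ) fun u => by
    refine norm_le_of_ae_abs_le hC0 (norm_nonneg u) ?_
    filter_upwards [hT₀ u, hτ] with x h1 hx
    rw [h1]
    exact abs_integral_kernel_mul_le hσ hC0 (fun y hy => by rw [hkk' x hx y hy]; exact hC x hx y hy) u
  have hTk : IsKernelOp σ τ (fun x y => k' (x, y)) T := hT₀
  exact ⟨T, hTk.congr hσ hτ hkk'⟩

theorem isCompactOperator_smulRight {X Y : Type*} [NormedAddCommGroup X] [NormedSpace ℝ X]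
    [NormedAddCommGroup Y] [NormedSpace ℝ Y] (ℓ : X →L[ℝ] ℝ) (y : Y) :
    IsCompactOperator (ℓ.smulRight y) := by
  have h1 : IsCompactOperator ℓ := isCompactOperator_of_locallyCompactSpace_dom ℓ
  exact h1.clm_comp (ContinuousLinearMap.toSpanSingleton ℝ y)

/-- An integral operator whose kernel depends on `x` only through a measurable function with
finitely many values has finite rank. -/
theorem exists_isKernelOp_simpleFunc [IsFiniteMeasure σ] [IsFiniteMeasure τ]
    (hσ : ∀ᵐ y ∂σ, y ∈ R) (hR : IsCompact R) {k : Eu d → Eu d → ℝ} (c : SimpleFunc (Eu d) (Eu d))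
    (hk : ∀ x, ContinuousOn (k (c x)) R) :
    ∃ T, IsKernelOp σ τ (fun x y => k (c x) y) T ∧ IsCompactOperator T := by
  have hm : ∀ p ∈ c.range, MemLp (k p) 2 σ := by
    intro p hp
    obtain ⟨x, rfl⟩ := SimpleFunc.mem_range.1 hp
    obtain ⟨C, hC⟩ := hR.exists_bound_of_continuousOn (hk x)
    have hmeas : AEStronglyMeasurable (k (c x)) σ := by
      have := (hk x).aestronglyMeasurable_of_isCompact hR hR.measurableSet (μ := σ)
      rwa [Measure.restrict_eq_self_of_ae_mem hσ] at this
    exact MemLp.of_bound hmeas C (hσ.mono fun y hy => hC y hy)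
  let T : Lp ℝ 2 σ →L[ℝ] Lp ℝ 2 τ := ∑ p ∈ c.range.attach,
    (innerSL ℝ ((hm p p.2).toLp _)).smulRight
      (indicatorConstLp 2 (c.measurableSet_preimage {(p : Eu d)}) (measure_ne_top τ _) (1 : ℝ))
  have hT : ∀ u, T u = ∑ p ∈ c.range.attach, (∫ y, k p y * u y ∂σ) •
      indicatorConstLp 2 (c.measurableSet_preimage {(p : Eu d)}) (measure_ne_top τ _) (1 : ℝ) := by
    intro u
    simp only [T, _root_.sum_apply, ContinuousLinearMap.smulRight_apply]
    refine Finset.sum_congr rfl fun p _ => ?_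
    congr 1
    rw [innerSL_apply_apply, L2.inner_def]
    refine integral_congr_ae ?_
    filter_upwards [(hm p p.2).coeFn_toLp] with y hy
    rw [hy]
    simp [mul_comm]
  refine ⟨T, fun u => ?_, ?_⟩
  · rw [hT u]
    have h1 : ∀ᵐ x ∂τ, ∀ p : c.range,
        indicatorConstLp 2 (c.measurableSet_preimage {(p : Eu d)}) (measure_ne_top τ _) (1 : ℝ) x =
          (c ⁻¹' {(p : Eu d)}).indicator (fun _ => (1 : ℝ)) x :=
      ae_all_iff.2 fun p => indicatorConstLp_coeFn
    have h2 : ∀ᵐ x ∂τ, ∀ p : c.range, ((∫ y, k p y * u y ∂σ) •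
        indicatorConstLp 2 (c.measurableSet_preimage {(p : Eu d)}) (measure_ne_top τ _) (1 : ℝ) :
          Lp ℝ 2 τ) x = (∫ y, k p y * u y ∂σ) • (indicatorConstLp 2
            (c.measurableSet_preimage {(p : Eu d)}) (measure_ne_top τ _) (1 : ℝ) : Lp ℝ 2 τ) x :=
      ae_all_iff.2 fun p => Lp.coeFn_smul _ _
    filter_upwards [h1, h2, Lp.coeFn_finsetSum c.range.attach fun p : c.range =>
      (∫ y, k p y * u y ∂σ) • indicatorConstLp 2 (c.measurableSet_preimage {(p : Eu d)})
        (measure_ne_top τ _) (1 : ℝ)] with x h1 h2 h3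
    rw [h3, Finset.sum_apply, Finset.sum_eq_single ⟨c x, c.mem_range_self x⟩]
    · rw [h2, h1]
      simp
    · intro p _ hp
      rw [h2, h1, indicator_of_notMem, smul_zero]
      intro hx
      exact hp (Subtype.ext hx.symm)
    · intro h
      exact absurd (Finset.mem_attach _ _) h
  · refine Finset.sum_induction _ (fun T : Lp ℝ 2 σ →L[ℝ] Lp ℝ 2 τ => IsCompactOperator T)
      (fun a b ha hb => ha.add hb) isCompactOperator_zero fun p _ => isCompactOperator_smulRight _ _

/-- Integral operators with continuous kernels on compact sets are compact. -/
theorem IsKernelOp.isCompactOperator [IsFiniteMeasure σ] [IsFiniteMeasure τ]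
    (hσ : ∀ᵐ y ∂σ, y ∈ R) (hR : IsCompact R) (hτ : ∀ᵐ x ∂τ, x ∈ V) (hV : IsCompact V)
    {k : Eu d → Eu d → ℝ} (hk : ContinuousOn (fun z : Eu d × Eu d => k z.1 z.2) (V ×ˢ R))
    {T : Lp ℝ 2 σ →L[ℝ] Lp ℝ 2 τ} (hT : IsKernelOp σ τ k T) : IsCompactOperator T := by
  rcases V.eq_empty_or_nonempty with rfl | hne
  · have hT0 : T = 0 := by
      have := hT.norm_le hσ hτ (le_refl (0 : ℝ)) (by simp)
      rw [zero_mul] at this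
      exact norm_le_zero_iff.1 this
    rw [hT0]
    exact isCompactOperator_zero
  have hkx : ∀ x ∈ V, ContinuousOn (k x) R := fun x hx =>
    continuousOn_slice hk hx
  -- Compact operators are closed in operator norm, so it suffices to approximate `T`. The
  -- approximants freeze `x` at the nearest point of a finite net of `V`, which gives finite rank.
  have hcl : IsClosed {T : Lp ℝ 2 σ →L[ℝ] Lp ℝ 2 τ | IsCompactOperator T} :=
    isClosed_setOfPred_isCompactOperator
  refine hcl.closure_subset (Metric.mem_closure_iff.2 fun ε hε => ?_)
  have hN := kernelConst_nonneg σ τ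
  -- A kernel error of at most `η` costs at most `η * kernelConst σ τ < ε` in operator norm.
  set η : ℝ := ε / (2 * (kernelConst σ τ + 1)) with hη
  have hη0 : 0 < η := by positivity
  have huc := (hV.prod hR).uniformContinuousOn_of_continuous hk
  obtain ⟨δ, hδ, hδk⟩ := Metric.uniformContinuousOn_iff.1 huc η hη0
  obtain ⟨t, htV, htf, htcov⟩ := hV.finite_cover_balls hδ
  have htne : t.Nonempty := by
    obtain ⟨x, hx⟩ := hne
    obtain ⟨y, hy, -⟩ := mem_iUnion₂.1 (htcov hx)
    exact ⟨y, hy⟩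
  obtain ⟨e, he⟩ := htf.countable.exists_eq_range htne
  have hsub : V ⊆ ⋃ N : ℕ, ⋃ n ≤ N, Metric.ball (e n) δ := by
    intro x hx
    obtain ⟨y, hy, hxy⟩ := mem_iUnion₂.1 (htcov hx)
    rw [he] at hy
    obtain ⟨n, rfl⟩ := hy
    exact mem_iUnion.2 ⟨n, mem_iUnion₂.2 ⟨n, le_rfl, hxy⟩⟩
  obtain ⟨N, hN'⟩ := hV.elim_directed_cover _
    (fun N => isOpen_biUnion fun n _ => Metric.isOpen_ball) hsub
    (directed_of_isDirected_le fun a b hab => biUnion_mono (fun n hn => le_trans hn hab)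
      fun _ _ => le_rfl)
  set c : SimpleFunc (Eu d) (Eu d) := SimpleFunc.nearestPt e N with hc
  have hcV : ∀ x, c x ∈ V := by
    intro x
    have : c x ∈ t := by
      rw [he, hc, SimpleFunc.nearestPt, SimpleFunc.map_apply]
      exact mem_range_self _
    exact htV this
  have hcd : ∀ x ∈ V, dist (c x) x < δ := by
    intro x hx
    obtain ⟨n, hn, hxn⟩ := mem_iUnion₂.1 (hN' hx)
    have h1 := SimpleFunc.edist_nearestPt_le e x hn
    rw [edist_dist, edist_dist, ENNReal.ofReal_le_ofReal_iff dist_nonneg] at h1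
    exact h1.trans_lt (by rw [dist_comm]; exact hxn)
  obtain ⟨T', hT', hT'c⟩ := exists_isKernelOp_simpleFunc (τ := τ) hσ hR (k := k) c
    fun x => hkx _ (hcV x)
  refine ⟨T', hT'c, ?_⟩
  rw [dist_eq_norm]
  have hsub' := hT.sub hσ hR hτ hT' hkx fun x _ => hkx _ (hcV x)
  have := hsub'.norm_le hσ hτ hη0.le fun x hx y hy => by
    have h1 := hδk (x, y) ⟨hx, hy⟩ (c x, y) ⟨hcV x, hy⟩ (by
      rw [Prod.dist_eq, dist_self, max_eq_left dist_nonneg, dist_comm]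
      exact hcd x hx)
    rw [Real.dist_eq] at h1
    exact h1.le
  refine this.trans_lt ?_
  rw [hη, div_mul_eq_mul_div, div_lt_iff₀ (by positivity)]
  nlinarith

end KernelOperators

end KernelInverse

/-! ### Dependence on the parameter -/

namespace KernelInverse

open Filter Topology TopologicalSpace
open scoped NNReal ENNReal

theorem norm_le_norm_of_forall_abs_le {p : ℕ} {z w : Eu p} (h : ∀ i, |z i| ≤ |w i|) :
    ‖z‖ ≤ ‖w‖ := by
  rw [EuclideanSpace.norm_eq, EuclideanSpace.norm_eq]
  refine Real.sqrt_le_sqrt (Finset.sum_le_sum fun i _ => ?_)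
  rw [Real.norm_eq_abs, Real.norm_eq_abs]
  exact pow_le_pow_left₀ (abs_nonneg _) (h i) 2

theorem abs_le_norm {p : ℕ} (z : Eu p) (i : Fin p) : |z i| ≤ ‖z‖ := by
  simpa using PiLp.norm_apply_le z i

/-- A mean value inequality for functions with coordinate derivatives. -/
theorem abs_sub_sub_sum_le {p : ℕ} {φ : Eu p → ℝ} {D : Fin p → Eu p → ℝ} {m₀ w : Eu p} {ε : ℝ}
    {c : Fin p → ℝ}
    (hD : ∀ i, ∀ m ∈ Metric.closedBall m₀ ‖w‖,
      HasLineDerivAt ℝ φ (D i m) m (EuclideanSpace.single i 1))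
    (hc : ∀ i, ∀ m ∈ Metric.closedBall m₀ ‖w‖, |D i m - c i| ≤ ε) :
    |φ (m₀ + w) - φ m₀ - ∑ i, w i * c i| ≤ ε * (p * ‖w‖) := by
  -- Only coordinate derivatives are available, so the path from `m₀` to `m₀ + w` changes one
  -- coordinate at a time; `pt s` is the displacement once the coordinates in `s` have been changed.
  -- Each point of the path has a displacement bounded coordinatewise by `w`, so it stays in the
  -- ball.
  let pt : Finset (Fin p) → Eu p := fun s => WithLp.toLp 2 fun i => if i ∈ s then w i else 0
  have hpt : ∀ s i, pt s i = if i ∈ s then w i else 0 := fun s i => rfl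
  have key : ∀ s : Finset (Fin p),
      |φ (m₀ + pt s) - φ m₀ - ∑ i ∈ s, w i * c i| ≤ ε * ∑ i ∈ s, |w i| := by
    intro s
    induction s using Finset.induction_on with
    | empty =>
      have : pt ∅ = 0 := by ext i; simp [hpt]
      simp [this]
    | insert i s hi ih =>
      let a : Eu p := m₀ + pt s
      let γ : ℝ → Eu p := fun t => a + t • EuclideanSpace.single i (1 : ℝ)
      have hγ1 : γ (w i) = m₀ + pt (insert i s) := by
        ext j
        simp only [γ, a, PiLp.add_apply, PiLp.smul_apply, hpt, smul_eq_mul, Finset.mem_insert]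
        rcases eq_or_ne j i with rfl | hji
        · simp [hi]
        · simp [hji]
      have hγ0 : γ 0 = m₀ + pt s := by simp [γ, a]
      have hmem : ∀ t ∈ uIcc 0 (w i), γ t ∈ Metric.closedBall m₀ ‖w‖ := by
        intro t ht
        rw [mem_closedBall_iff_norm]
        refine norm_le_norm_of_forall_abs_le fun j => ?_
        have : (γ t - m₀) j = (if j ∈ s then w j else 0) + t * (EuclideanSpace.single i (1 : ℝ)) j := by
          simp only [γ, a, PiLp.add_apply, PiLp.sub_apply, PiLp.smul_apply, hpt, smul_eq_mul]
          ring
        rw [this]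
        rcases eq_or_ne j i with rfl | hji
        · simp only [hi, if_false, PiLp.single_apply, if_true, mul_one, zero_add]
          simpa using abs_sub_left_of_mem_uIcc ht
        · simp only [PiLp.single_apply, hji, if_false, mul_zero, add_zero]
          split_ifs <;> simp
      have hder : ∀ t ∈ uIcc 0 (w i), HasDerivWithinAt (fun t => φ (γ t) - t * c i)
          (D i (γ t) - c i) (uIcc 0 (w i)) t := by
        intro t ht
        have h1 : HasDerivAt (fun u : ℝ => φ (γ t + u • EuclideanSpace.single i (1 : ℝ)))
            (D i (γ t)) (t - t) := by
          rw [sub_self]; exact hD i (γ t) (hmem t ht)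
        have h2 : HasDerivAt (fun u : ℝ => φ (γ u)) (D i (γ t)) t := by
          have h3 := HasDerivAt.comp_sub_const t t h1
          refine h3.congr_of_eventuallyEq (Eventually.of_forall fun u => ?_)
          simp only [γ]
          congr 1
          module
        have h4 := h2.sub ((hasDerivAt_id t).mul_const (c i))
        simp only [one_mul] at h4
        exact h4.hasDerivWithinAt
      have hmv := (convex_uIcc 0 (w i)).norm_image_sub_le_of_norm_hasDerivWithin_le hder
        (fun t ht => hc i (γ t) (hmem t ht)) left_mem_uIcc right_mem_uIcc
      rw [Real.norm_eq_abs, Real.norm_eq_abs, hγ1, hγ0, sub_zero, zero_mul, sub_zero] at hmv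
      rw [Finset.sum_insert hi, Finset.sum_insert hi]
      have e : φ (m₀ + pt (insert i s)) - φ m₀ - (w i * c i + ∑ j ∈ s, w j * c j) =
          (φ (m₀ + pt (insert i s)) - w i * c i - φ (m₀ + pt s)) +
            (φ (m₀ + pt s) - φ m₀ - ∑ j ∈ s, w j * c j) := by ring
      rw [e, mul_add]
      exact (abs_add_le _ _).trans (add_le_add hmv ih)
  have huniv : pt Finset.univ = w := by ext i; simp [hpt]
  have h := key Finset.univ
  rw [huniv] at h
  rcases Nat.eq_zero_or_pos p with rfl | hp
  · simpa using h
  have hε : 0 ≤ ε := (abs_nonneg _).trans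
    (hc ⟨0, hp⟩ m₀ (Metric.mem_closedBall_self (norm_nonneg _)))
  refine h.trans (mul_le_mul_of_nonneg_left ?_ hε)
  refine (Finset.sum_le_card_nsmul _ _ _ fun i _ => abs_le_norm w i).trans (le_of_eq ?_)
  simp

section KernelFamily

variable {p d : ℕ} {B B' : Set (Eu p)} {V R : Set (Eu d)} {H : Eu p → Eu d → Eu d → ℝ}

/-- The first order Taylor expansion of a regular kernel in the parameter, uniformly in the
space variables, and the continuity of the kernel for parameters near `m₀`. -/
theorem KernelRegular.exists_derivative (hH : KernelRegular B B' V R H) (hV : IsCompact V)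
    (hR : IsCompact R) {m₀ : Eu p} (hm₀ : m₀ ∈ B) :
    ∃ D : Fin p → Eu d → Eu d → ℝ,
      (∀ i, ContinuousOn (fun z : Eu d × Eu d => D i z.1 z.2) (V ×ˢ R)) ∧
      (∀ ε > 0, ∃ η > 0, ∀ w : Eu p, ‖w‖ ≤ η → ∀ x ∈ V, ∀ y ∈ R,
        |H (m₀ + w) x y - H m₀ x y - ∑ i, w i * D i x y| ≤ ε * ‖w‖) ∧
      ∃ η > 0, ∀ w : Eu p, ‖w‖ ≤ η → ∀ x ∈ V, ContinuousOn (H (m₀ + w) x) R := by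
  choose D hD hDc _ using hH.paramDeriv
  have hm₀' : m₀ ∈ B' := hH.subset hm₀
  obtain ⟨δ, hδ, hδB⟩ := Metric.nhds_basis_closedBall.mem_iff.1 (hH.isOpen.mem_nhds hm₀')
  have huc : ∀ i, UniformContinuousOn (fun z : Eu p × Eu d × Eu d => D i z.1 z.2.1 z.2.2)
      (Metric.closedBall m₀ δ ×ˢ V ×ˢ R) := fun i =>
    ((isCompact_closedBall m₀ δ).prod (hV.prod hR)).uniformContinuousOn_of_continuous
      ((hDc i).mono (prod_mono hδB subset_rfl))
  have huc' : ∀ ε > 0, ∃ η > 0, ∀ i, ∀ z ∈ Metric.closedBall m₀ δ ×ˢ V ×ˢ R,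
      ∀ z' ∈ Metric.closedBall m₀ δ ×ˢ V ×ˢ R, dist z z' < η →
        |D i z.1 z.2.1 z.2.2 - D i z'.1 z'.2.1 z'.2.2| < ε := by
    intro ε hε
    choose η hη h using fun i => Metric.uniformContinuousOn_iff.1 (huc i) ε hε
    obtain ⟨η', hη', hle⟩ : ∃ η' > 0, ∀ i, η' ≤ η i := by
      rcases isEmpty_or_nonempty (Fin p) with _ | _
      · exact ⟨1, one_pos, fun i => isEmptyElim i⟩
      · obtain ⟨j, hj⟩ := Finite.exists_min η
        exact ⟨η j, hη j, hj⟩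
    exact ⟨η', hη', fun i z hz z' hz' hd => h i z hz z' hz' (hd.trans_le (hle i))⟩
  refine ⟨fun i => D i m₀, fun i => ?_, fun ε hε => ?_, δ, hδ, fun w hw x hx => ?_⟩
  · have hc : ContinuousOn (fun z : Eu d × Eu d => ((m₀, z) : Eu p × Eu d × Eu d)) (V ×ˢ R) := by
      fun_prop
    exact (hDc i).comp hc fun z hz => ⟨hm₀', hz⟩
  · obtain ⟨η, hη, h⟩ := huc' (ε / (p + 1)) (by positivity)
    refine ⟨min δ (η / 2), by positivity, fun w hw x hx y hy => ?_⟩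
    have hsub : Metric.closedBall m₀ ‖w‖ ⊆ Metric.closedBall m₀ δ :=
      Metric.closedBall_subset_closedBall (hw.trans (min_le_left _ _))
    have := abs_sub_sub_sum_le (φ := fun m => H m x y) (D := fun i m => D i m x y) (m₀ := m₀)
      (w := w) (ε := ε / (p + 1)) (c := fun i => D i m₀ x y)
      (fun i m hm => hD i m (hδB (hsub hm)) x hx y hy) (fun i m hm => by
        refine (h i (m, x, y) ⟨hsub hm, hx, hy⟩ (m₀, x, y)
          ⟨Metric.mem_closedBall_self hδ.le, hx, hy⟩ ?_).le
        rw [Prod.dist_eq, dist_self, max_eq_left dist_nonneg]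
        have h1 := Metric.mem_closedBall.1 hm
        have h2 := hw.trans (min_le_right _ _)
        linarith)
    refine this.trans ?_
    rw [← mul_assoc]
    refine mul_le_mul_of_nonneg_right ?_ (norm_nonneg _)
    rw [div_mul_eq_mul_div, div_le_iff₀ (by positivity)]
    nlinarith
  -- Off `B`, continuity of the kernel in `y` is not assumed. It is deduced from continuity at `m₀`
  -- and a mean value bound, in the parameter, for `H m x y' - H m x y`, whose derivatives are small
  -- by uniform continuity of `D`.
  · have hH0 : ContinuousOn (H m₀ x) R := by
      have hc : ContinuousOn (fun y : Eu d => ((m₀, x, y) : Eu p × Eu d × Eu d)) R := by fun_prop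
      exact hH.continuousOn.comp hc fun y hy => ⟨hm₀, hx, hy⟩
    have hsub : Metric.closedBall m₀ ‖w‖ ⊆ Metric.closedBall m₀ δ :=
      Metric.closedBall_subset_closedBall hw
    refine Metric.continuousOn_iff.2 fun y hy ε hε => ?_
    obtain ⟨η₁, hη₁, h1⟩ := Metric.continuousOn_iff.1 hH0 y hy (ε / 2) (by positivity)
    obtain ⟨η₂, hη₂, h2⟩ := huc' (ε / (2 * (p * δ + 1))) (by positivity)
    refine ⟨min η₁ η₂, by positivity, fun y' hy' hd => ?_⟩
    have h3 := h1 y' hy' (hd.trans_le (min_le_left _ _))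
    have h4 := abs_sub_sub_sum_le (φ := fun m => H m x y' - H m x y)
      (D := fun i m => D i m x y' - D i m x y) (m₀ := m₀) (w := w)
      (ε := ε / (2 * (p * δ + 1))) (c := 0)
      (fun i m hm => HasDerivAt.sub (hD i m (hδB (hsub hm)) x hx y' hy')
        (hD i m (hδB (hsub hm)) x hx y hy)) (fun i m hm => by
        rw [Pi.zero_apply, sub_zero]
        refine (h2 i (m, x, y') ⟨hsub hm, hx, hy'⟩ (m, x, y) ⟨hsub hm, hx, hy⟩ ?_).le
        rw [Prod.dist_eq, dist_self, Prod.dist_eq, dist_self, max_eq_right dist_nonneg,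
          max_eq_right dist_nonneg]
        exact hd.trans_le (min_le_right _ _))
    simp only [Pi.zero_apply, mul_zero, Finset.sum_const_zero, sub_zero] at h4
    have h5 : ε / (2 * (p * δ + 1)) * (p * ‖w‖) < ε / 2 := by
      rw [div_mul_eq_mul_div, div_lt_div_iff₀ (by positivity) two_pos]
      have : (p : ℝ) * ‖w‖ ≤ p * δ := by gcongr
      nlinarith
    rw [Real.dist_eq] at h3 ⊢
    have h6 : H (m₀ + w) x y' - H (m₀ + w) x y =
        (H (m₀ + w) x y' - H (m₀ + w) x y - (H m₀ x y' - H m₀ x y)) + (H m₀ x y' - H m₀ x y) := by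
      ring
    rw [h6]
    exact (abs_add_le _ _).trans_lt (by linarith)

theorem KernelRegular.continuousOn_kernel (hH : KernelRegular B B' V R H) {m : Eu p} (hm : m ∈ B) :
    ContinuousOn (fun z : Eu d × Eu d => H m z.1 z.2) (V ×ˢ R) := by
  have hc : ContinuousOn (fun z : Eu d × Eu d => ((m, z) : Eu p × Eu d × Eu d)) (V ×ˢ R) := by
    fun_prop
  exact hH.continuousOn.comp hc fun z hz => ⟨hm, hz⟩

variable {σ τ : Measure (Eu d)} [IsFiniteMeasure σ] [IsFiniteMeasure τ]

theorem KernelRegular.continuousOn_op (hH : KernelRegular B B' V R H) (hB : IsCompact B)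
    (hV : IsCompact V) (hR : IsCompact R) (hσ : ∀ᵐ y ∂σ, y ∈ R) (hτ : ∀ᵐ x ∂τ, x ∈ V)
    {A : Eu p → Lp ℝ 2 σ →L[ℝ] Lp ℝ 2 τ} (hA : ∀ m ∈ B, IsKernelOp σ τ (H m) (A m)) :
    ContinuousOn A B := by
  have huc := (hB.prod (hV.prod hR)).uniformContinuousOn_of_continuous hH.continuousOn
  have hN := kernelConst_nonneg σ τ
  refine Metric.continuousOn_iff.2 fun m hm ε hε => ?_
  set η : ℝ := ε / (2 * (kernelConst σ τ + 1)) with hη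
  have hη0 : 0 < η := by positivity
  obtain ⟨δ, hδ, h⟩ := Metric.uniformContinuousOn_iff.1 huc η hη0
  refine ⟨δ, hδ, fun m' hm' hd => ?_⟩
  rw [dist_eq_norm]
  have := ((hA m' hm').sub hσ hR hτ (hA m hm)
    (fun x hx => continuousOn_slice (hH.continuousOn_kernel hm') hx)
    (fun x hx => continuousOn_slice (hH.continuousOn_kernel hm) hx)).norm_le hσ hτ hη0.le
    fun x hx y hy => by
      have h1 := h (m', x, y) ⟨hm', hx, hy⟩ (m, x, y) ⟨hm, hx, hy⟩ (by
        rwa [Prod.dist_eq, dist_self, max_eq_left dist_nonneg])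
      rw [Real.dist_eq] at h1
      exact h1.le
  refine this.trans_lt ?_
  rw [hη, div_mul_eq_mul_div, div_lt_iff₀ (by positivity)]
  nlinarith

/-- The derivative in the parameter of the integral operator, and of the integral itself. -/
theorem KernelRegular.exists_hasFDerivWithinAt (hH : KernelRegular B B' V R H)
    (hV : IsCompact V) (hR : IsCompact R) (hσ : ∀ᵐ y ∂σ, y ∈ R) (hτ : ∀ᵐ x ∂τ, x ∈ V)
    {A : Eu p → Lp ℝ 2 σ →L[ℝ] Lp ℝ 2 τ} (hA : ∀ m ∈ B, IsKernelOp σ τ (H m) (A m))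
    {m₀ : Eu p} (hm₀ : m₀ ∈ B) :
    ∃ A' : Eu p →L[ℝ] Lp ℝ 2 σ →L[ℝ] Lp ℝ 2 τ, HasFDerivWithinAt A A' B m₀ ∧
      ∀ q u, A' q u =ᵐ[τ] fun x => lineDeriv ℝ (fun m => ∫ y, H m x y * u y ∂σ) m₀ q := by
  obtain ⟨D, hDc, hDe, η₀, hη₀, hcont⟩ := hH.exists_derivative hV hR hm₀
  choose T hT using fun i => exists_isKernelOp hσ hR hτ hV (hDc i)
  have hDx : ∀ i, ∀ x ∈ V, ContinuousOn (D i x) R := fun i x hx => continuousOn_slice (hDc i) hx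
  have hN := kernelConst_nonneg σ τ
  let A' : Eu p →L[ℝ] Lp ℝ 2 σ →L[ℝ] Lp ℝ 2 τ :=
    ∑ i, (EuclideanSpace.proj i : Eu p →L[ℝ] ℝ).smulRight (T i)
  have hA' : ∀ q, A' q = ∑ i, q i • T i := fun q => by
    simp [A', _root_.sum_apply]
  have hA'k : ∀ q, IsKernelOp σ τ (fun x y => ∑ i, q i * D i x y) (A' q) := fun q => by
    rw [hA']
    exact IsKernelOp.sum hσ hR hτ Finset.univ (fun i => q i) hT hDx
  have hsumc : ∀ (q : Eu p), ∀ x ∈ V, ContinuousOn (fun y => ∑ i, q i * D i x y) R :=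
    fun q x hx => continuousOn_finsetSum _ fun i _ => continuousOn_const.mul (hDx i x hx)
  refine ⟨A', ?_, fun q u => ?_⟩
  -- The uniform Taylor remainder of the kernel bounds the operator norm of the remainder.
  · rw [hasFDerivWithinAt_iff_isLittleO, Asymptotics.isLittleO_iff]
    intro ε hε
    set ε' : ℝ := ε / (kernelConst σ τ + 1) with hε'
    have hε'0 : 0 < ε' := by positivity
    obtain ⟨η, hη, h⟩ := hDe ε' hε'0
    filter_upwards [mem_nhdsWithin_of_mem_nhds (Metric.closedBall_mem_nhds m₀ hη),
      self_mem_nhdsWithin] with m hm hmB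
    rw [mem_closedBall_iff_norm] at hm
    have hk := (((hA m hmB).sub hσ hR hτ (hA m₀ hm₀)
      (fun x hx => continuousOn_slice (hH.continuousOn_kernel hmB) hx)
      (fun x hx => continuousOn_slice (hH.continuousOn_kernel hm₀) hx)).sub hσ hR hτ
      (hA'k (m - m₀))
      (fun x hx => (continuousOn_slice (hH.continuousOn_kernel hmB) hx).sub
        (continuousOn_slice (hH.continuousOn_kernel hm₀) hx)) (hsumc (m - m₀))).norm_le hσ hτ
      (C := ε' * ‖m - m₀‖) (by positivity) fun x hx y hy => by
        have := h (m - m₀) hm x hx y hy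
        rwa [add_sub_cancel] at this
    refine hk.trans ?_
    rw [hε', div_mul_eq_mul_div, div_mul_eq_mul_div, div_le_iff₀ (by positivity)]
    nlinarith [mul_nonneg hε.le (norm_nonneg (m - m₀))]
  -- The line derivative is taken separately at each `x`. The points `m₀ + t • q` may leave `B`, so
  -- integrability there rests on `hcont`.
  · filter_upwards [hA'k q u, hτ] with x hx hxV
    rw [hx]
    refine (HasLineDerivAt.lineDeriv ?_).symm
    rw [HasLineDerivAt, hasDerivAt_iff_isLittleO, Asymptotics.isLittleO_iff]
    intro ε hε
    set M : ℝ := √(σ.real univ) * ‖u‖ with hM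
    have hM0 : 0 ≤ M := by positivity
    set ε' : ℝ := ε / (‖q‖ * M + 1) with hε'
    have hε'0 : 0 < ε' := by positivity
    obtain ⟨η, hη, h⟩ := hDe ε' hε'0
    have hev : ∀ᶠ t : ℝ in 𝓝 0, ‖t • q‖ ≤ min η η₀ := by
      have : Tendsto (fun t : ℝ => ‖t • q‖) (𝓝 0) (𝓝 ‖(0 : ℝ) • q‖) :=
        (Continuous.norm (by fun_prop)).tendsto 0
      rw [zero_smul, norm_zero] at this
      exact this.eventually_le_const (lt_min hη hη₀)
    filter_upwards [hev] with t ht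
    have i1 := integrable_kernel_mul hσ hR (hcont (t • q) (ht.trans (min_le_right _ _)) x hxV) u
    have i2 := integrable_kernel_mul hσ hR (continuousOn_slice (hH.continuousOn_kernel hm₀) hxV) u
    have i3 := integrable_kernel_mul hσ hR (hsumc (t • q) x hxV) u
    have e1 : ∫ y, (H (m₀ + t • q) x y - H m₀ x y - ∑ i, (t • q) i * D i x y) * u y ∂σ =
        (∫ y, H (m₀ + t • q) x y * u y ∂σ) - (∫ y, H (m₀ + (0 : ℝ) • q) x y * u y ∂σ) -
          (t - 0) • ∫ y, (∑ i, q i * D i x y) * u y ∂σ := by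
      rw [zero_smul, add_zero, sub_zero, smul_eq_mul, ← integral_const_mul]
      have e2 : ∀ y, t * ((∑ i, q i * D i x y) * u y) = (∑ i, (t • q) i * D i x y) * u y := by
        intro y
        rw [← mul_assoc, Finset.mul_sum]
        simp only [PiLp.smul_apply, smul_eq_mul, mul_assoc]
      simp only [e2]
      have i12 : Integrable (fun y => H (m₀ + t • q) x y * u y - H m₀ x y * u y) σ := i1.sub i2
      rw [← integral_sub i1 i2, ← integral_sub i12 i3]
      refine integral_congr_ae (ae_of_all _ fun y => ?_)
      ring
    rw [← e1, Real.norm_eq_abs, sub_zero]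
    refine (abs_integral_kernel_mul_le hσ (C := ε' * ‖t • q‖) (by positivity)
      (fun y hy => h (t • q) (ht.trans (min_le_left _ _)) x hxV y hy) u).trans ?_
    rw [norm_smul, ← hM, hε', div_mul_eq_mul_div, div_mul_eq_mul_div, div_le_iff₀ (by positivity)]
    nlinarith [mul_nonneg hε.le (norm_nonneg t)]

end KernelFamily

end KernelInverse

/-! ### Assembly on `H10` -/

namespace KernelInverse

open Filter Topology TopologicalSpace
open scoped NNReal ENNReal

theorem hasFDerivWithinAt_precomp {M X Y Z : Type*} [NormedAddCommGroup M] [NormedSpace ℝ M]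
    [NormedAddCommGroup X] [NormedSpace ℝ X] [NormedAddCommGroup Y] [NormedSpace ℝ Y]
    [NormedAddCommGroup Z] [NormedSpace ℝ Z] (L : X →L[ℝ] Y) {T : M → Y →L[ℝ] Z}
    {T' : M →L[ℝ] Y →L[ℝ] Z} {B : Set M} {m : M} (h : HasFDerivWithinAt T T' B m) :
    HasFDerivWithinAt (fun m => (T m).comp L) ((ContinuousLinearMap.precomp Z L).comp T') B m :=
  HasFDerivAt.comp_hasFDerivWithinAt (g := ContinuousLinearMap.precomp Z L) m
    (ContinuousLinearMap.hasFDerivAt _) h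

section Assembly

variable {p d r s : ℕ} {R V : Set (Eu d)}

theorem completeSpace_H10 : CompleteSpace (H10 R r) :=
  (Submodule.isClosed_topologicalClosure _).completeSpace_coe

theorem IsCompactManifold.ae_mem_surfaceMeasure {n : ℕ} {S : Set (Eu d)}
    (hS : IsCompactManifold S n) : ∀ᵐ x ∂(surfaceMeasure S n), x ∈ S :=
  ae_restrict_mem hS.isCompact.measurableSet

/-- The map `u ↦ u` from `H¹₀(R)` to `L²(R)`. -/
noncomputable def H10.toLp (R : Set (Eu d)) (r : ℕ) : H10 R r →L[ℝ] Lp ℝ 2 (surfaceMeasure R r) :=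
  (ContinuousLinearMap.fst ℝ _ _).comp (H10 R r).subtypeL

/-- The gradient from `H¹₀(R)` to `L²(R; ℝᵈ)`. -/
noncomputable def H10.grad (R : Set (Eu d)) (r : ℕ) :
    H10 R r →L[ℝ] Lp (Eu d) 2 (surfaceMeasure R r) :=
  (ContinuousLinearMap.snd ℝ _ _).comp (H10 R r).subtypeL

theorem inner_grad (u v : H10 R r) :
    inner ℝ (H10.grad R r u) (H10.grad R r v) = gradInner u v :=
  L2.inner_def _ _

theorem inner_Lp_eq_innerL2 {f g : Lp ℝ 2 (surfaceMeasure V s)} {ψ χ : Eu d → ℝ}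
    (hf : f =ᵐ[surfaceMeasure V s] ψ) (hg : g =ᵐ[surfaceMeasure V s] χ) :
    inner ℝ f g = innerL2 V s ψ χ := by
  rw [L2.inner_def, innerL2]
  refine integral_congr_ae ?_
  filter_upwards [hf, hg] with x h1 h2
  rw [h1, h2]
  exact mul_comm _ _

theorem norm_Lp_eq_normL2 {f : Lp ℝ 2 (surfaceMeasure V s)} {ψ : Eu d → ℝ}
    (hf : f =ᵐ[surfaceMeasure V s] ψ) : ‖f‖ = normL2 V s ψ := by
  rw [normL2, ← Real.sqrt_sq (norm_nonneg f), norm_sq_eq_integral_norm_sq]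
  congr 1
  refine integral_congr_ae ?_
  filter_upwards [hf] with x h
  rw [h, Real.norm_eq_abs]

/-- The adjoint relation tested against `φ` is the form identity. An inclusion suffices, because the
lower bound is proved on the larger span. -/
theorem eigenspan_le_formEigenspan {H : Eu p → Eu d → Eu d → ℝ} {m : Eu p} {β : ℝ}
    {A : H10 R r →L[ℝ] Lp ℝ 2 (surfaceMeasure V s)}
    (hA : ∀ u, A u =ᵐ[surfaceMeasure V s] opA H m u) :
    eigenspan R r V s H β m ≤ formEigenspan (H10.grad R r) A β := by
  refine Submodule.span_mono ?_
  rintro u ⟨lam, hlam, -, hu⟩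
  refine ⟨lam, hlam, fun φ => ?_⟩
  rw [← real_inner_smul_left, ← map_smul, inner_grad, hu φ, inner_Lp_eq_innerL2 (hA u) (hA φ)]

end Assembly

end KernelInverse

open KernelInverse in
theorem mainTheorem4 {p d r s : ℕ} (R V : Set (KernelInverse.Eu d))
    (hR : KernelInverse.IsCompactManifold R r)
    (hRb : KernelInverse.ComponentsHaveBoundary R r)
    (hV : KernelInverse.IsCompactManifold V s)
    (B B' : Set (KernelInverse.Eu p)) (hB : IsCompact B)
    (H : KernelInverse.Eu p → KernelInverse.Eu d → KernelInverse.Eu d → ℝ)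
    (hH : KernelInverse.KernelRegular B B' V R H)
    (hU1 : KernelInverse.UniqueSource B R r V s H)
    (hU2 : KernelInverse.UniqueDerivative B R r V s H)
    (β : ℝ) (hβ : 0 < β)
    (m₀ : KernelInverse.Eu p) (hm₀ : m₀ ∈ B)
    (v₀ : KernelInverse.H10 R r) (hv₀ : v₀ ≠ 0) :
    ∃ C : ℝ, 0 < C ∧ ∀ m ∈ B, ∀ u ∈ KernelInverse.eigenspan R r V s H β m,
      C * ‖m - m₀‖ ≤
        KernelInverse.normL2 V s
          (fun x => KernelInverse.opA H m u x - KernelInverse.opA H m₀ v₀ x) := by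
  have := hR.isFiniteMeasure_surfaceMeasure
  have := hV.isFiniteMeasure_surfaceMeasure
  have : CompleteSpace (H10 R r) := completeSpace_H10
  have hσ := hR.ae_mem_surfaceMeasure
  have hτ := hV.ae_mem_surfaceMeasure
  choose! T hT using fun m (hm : m ∈ B) =>
    exists_isKernelOp hσ hR.isCompact hτ hV.isCompact (hH.continuousOn_kernel hm)
  obtain ⟨T', hT', hT'k⟩ := hH.exists_hasFDerivWithinAt hV.isCompact hR.isCompact hσ hτ hT hm₀
  -- Kernel operators act on `L²(R)`; precomposition with `H10.toLp` restricts them to `H10` and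
  -- preserves continuity, differentiability and compactness.
  let P : (Lp ℝ 2 (surfaceMeasure R r) →L[ℝ] Lp ℝ 2 (surfaceMeasure V s)) →L[ℝ]
      (H10 R r →L[ℝ] Lp ℝ 2 (surfaceMeasure V s)) :=
    ContinuousLinearMap.precomp _ (H10.toLp R r)
  have hPT : HasFDerivWithinAt (fun m => P (T m)) (P.comp T') B m₀ :=
    hasFDerivWithinAt_precomp (H10.toLp R r) hT'
  have hPk : ∀ m ∈ B, ∀ u, P (T m) u =ᵐ[surfaceMeasure V s] opA H m u := fun m hm u =>
    hT m hm (H10.toLp R r u)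
  have hU1' : ∀ m₁ ∈ B, ∀ m₂ ∈ B, ∀ u v, P (T m₁) u = P (T m₂) v → u ≠ 0 ∨ v ≠ 0 →
      m₁ = m₂ ∧ u = v := fun m₁ h₁ m₂ h₂ u v h =>
    hU1 m₁ h₁ m₂ h₂ u v ((hPk m₁ h₁ u).symm.trans (h ▸ hPk m₂ h₂ v))
  have hU2' : ∀ q, ‖q‖ = 1 → ∀ u v, (P.comp T') q u = P (T m₀) v → u = 0 ∧ v = 0 :=
    fun q hq u v h =>
    hU2 q hq m₀ hm₀ u v ((hT'k q (H10.toLp R r u)).symm.trans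
      (show (P.comp T') q u =ᵐ[surfaceMeasure V s] opA H m₀ v from h ▸ hPk m₀ hm₀ v))
  have hinj : ∀ u, P (T m₀) u = 0 → u = 0 := fun u hu => by
    by_contra hne
    exact hne (hU1' m₀ hm₀ m₀ hm₀ u 0 (by rw [hu, map_zero]) (Or.inl hne)).2
  -- The finitely many functionals `ℓ` are exchanged for the injective operator `P (T m₀)`.
  obtain ⟨t, ℓ, c, hc⟩ := hR.exists_H10_estimate
  obtain ⟨c', hc'⟩ := exists_norm_le_of_finiteDimensional (H10.grad R r)
    (ℓ.comp (H10.toLp R r)) (P (T m₀)) hc hinj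
  obtain ⟨C, hC, h⟩ := exists_mul_norm_sub_le hB hm₀ (A := fun m => P (T m)) hc'
    (P.continuous.comp_continuousOn
      (hH.continuousOn_op hB hV.isCompact hR.isCompact hσ hτ hT))
    (fun m hm => ((hT m hm).isCompactOperator hσ hR.isCompact hτ hV.isCompact
      (hH.continuousOn_kernel hm)).comp_clm _)
    hPT hU1' hU2' hβ hv₀
  refine ⟨C, hC, fun m hm u hu => (h m hm u (eigenspan_le_formEigenspan (hPk m hm) hu)).trans_eq
    (norm_Lp_eq_normL2 ?_)⟩
  filter_upwards [Lp.coeFn_sub (P (T m) u) (P (T m₀) v₀), hPk m hm u, hPk m₀ hm₀ v₀] with x h1 h2 h3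
  rw [h1, Pi.sub_apply, h2, h3]
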